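/- Let $\mu$ be the surface measure on $\mathbb S^2\subset\mathbb R^3$ (total mass $4\pi$), let $\{Y_{\ell,k}\}_{k=1}^{2\ell+1}$ be an $L_2(\mathbb S^2)$-orthonormal basis of the real spherical harmonics of degree $\ell$, $\lambda_\ell=\ell(\ell+1)$, and for $\ell\ge1$ put $\mathbf y_{\ell,k}=\lambda_\ell^{-1/2}\mathbf L_*Y_{\ell,k}$ and $\mathbf z_{\ell,k}=\lambda_\ell^{-1/2}\nabla_*Y_{\ell,k}$, where $\nabla_*$ is the surface gradient and $\mathbf L_*=x\times\nabla$ the surface curl. For $\sigma\ge 0$ let $$\|f\|_{H^\sigma}^2=\sum_{\ell\ge0}\sum_k(1+\lambda_\ell)^\sigma\langle f,Y_{\ell,k}\rangle^2,\qquad \|\mathbf f\|_{\mathbf H^\sigma}^2=\sum_{\ell\ge1}\sum_k(1+\lambda_\ell)^\sigma\big(\langle\mathbf f,\mathbf y_{\ell,k}\rangle^2+\langle\mathbf f,\mathbf z_{\ell,k}\rangle^2\big)$$ be the Sobolev norms of scalar functions in $L_2(\mathbb S^2)$ and of tangential fields in $\mathbf L_2(\mathbb S^2)$; $H^\sigma$,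 $\mathbf H^\sigma$ consist of those with finite norm. For $\sigma>1$ elements of these spaces are identified with their continuous representatives. Let $\sigma>1$, $0\le\tau\le\sigma$ and $s=\tau+\sigma$. (QMC designs.) Let $(X_N)$ be a sequence of configurations $X_N=\{x_1,\dots,x_N\}\subset\mathbb S^2$, with $N\to\infty$ along the sequence, of QMC designs for $H^\sigma(\mathbb S^2)$: there is $c_\sigma>0$, independent of $N$, with $\big|\int_{\mathbb S^2}f\,d\mu-\frac{4\pi}N\sum_{j=1}^Nf(x_j)\big|\le c_\sigma N^{-\sigma/2}\|f\|_{H^\sigma}$ for all $f\in H^\sigma(\mathbb S^2)$. (Kernels.) Let $\psi_\rho(x\cdot y)=C_{\psi,\rho}\,\phi(\rho^{-1}\|x-y\|)$, $0<\rho<1$, with $\phi\in C[0,\infty)$ and the constant $C_{\psi,\rho}$ such that $\int_{\mathbb S^2}\psi_\rho(x\cdot y)\,d\mu(y)=1$, and let $\widehat\psi_\rho(\ell)=2\pi\int_{-1}^1\psi_\rho(t)P_\ell(t)\,dt$, $P_\ell$ the Legendre polynomial with $P_\ell(1)=1$. Suppose that * there are $0<\rho_0<1$ and $c_1,c_2>0$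 such that for $0<\rho<\rho_0$ and $\ell_\rho=\lfloor\rho^{-1}-1\rfloor$: $|1-\widehat\psi_\rho(\ell)|\le c_1(\ell\rho)^\sigma$ for $0\le\ell\le\ell_\rho$, and $\widehat\psi_\rho(\ell)\le c_2$ for $\ell>\ell_\rho$; * there is $c_4>0$ such that $|\widehat\psi_\rho(\ell)|\le c_4(1+\rho\ell)^{-s}$ for all $0<\rho<1$ and $\ell\ge1$. With $\kappa_\rho(t)=\frac1{4\pi(1-t^2)}\int_{-1}^t(1-4\pi\psi_\rho(u))\,du$, extended continuously to $[-1,1]$, and $t=x\cdot y$, put $$\Psi_\rho^{\rm div}(x,y)=-\kappa_\rho'(t)(x\times y)(x\times y)^\top+\kappa_\rho(t)(tI-yx^\top),$$ $$\Psi_\rho^{\rm curl}(x,y)=\kappa_\rho'(t)(y-tx)(x-ty)^\top+\kappa_\rho(t)(I-xx^\top)(I-yy^\top)$$ (first terms read as $0$ for $y=\pm x$), and define the components of the quasi-interpolant of $\mathbf f$ by $$(\mathcal L_{\Psi_\rho}\mathbf f)_{\rm div}(x)=\frac{4\pi}N\sum_{j=1}^N\Psi^{\rm div}_\rho(x,x_j)\mathbf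 f(x_j),\qquad(\mathcal L_{\Psi_\rho}\mathbf f)_{\rm curl}(x)=\frac{4\pi}N\sum_{j=1}^N\Psi^{\rm curl}_\rho(x,x_j)\mathbf f(x_j).$$ Then there is a constant $C>0$, independent of $\rho\in(0,1)$, of $N$ and of $\mathbf f$, such that for every tangential field $\mathbf f\in\mathbf H^\sigma(\mathbb S^2)$ with Helmholtz–Hodge decomposition $\mathbf f=\mathbf f_{\rm div}+\mathbf f_{\rm curl}$ (the $\mathbf L_2$-orthogonal projections of $\mathbf f$ onto the divergence-free and the curl-free tangential fields), both errors below belong to $\mathbf H^\tau(\mathbb S^2)$ and $$\|\mathbf f_{\rm div}-(\mathcal L_{\Psi_\rho}\mathbf f)_{\rm div}\|_{\mathbf H^\tau}\le C\big(\rho^{\sigma-\tau}+\rho^{-s}N^{-\sigma/2}\big)\|\mathbf f\|_{\mathbf H^\sigma},$$ $$\|\mathbf f_{\rm curl}-(\mathcal L_{\Psi_\rho}\mathbf f)_{\rm curl}\|_{\mathbf H^\tau}\le C\big(\rho^{\sigma-\tau}+\rho^{-s}N^{-\sigma/2}\big)\|\mathbf f\|_{\mathbf H^\sigma}.$$ 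-/

import Mathlib

open Set Filter Topology MeasureTheory
open scoped Matrix ContDiff RealInnerProductSpace

noncomputable section

namespace SphereQI

/-! ### The sphere, its surface measure, surface gradient and surface curl -/

/-- Euclidean space `ℝ³`. -/
abbrev E3 : Type := EuclideanSpace ℝ (Fin 3)

/-- The unit sphere `𝕊²` in `ℝ³`. -/
abbrev S2 : Type := Metric.sphere (0 : E3) 1

/-- The rotation invariant surface measure on `𝕊²` (total mass `4π`). -/
def surf : Measure S2 := (volume : Measure E3).toSphere

instance surf_isFiniteMeasure : IsFiniteMeasure surf := by
  unfold surf; infer_instance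

/-- The surface gradient `∇_* F (x) = (I - x xᵀ) ∇F(x)` of (the restriction to the sphere of) a
differentiable function `F` on `ℝ³`. -/
def surfGrad (F : E3 → ℝ) (x : S2) : E3 :=
  gradient F x - ⟪(x : E3), gradient F x⟫ • (x : E3)

/-- The surface curl `L_* F (x) = x × ∇F(x)` of (the restriction to the sphere of) a
differentiable function `F` on `ℝ³`. -/
def surfCurl (F : E3 → ℝ) (x : S2) : E3 :=
  WithLp.toLp 2 ((x : E3).ofLp ⨯₃ (gradient F x).ofLp)

/-! ### Scalar and vector spherical harmonics -/

/-- The function on `ℝ³` given by a polynomial in three variables. -/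
def polyFun (p : MvPolynomial (Fin 3) ℝ) (x : E3) : ℝ := MvPolynomial.eval x.ofLp p

theorem continuous_polyFun (p : MvPolynomial (Fin 3) ℝ) : Continuous (polyFun p) :=
  (MvPolynomial.continuous_eval p).comp (PiLp.continuous_ofLp 2 _)

/-- The Laplace operator on polynomials in three variables. -/
def polyLaplacian : MvPolynomial (Fin 3) ℝ →ₗ[ℝ] MvPolynomial (Fin 3) ℝ :=
  ∑ i : Fin 3, (MvPolynomial.pderiv i).toLinearMap ∘ₗ (MvPolynomial.pderiv i).toLinearMap

/-- Harmonic homogeneous polynomials of degree `ℓ` in three variables. -/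
def harmonicPoly (ℓ : ℕ) : Submodule ℝ (MvPolynomial (Fin 3) ℝ) :=
  MvPolynomial.homogeneousSubmodule (Fin 3) ℝ ℓ ⊓ LinearMap.ker polyLaplacian

/-- Restriction of a polynomial to the sphere, as a linear map into `L₂(𝕊²)`. -/
def polyToL2 : MvPolynomial (Fin 3) ℝ →ₗ[ℝ] Lp ℝ 2 surf :=
  (ContinuousMap.toLp (E := ℝ) 2 surf ℝ).toLinearMap ∘ₗ
    { toFun := fun p => (⟨fun x : S2 => polyFun p x,
        (continuous_polyFun p).comp continuous_subtype_val⟩ : C(S2, ℝ))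
      map_add' := fun p q => by ext x; simp [polyFun]
      map_smul' := fun c p => by ext x; simp [polyFun] }

/-- The space `H_ℓ ⊂ L₂(𝕊²)` of spherical harmonics of degree `ℓ`: restrictions to the sphere of
harmonic homogeneous polynomials of degree `ℓ` (its dimension is `2ℓ + 1`). -/
def sphHarm (ℓ : ℕ) : Submodule ℝ (Lp ℝ 2 surf) := (harmonicPoly ℓ).map polyToL2

instance sphHarm_finiteDimensional (ℓ : ℕ) : FiniteDimensional ℝ (sphHarm ℓ) := by
  have h1 : Module.Finite ℝ (MvPolynomial.homogeneousSubmodule (Fin 3) ℝ ℓ) :=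
    Module.Finite.iff_fg.mpr (MvPolynomial.homogeneousSubmodule_fg (σ := Fin 3) (R := ℝ) ℓ)
  have h2 : Module.Finite ℝ (harmonicPoly ℓ) :=
    Submodule.finiteDimensional_of_le (inf_le_left : harmonicPoly ℓ ≤ _)
  unfold sphHarm
  infer_instance

/-- Index set of the orders of the spherical harmonics of degree `ℓ`. -/
abbrev Order (ℓ : ℕ) : Type := Fin (Module.finrank ℝ (sphHarm ℓ))

theorem exists_harmonicPoly (ℓ : ℕ) (k : Order ℓ) :
    ∃ p ∈ harmonicPoly ℓ, polyToL2 p = (stdOrthonormalBasis ℝ (sphHarm ℓ) k : Lp ℝ 2 surf) :=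
  Submodule.mem_map.mp (stdOrthonormalBasis ℝ (sphHarm ℓ) k).2

/-- The real spherical harmonics `Y_{ℓ,k}`, for `k` in the index set an orthonormal basis of `H_ℓ`,
as harmonic homogeneous polynomial functions on `ℝ³`. -/
def Y (ℓ : ℕ) (k : Order ℓ) : E3 → ℝ := polyFun (exists_harmonicPoly ℓ k).choose

/-- The eigenvalue `λ_ℓ = ℓ (ℓ + 1)` of minus the Laplace–Beltrami operator. -/
def eigen (ℓ : ℕ) : ℝ := (ℓ : ℝ) * ((ℓ : ℝ) + 1)

/-- Divergence-free vector spherical harmonics `y_{ℓ,k} = L_* Y_{ℓ,k} / √(ℓ(ℓ+1))`, `ℓ ≥ 1`. -/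
def ydiv (ℓ : ℕ) (k : Order ℓ) (x : S2) : E3 := (√(eigen ℓ))⁻¹ • surfCurl (Y ℓ k) x

/-- Curl-free vector spherical harmonics `z_{ℓ,k} = ∇_* Y_{ℓ,k} / √(ℓ(ℓ+1))`, `ℓ ≥ 1`. -/
def zcurl (ℓ : ℕ) (k : Order ℓ) (x : S2) : E3 := (√(eigen ℓ))⁻¹ • surfGrad (Y ℓ k) x

/-! ### Sobolev spaces -/

/-- The terms (in `ℓ`) of the series for the squared norm of `H^σ(𝕊²)`. -/
def scalarSobolevTerm (σ : ℝ) (f : S2 → ℝ) (ℓ : ℕ) : ℝ :=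
  ∑ k : Order ℓ, (1 + eigen ℓ) ^ σ * (∫ x, f x * Y ℓ k x ∂surf) ^ 2

/-- Membership in the scalar Sobolev space `H^σ(𝕊²)`. -/
def MemScalarSobolev (σ : ℝ) (f : S2 → ℝ) : Prop :=
  MemLp f 2 surf ∧ Summable (scalarSobolevTerm σ f)

/-- The norm of `H^σ(𝕊²)`. -/
def scalarSobolevNorm (σ : ℝ) (f : S2 → ℝ) : ℝ := √(∑' ℓ : ℕ, scalarSobolevTerm σ f ℓ)

/-- The terms (in `ℓ ≥ 1`) of the series for the squared norm of the vectorial Sobolev space. -/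
def vecSobolevTerm (σ : ℝ) (f : S2 → E3) (ℓ : ℕ) : ℝ :=
  ∑ k : Order ℓ, (1 + eigen ℓ) ^ σ *
    ((∫ x, ⟪f x, ydiv ℓ k x⟫ ∂surf) ^ 2 + (∫ x, ⟪f x, zcurl ℓ k x⟫ ∂surf) ^ 2)

/-- Membership in the Sobolev space of tangential vector fields: square integrable, tangential
(almost everywhere), and with finite norm. -/
def MemVecSobolev (σ : ℝ) (f : S2 → E3) : Prop :=
  MemLp f 2 surf ∧ (∀ᵐ x : S2 ∂surf, ⟪(x : E3), f x⟫ = 0) ∧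
    Summable (fun ℓ : ℕ => vecSobolevTerm σ f (ℓ + 1))

/-- The norm of the Sobolev space of tangential vector fields. -/
def vecSobolevNorm (σ : ℝ) (f : S2 → E3) : ℝ := √(∑' ℓ : ℕ, vecSobolevTerm σ f (ℓ + 1))

/-! ### The Helmholtz–Hodge decomposition in `L₂` -/

theorem continuous_gradient {F : E3 → ℝ} (hF : ContDiff ℝ ∞ F) : Continuous (gradient F) :=
  (InnerProductSpace.toDual ℝ E3).symm.continuous.comp (hF.continuous_fderiv (by simp))

theorem continuous_surfGrad {F : E3 → ℝ} (hF : ContDiff ℝ ∞ F) : Continuous (surfGrad F) := by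
  have h : Continuous fun x : S2 => gradient F (x : E3) :=
    (continuous_gradient hF).comp continuous_subtype_val
  unfold surfGrad
  exact h.sub (Continuous.fun_smul (continuous_subtype_val.inner h) continuous_subtype_val)

theorem continuous_surfCurl {F : E3 → ℝ} (hF : ContDiff ℝ ∞ F) : Continuous (surfCurl F) := by
  have h : Continuous fun x : S2 => (gradient F (x : E3)).ofLp :=
    (PiLp.continuous_ofLp 2 _).comp ((continuous_gradient hF).comp continuous_subtype_val)
  have h' : Continuous fun x : S2 => (x : E3).ofLp :=
    (PiLp.continuous_ofLp 2 _).comp continuous_subtype_val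
  unfold surfCurl
  refine (PiLp.continuous_toLp 2 _).comp ?_
  have a := fun i : Fin 3 => (continuous_apply i).comp h
  have b := fun i : Fin 3 => (continuous_apply i).comp h'
  simp only [cross_apply]
  refine continuous_pi fun i => ?_
  fin_cases i
  · exact ((b 1).mul (a 2)).sub ((b 2).mul (a 1))
  · exact ((b 2).mul (a 0)).sub ((b 0).mul (a 2))
  · exact ((b 0).mul (a 1)).sub ((b 1).mul (a 0))

/-- The space of square integrable tangential vector fields. -/
def tangentL2 : Submodule ℝ (Lp E3 2 surf) where
  carrier := {u | ∀ᵐ x : S2 ∂surf, ⟪(x : E3), u x⟫ = 0}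
  zero_mem' := by
    filter_upwards [Lp.coeFn_zero E3 2 surf] with x hx
    exact (congrArg (fun v => ⟪(x : E3), v⟫) hx).trans (inner_zero_right _)
  add_mem' := by
    intro u v hu hv
    filter_upwards [hu, hv, Lp.coeFn_add u v] with x h1 h2 h3
    rw [h3, Pi.add_apply, inner_add_right, h1, h2, add_zero]
  smul_mem' := by
    intro c u hu
    filter_upwards [hu, Lp.coeFn_smul c u] with x h1 h2
    rw [h2, Pi.smul_apply, inner_smul_right, h1, mul_zero]

/-- Integration against a continuous field, as a functional on `L₂`. -/
theorem inner_toLp_eq (g : C(S2, E3)) (u : Lp E3 2 surf) :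
    ⟪ContinuousMap.toLp (E := E3) 2 surf ℝ g, u⟫ = ∫ x, ⟪g x, u x⟫ ∂surf := by
  rw [L2.inner_def]
  refine integral_congr_ae ?_
  filter_upwards [ContinuousMap.coeFn_toLp (p := 2) (𝕜 := ℝ) surf g] with x hx
  rw [hx]

/-- Weakly divergence-free fields: tangential `u` with `∫ ∇_* φ · u = 0` for all smooth `φ`. -/
def divFreeL2 : Submodule ℝ (Lp E3 2 surf) where
  carrier := {u | u ∈ tangentL2 ∧
    ∀ φ : E3 → ℝ, ContDiff ℝ ∞ φ → ∫ x, ⟪surfGrad φ x, u x⟫ ∂surf = 0}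
  zero_mem' := by
    refine ⟨tangentL2.zero_mem, fun φ hφ => ?_⟩
    simpa using (inner_toLp_eq ⟨_, continuous_surfGrad hφ⟩ 0).symm
  add_mem' := by
    rintro u v ⟨hu, hu'⟩ ⟨hv, hv'⟩
    refine ⟨tangentL2.add_mem hu hv, fun φ hφ => ?_⟩
    have h := fun w => inner_toLp_eq ⟨_, continuous_surfGrad hφ⟩ w
    have := h (u + v)
    rw [inner_add_right, h, h] at this
    simpa [hu' φ hφ, hv' φ hφ] using this.symm
  smul_mem' := by
    rintro c u ⟨hu, hu'⟩
    refine ⟨tangentL2.smul_mem c hu, fun φ hφ => ?_⟩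
    have h := fun w => inner_toLp_eq ⟨_, continuous_surfGrad hφ⟩ w
    have := h (c • u)
    rw [inner_smul_right, h] at this
    simpa [hu' φ hφ] using this.symm

/-- Weakly curl-free fields: tangential `u` with `∫ L_* φ · u = 0` for all smooth `φ`. -/
def curlFreeL2 : Submodule ℝ (Lp E3 2 surf) where
  carrier := {u | u ∈ tangentL2 ∧
    ∀ φ : E3 → ℝ, ContDiff ℝ ∞ φ → ∫ x, ⟪surfCurl φ x, u x⟫ ∂surf = 0}
  zero_mem' := by
    refine ⟨tangentL2.zero_mem, fun φ hφ => ?_⟩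
    simpa using (inner_toLp_eq ⟨_, continuous_surfCurl hφ⟩ 0).symm
  add_mem' := by
    rintro u v ⟨hu, hu'⟩ ⟨hv, hv'⟩
    refine ⟨tangentL2.add_mem hu hv, fun φ hφ => ?_⟩
    have h := fun w => inner_toLp_eq ⟨_, continuous_surfCurl hφ⟩ w
    have := h (u + v)
    rw [inner_add_right, h, h] at this
    simpa [hu' φ hφ, hv' φ hφ] using this.symm
  smul_mem' := by
    rintro c u ⟨hu, hu'⟩
    refine ⟨tangentL2.smul_mem c hu, fun φ hφ => ?_⟩
    have h := fun w => inner_toLp_eq ⟨_, continuous_surfCurl hφ⟩ w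
    have := h (c • u)
    rw [inner_smul_right, h] at this
    simpa [hu' φ hφ] using this.symm

theorem isClosed_tangentL2 : IsClosed (tangentL2 : Set (Lp E3 2 surf)) := by
  refine IsSeqClosed.isClosed fun u v hu huv => ?_
  obtain ⟨ns, -, hns⟩ := (tendstoInMeasure_of_tendsto_Lp huv).exists_seq_tendsto_ae
  have hall : ∀ᵐ x : S2 ∂surf, ∀ n, ⟪(x : E3), u n x⟫ = 0 := ae_all_iff.mpr hu
  change ∀ᵐ x : S2 ∂surf, ⟪(x : E3), v x⟫ = 0
  filter_upwards [hns, hall] with x h1 h2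
  have h3 : Tendsto (fun i => ⟪(x : E3), u (ns i) x⟫) atTop (𝓝 ⟪(x : E3), v x⟫) :=
    tendsto_const_nhds.inner h1
  simp only [h2] at h3
  exact tendsto_nhds_unique h3 tendsto_const_nhds

theorem isClosed_divFreeL2 : IsClosed (divFreeL2 : Set (Lp E3 2 surf)) := by
  have h : (divFreeL2 : Set (Lp E3 2 surf)) = (tangentL2 : Set (Lp E3 2 surf)) ∩
      ⋂ (φ : E3 → ℝ) (hφ : ContDiff ℝ ∞ φ),
        {u | ⟪ContinuousMap.toLp (E := E3) 2 surf ℝ ⟨_, continuous_surfGrad hφ⟩, u⟫ = 0} := by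
    ext u
    simp only [inner_toLp_eq, mem_inter_iff, mem_iInter, mem_ofPred_eq, ContinuousMap.coe_mk]
    rfl
  rw [h]
  exact isClosed_tangentL2.inter (isClosed_iInter fun φ => isClosed_iInter fun hφ =>
    isClosed_eq (by fun_prop) continuous_const)

theorem isClosed_curlFreeL2 : IsClosed (curlFreeL2 : Set (Lp E3 2 surf)) := by
  have h : (curlFreeL2 : Set (Lp E3 2 surf)) = (tangentL2 : Set (Lp E3 2 surf)) ∩
      ⋂ (φ : E3 → ℝ) (hφ : ContDiff ℝ ∞ φ),
        {u | ⟪ContinuousMap.toLp (E := E3) 2 surf ℝ ⟨_, continuous_surfCurl hφ⟩, u⟫ = 0} := by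
    ext u
    simp only [inner_toLp_eq, mem_inter_iff, mem_iInter, mem_ofPred_eq, ContinuousMap.coe_mk]
    rfl
  rw [h]
  exact isClosed_tangentL2.inter (isClosed_iInter fun φ => isClosed_iInter fun hφ =>
    isClosed_eq (by fun_prop) continuous_const)

instance divFreeL2_completeSpace : CompleteSpace divFreeL2 :=
  isClosed_divFreeL2.completeSpace_coe

instance curlFreeL2_completeSpace : CompleteSpace curlFreeL2 :=
  isClosed_curlFreeL2.completeSpace_coe

/-- The divergence-free part `f_div = P_div f`: the orthogonal projection in `L₂` of the
(continuous) field `f`. -/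
def divPart (f : C(S2, E3)) : Lp E3 2 surf :=
  divFreeL2.starProjection (ContinuousMap.toLp (E := E3) 2 surf ℝ f)

/-- The curl-free part `f_curl = P_curl f`. -/
def curlPart (f : C(S2, E3)) : Lp E3 2 surf :=
  curlFreeL2.starProjection (ContinuousMap.toLp (E := E3) 2 surf ℝ f)

/-! ### Scaled zonal kernels and the matrix-valued kernels built from them -/

/-- The Legendre polynomial `P_ℓ` (Rodrigues' formula), normalized by `P_ℓ(1) = 1`. -/
def legendre (ℓ : ℕ) : Polynomial ℝ :=
  Polynomial.C ((2 ^ ℓ * (ℓ.factorial : ℝ))⁻¹) *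
    Polynomial.derivative^[ℓ] ((Polynomial.X ^ 2 - 1) ^ ℓ)

/-- The Fourier–Legendre coefficient `ψ̂(ℓ)` of a zonal kernel, normalized so that
`ψ(x · y) = ∑_ℓ (2ℓ+1)/(4π) ψ̂(ℓ) P_ℓ(x · y)`. -/
def legendreCoeff (ψ : ℝ → ℝ) (ℓ : ℕ) : ℝ :=
  2 * Real.pi * ∫ t in (-1 : ℝ)..1, ψ t * (legendre ℓ).eval t

/-- `(ψ_ρ)_{0<ρ<1}` is a family of scaled zonal kernels: `ψ_ρ(x · y) = c_ρ φ(‖x - y‖ / ρ)` for some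
`φ ∈ C[0, ∞)`, with normalizing constants `c_ρ` such that `∫ ψ_ρ(x · y) dμ(y) = 1`. -/
def IsScaledZonalKernel (ψ : ℝ → ℝ → ℝ) : Prop :=
  ∃ (φ : ℝ → ℝ) (c : ℝ → ℝ), ContinuousOn φ (Ici 0) ∧ ∀ ρ ∈ Ioo (0 : ℝ) 1,
    (∀ x y : S2, ψ ρ ⟪(x : E3), (y : E3)⟫ = c ρ * φ (ρ⁻¹ * ‖(x : E3) - (y : E3)‖)) ∧
    (∀ x : S2, ∫ y : S2, ψ ρ ⟪(x : E3), (y : E3)⟫ ∂surf = 1)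

/-- The approximation condition of order `m` on the Fourier–Legendre coefficients, with the
cut-off `ℓ_ρ = ⌊ρ⁻¹ - 1⌋`. -/
def KernelOrder (ψ : ℝ → ℝ → ℝ) (m : ℝ) : Prop :=
  ∃ ρ₀ ∈ Ioo (0 : ℝ) 1, ∃ c₁ > (0 : ℝ), ∃ c₂ > (0 : ℝ), ∀ ρ ∈ Ioo (0 : ℝ) ρ₀,
    (∀ ℓ : ℕ, ℓ ≤ ⌊ρ⁻¹ - 1⌋₊ → |1 - legendreCoeff (ψ ρ) ℓ| ≤ c₁ * ((ℓ : ℝ) * ρ) ^ m) ∧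
    (∀ ℓ : ℕ, ⌊ρ⁻¹ - 1⌋₊ < ℓ → legendreCoeff (ψ ρ) ℓ ≤ c₂)

/-- Algebraic decay of order `s` of the Fourier–Legendre coefficients, uniformly in the scale. -/
def KernelDecay (ψ : ℝ → ℝ → ℝ) (s : ℝ) : Prop :=
  ∃ c > (0 : ℝ), ∀ ρ ∈ Ioo (0 : ℝ) 1, ∀ ℓ : ℕ, 0 < ℓ →
    |legendreCoeff (ψ ρ) ℓ| ≤ c * (1 + ρ * ℓ) ^ (-s)

/-- The auxiliary function `κ(t) = (4π(1-t²))⁻¹ ∫_{-1}^t (1 - 4πψ(s)) ds`, `-1 < t < 1`, extended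
by continuity to `[-1, 1]`. -/
def kappa (ψ : ℝ → ℝ) : ℝ → ℝ :=
  extendFrom (Ioo (-1 : ℝ) 1) fun t =>
    (∫ s in (-1 : ℝ)..t, (1 - 4 * Real.pi * ψ s)) / (4 * Real.pi * (1 - t ^ 2))

/-- `t = x · y`. -/
def dotS (x y : S2) : ℝ := ⟪(x : E3), (y : E3)⟫

/-- `Q(x, y) = -(x × y)(x × y)ᵀ`. -/
def matQ (x y : S2) : Matrix (Fin 3) (Fin 3) ℝ :=
  -Matrix.vecMulVec ((x : E3).ofLp ⨯₃ (y : E3).ofLp) ((x : E3).ofLp ⨯₃ (y : E3).ofLp)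

/-- `R(x, y) = t I - y xᵀ`. -/
def matR (x y : S2) : Matrix (Fin 3) (Fin 3) ℝ :=
  dotS x y • (1 : Matrix (Fin 3) (Fin 3) ℝ) - Matrix.vecMulVec (y : E3).ofLp (x : E3).ofLp

/-- `V(x, y) = (y - t x)(x - t y)ᵀ`. -/
def matV (x y : S2) : Matrix (Fin 3) (Fin 3) ℝ :=
  Matrix.vecMulVec ((y : E3).ofLp - dotS x y • (x : E3).ofLp)
    ((x : E3).ofLp - dotS x y • (y : E3).ofLp)

/-- `W(x, y) = (I - x xᵀ)(I - y yᵀ)`. -/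
def matW (x y : S2) : Matrix (Fin 3) (Fin 3) ℝ :=
  (1 - Matrix.vecMulVec (x : E3).ofLp (x : E3).ofLp) *
    (1 - Matrix.vecMulVec (y : E3).ofLp (y : E3).ofLp)

/-- The divergence-free kernel `Ψ^div = κ'(t) Q + κ(t) R`. As `Q` vanishes for `y = ± x`, the value
of `κ'` at `t = ± 1` plays no role; the formula gives the continuous extension there. -/
def kernelDiv (ψ : ℝ → ℝ) (x y : S2) : Matrix (Fin 3) (Fin 3) ℝ :=
  deriv (kappa ψ) (dotS x y) • matQ x y + kappa ψ (dotS x y) • matR x y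

/-- The curl-free kernel `Ψ^curl = κ'(t) V + κ(t) W`; `V` vanishes for `y = ± x`. -/
def kernelCurl (ψ : ℝ → ℝ) (x y : S2) : Matrix (Fin 3) (Fin 3) ℝ :=
  deriv (kappa ψ) (dotS x y) • matV x y + kappa ψ (dotS x y) • matW x y

/-! ### QMC designs and the quasi-interpolant -/

/-- The equal weight quadrature rule `(4π/N) ∑_j f(x_j)`. -/
def quadrature {N : ℕ} (X : Fin N → S2) (f : S2 → ℝ) : ℝ :=
  4 * Real.pi / N * ∑ j, f (X j)

/-- A sequence of `N n`-point configurations with `N n → ∞` is a sequence of QMC designs for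
`H^σ(𝕊²)`, `σ > 1`. Point evaluation refers to the continuous representative. -/
def IsQMCDesign (σ : ℝ) (N : ℕ → ℕ) (X : ∀ n, Fin (N n) → S2) : Prop :=
  (∀ n, 0 < N n) ∧ Tendsto N atTop atTop ∧
    ∃ c > (0 : ℝ), ∀ (n : ℕ) (f : C(S2, ℝ)), MemScalarSobolev σ f →
      |(∫ x, f x ∂surf) - quadrature (X n) f| ≤
        c * (N n : ℝ) ^ (-(σ / 2)) * scalarSobolevNorm σ f

/-- The divergence-free component `(4π/N) ∑_j Ψ^div(x, x_j) f(x_j)` of the quasi-interpolant. -/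
def quasiDiv (ψ : ℝ → ℝ) {N : ℕ} (X : Fin N → S2) (f : S2 → E3) (x : S2) : E3 :=
  (4 * Real.pi / N) • ∑ j, WithLp.toLp 2 (kernelDiv ψ x (X j) *ᵥ (f (X j)).ofLp)

/-- The curl-free component `(4π/N) ∑_j Ψ^curl(x, x_j) f(x_j)` of the quasi-interpolant. -/
def quasiCurl (ψ : ℝ → ℝ) {N : ℕ} (X : Fin N → S2) (f : S2 → E3) (x : S2) : E3 :=
  (4 * Real.pi / N) • ∑ j, WithLp.toLp 2 (kernelCurl ψ x (X j) *ᵥ (f (X j)).ofLp)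

end SphereQI

end

/-! Applied to a vector `v`, either matrix kernel is the surface curl or surface gradient, in `x`,
of the scalar potential `κ(x·y) (x·w)`, where `w` is a tangent vector at `y` made from `v`. Since
`((1 - t²) κ)' = 1/(4π) - ψ`, a Funk–Hecke argument shows that the kernel acts on vector harmonics
of its own type and degree `ℓ ≥ 1` as multiplication by `ψ̂(ℓ)`, and annihilates the other type
(`integral_kerOf`, `integral_quasi`). Hence the coefficient of the error at a harmonic `y` of degree
`ℓ` is `∫ f·y - ψ̂(ℓ) Q[f·y] = (1 - ψ̂(ℓ)) ∫ f·y + ψ̂(ℓ) (∫ f·y - Q[f·y])`, with `Q` the quadrature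
rule.

The first term is the approximation error of the kernel. The order condition, lowered from exponent
`σ` to `σ - τ` and extended to all degrees and scales by the decay condition, gives `ρ^(σ-τ)`.

The second term is estimated by duality (`sum_quadErr_sq_le`). Write `r` for the quadrature errors
of the products with harmonics, and `T = ∑ w r²` for their weighted square sum, `w = (1+λ)^τ ψ̂²`.
For the finite test field `G = ∑ w r y`, the quadrature error of `f·G` is exactly `T`, so the design
property gives `T ≤ D ‖f·G‖_{H^σ}`. Products obey `‖f·G‖_{H^σ} ≤ C ‖f‖ ‖G‖`, and `‖G‖² = ∑ (1+λ)^σ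
w² r² ≤ B T` with `B = sup (1+λ)^(τ+σ) ψ̂²`, which the decay condition bounds by a multiple of
`ρ^(-2s)`. Dividing by `T` leaves `T ≤ C² D² B ‖f‖²`.

The product estimate (`memScalarSobolev_innerC`) rests on polynomial approximation. The inner
product of two partial sums up to degree `n` is a polynomial of degree at most `2n + 2`, invisible
to higher harmonics; thus the high harmonics of `f·g` are controlled by the `L₂` tails of `f` and
`g` times uniform bounds. The latter come from the pointwise estimate of a harmonic by its `L₂` norm
and from `σ > 1`. Abel summation turns weighted tails into Sobolev norms.

The underlying harmonic analysis is algebraic. The components of `x × ∇` are derivations of the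
polynomial ring, with mean zero on the sphere because they generate rotations. Their sum of squares
yields Green's formula, orthogonality of harmonics and, on zonal functions, Legendre's operator.
Completeness follows from Stone–Weierstrass and the splitting of polynomials into harmonics times
powers of `|x|²`; for vector fields it is reduced to the scalar case by `smul_tangential_eq`. -/

noncomputable section

namespace SphereQI

/-! ### Polynomial calculus -/

/-- Polynomials in three variables. -/
abbrev Poly : Type := MvPolynomial (Fin 3) ℝ

/-- The angular momentum derivation `(x × ∇)_i` on polynomials. -/
def angMom (i : Fin 3) : Derivation ℝ Poly Poly :=
  (MvPolynomial.X (i + 1) : Poly) • MvPolynomial.pderiv (i + 2) -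
    (MvPolynomial.X (i + 2) : Poly) • MvPolynomial.pderiv (i + 1)

/-- The polynomial `|x|²`. -/
def normSqPoly : Poly := ∑ i : Fin 3, MvPolynomial.X i ^ 2

theorem angMom_apply (i : Fin 3) (p : Poly) :
    angMom i p = MvPolynomial.X (i + 1) * MvPolynomial.pderiv (i + 2) p -
      MvPolynomial.X (i + 2) * MvPolynomial.pderiv (i + 1) p := rfl

theorem angMom_zero_apply (p : Poly) : angMom 0 p =
    MvPolynomial.X 1 * MvPolynomial.pderiv 2 p - MvPolynomial.X 2 * MvPolynomial.pderiv 1 p := rfl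

theorem angMom_one_apply (p : Poly) : angMom 1 p =
    MvPolynomial.X 2 * MvPolynomial.pderiv 0 p - MvPolynomial.X 0 * MvPolynomial.pderiv 2 p := rfl

theorem angMom_two_apply (p : Poly) : angMom 2 p =
    MvPolynomial.X 0 * MvPolynomial.pderiv 1 p - MvPolynomial.X 1 * MvPolynomial.pderiv 0 p := rfl

/-- The commutator of two derivations is again a derivation, so it is enough to see it vanish on the
variables. -/
theorem pderiv_comm (i j : Fin 3) (p : Poly) :
    MvPolynomial.pderiv i (MvPolynomial.pderiv j p) =
      MvPolynomial.pderiv j (MvPolynomial.pderiv i p) := by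
  have h : ⁅(MvPolynomial.pderiv i : Derivation ℝ Poly Poly),
      (MvPolynomial.pderiv j : Derivation ℝ Poly Poly)⁆ = 0 := by
    refine MvPolynomial.derivation_ext fun k => ?_
    rw [Derivation.commutator_apply]
    simp [MvPolynomial.pderiv_X, Pi.single_apply, apply_ite]
  have := DFunLike.congr_fun h p
  rw [Derivation.commutator_apply] at this
  exact sub_eq_zero.mp this

theorem polyLaplacian_apply (p : Poly) : polyLaplacian p =
    MvPolynomial.pderiv 0 (MvPolynomial.pderiv 0 p) +
      MvPolynomial.pderiv 1 (MvPolynomial.pderiv 1 p) +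
      MvPolynomial.pderiv 2 (MvPolynomial.pderiv 2 p) := by
  simp [polyLaplacian, Fin.sum_univ_three]

theorem euler_identity {p : Poly} {n : ℕ} (h : p.IsHomogeneous n) :
    MvPolynomial.X 0 * MvPolynomial.pderiv 0 p + MvPolynomial.X 1 * MvPolynomial.pderiv 1 p +
      MvPolynomial.X 2 * MvPolynomial.pderiv 2 p = (n : Poly) * p := by
  rw [← nsmul_eq_mul, ← h.sum_X_mul_pderiv, Fin.sum_univ_three]

/-- The rules to expand derivatives of products of coordinates and derivatives. -/
theorem pderiv_X_mul (i j : Fin 3) (p : Poly) :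
    MvPolynomial.pderiv i (MvPolynomial.X j * p) =
      (if i = j then p else 0) + MvPolynomial.X j * MvPolynomial.pderiv i p := by
  rw [MvPolynomial.pderiv_mul, MvPolynomial.pderiv_X, Pi.single_apply]
  split_ifs <;> simp_all

/-- The Casimir operator of the rotation group acts on homogeneous polynomials as
`|x|² Δ - ℓ (ℓ + 1)`. -/
theorem sum_angMom_angMom {p : Poly} {n : ℕ} (h : p.IsHomogeneous n) :
    ∑ i, angMom i (angMom i p) = normSqPoly * polyLaplacian p - MvPolynomial.C (eigen n) * p := by
  have e1 := euler_identity h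
  have e2 : ∀ i : Fin 3, MvPolynomial.pderiv i (MvPolynomial.X 0 * MvPolynomial.pderiv 0 p +
      MvPolynomial.X 1 * MvPolynomial.pderiv 1 p + MvPolynomial.X 2 * MvPolynomial.pderiv 2 p) =
      (n : Poly) * MvPolynomial.pderiv i p := by
    intro i
    rw [e1, ← nsmul_eq_mul, map_nsmul, nsmul_eq_mul]
  have h0 := e2 0
  have h1 := e2 1
  have h2 := e2 2
  have hc : (MvPolynomial.C (eigen n) : Poly) = (n : Poly) * ((n : Poly) + 1) := by
    simp [eigen]
  rw [hc]
  simp only [map_add, pderiv_X_mul, pderiv_comm 1 0, pderiv_comm 2 0, pderiv_comm 2 1] at h0 h1 h2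
  simp only [Fin.sum_univ_three, angMom_zero_apply, angMom_one_apply, angMom_two_apply, map_sub,
    polyLaplacian_apply, normSqPoly, pderiv_X_mul, pderiv_comm 1 0, pderiv_comm 2 0,
    pderiv_comm 2 1]
  simp at h0 h1 h2 ⊢
  -- The Hessian term `x_i x_j ∂_i ∂_j p` is removed by differentiating Euler's identity, the
  -- remaining first order term by the identity itself.
  linear_combination -MvPolynomial.X 0 * h0 - MvPolynomial.X 1 * h1 - MvPolynomial.X 2 * h2
    - (n + 1 : Poly) * e1

/-- The Laplacian is rotation invariant; consequently the angular momentum derivations preserve each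
space of harmonics. -/
theorem polyLaplacian_angMom (i : Fin 3) (p : Poly) :
    polyLaplacian (angMom i p) = angMom i (polyLaplacian p) := by
  fin_cases i <;>
  · simp only [Fin.zero_eta, Fin.mk_one, Fin.reduceFinMk, angMom_zero_apply, angMom_one_apply,
      angMom_two_apply, map_sub, map_add,
      polyLaplacian_apply, pderiv_X_mul, pderiv_comm 1 0, pderiv_comm 2 0, pderiv_comm 2 1]
    simp [pderiv_comm 1 0, pderiv_comm 2 0, pderiv_comm 2 1]
    ring

/-- This is `(x × ∇) · ∇ = 0`, the source of the orthogonality of curls and gradients. -/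
theorem sum_angMom_pderiv (p : Poly) : ∑ i, angMom i (MvPolynomial.pderiv i p) = 0 := by
  simp only [Fin.sum_univ_three, angMom_zero_apply, angMom_one_apply, angMom_two_apply,
    pderiv_comm 1 0, pderiv_comm 2 0, pderiv_comm 2 1]
  ring

theorem angMom_normSqPoly (i : Fin 3) : angMom i normSqPoly = 0 := by
  fin_cases i <;>
  · simp [angMom_zero_apply, angMom_one_apply, angMom_two_apply, normSqPoly, Fin.sum_univ_three,
      MvPolynomial.pderiv_X]
    try ring

theorem isHomogeneous_angMom (i : Fin 3) {p : Poly} {n : ℕ} (h : p.IsHomogeneous n) :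
    (angMom i p).IsHomogeneous n := by
  cases n with
  -- `n - 1` truncates at `n = 0`, so the degree count below would be wrong for constants, which are
  -- killed anyway.
  | zero =>
    rw [← MvPolynomial.totalDegree_zero_iff_isHomogeneous, MvPolynomial.totalDegree_eq_zero_iff_eq_C]
      at h
    rw [h, angMom_apply]
    simpa using MvPolynomial.isHomogeneous_zero (Fin 3) ℝ 0
  | succ m =>
    have key : ∀ j k : Fin 3, (MvPolynomial.X j * MvPolynomial.pderiv k p).IsHomogeneous (m + 1) := by
      intro j k
      have h1 := (MvPolynomial.isHomogeneous_X ℝ j).mul (h.pderiv (i := k))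
      simpa [add_comm] using h1
    rw [angMom_apply]
    exact (key _ _).sub (key _ _)

theorem mem_harmonicPoly {n : ℕ} {p : Poly} :
    p ∈ harmonicPoly n ↔ p.IsHomogeneous n ∧ polyLaplacian p = 0 := by
  simp [harmonicPoly, Submodule.mem_inf]

theorem angMom_mem_harmonicPoly (i : Fin 3) {p : Poly} {n : ℕ} (h : p ∈ harmonicPoly n) :
    angMom i p ∈ harmonicPoly n := by
  rw [mem_harmonicPoly] at h ⊢
  exact ⟨isHomogeneous_angMom i h.1, by rw [polyLaplacian_angMom, h.2, map_zero]⟩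

theorem sum_angMom_angMom_harmonic {p : Poly} {n : ℕ} (h : p ∈ harmonicPoly n) :
    ∑ i, angMom i (angMom i p) = -(MvPolynomial.C (eigen n) * p) := by
  rw [mem_harmonicPoly] at h
  rw [sum_angMom_angMom h.1, h.2]; ring

/-! ### Polynomial functions and their gradients -/

theorem polyFun_add (p q : Poly) (x : E3) : polyFun (p + q) x = polyFun p x + polyFun q x := by
  simp [polyFun]

theorem polyFun_sub (p q : Poly) (x : E3) : polyFun (p - q) x = polyFun p x - polyFun q x := by
  simp [polyFun]

theorem polyFun_neg (p : Poly) (x : E3) : polyFun (-p) x = -polyFun p x := by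
  simp [polyFun]

theorem polyFun_mul (p q : Poly) (x : E3) : polyFun (p * q) x = polyFun p x * polyFun q x := by
  simp [polyFun]

theorem polyFun_smul (c : ℝ) (p : Poly) (x : E3) : polyFun (c • p) x = c * polyFun p x := by
  simp [polyFun]

theorem polyFun_C (c : ℝ) (x : E3) : polyFun (MvPolynomial.C c) x = c := by
  simp [polyFun]

theorem polyFun_one (x : E3) : polyFun 1 x = 1 := by
  simp [polyFun]

theorem polyFun_zero (x : E3) : polyFun 0 x = 0 := by
  simp [polyFun]

theorem polyFun_X (i : Fin 3) (x : E3) : polyFun (MvPolynomial.X i) x = x i := by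
  simp [polyFun]

theorem polyFun_pow (p : Poly) (n : ℕ) (x : E3) : polyFun (p ^ n) x = polyFun p x ^ n := by
  simp [polyFun]

theorem polyFun_sum {ι : Type*} (s : Finset ι) (p : ι → Poly) (x : E3) :
    polyFun (∑ i ∈ s, p i) x = ∑ i ∈ s, polyFun (p i) x := by
  simp [polyFun]

theorem polyFun_normSqPoly (x : E3) : polyFun normSqPoly x = ‖x‖ ^ 2 := by
  simp [polyFun, normSqPoly, EuclideanSpace.norm_sq_eq]

theorem polyFun_normSqPoly_sphere (x : S2) : polyFun normSqPoly x = 1 := by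
  rw [polyFun_normSqPoly, norm_eq_of_mem_sphere x]; norm_num

theorem inner_eq_sum (x y : E3) : ⟪x, y⟫ = x 0 * y 0 + x 1 * y 1 + x 2 * y 2 := by
  simp [PiLp.inner_apply, Fin.sum_univ_three, mul_comm]

theorem hasGradientAt_polyFun (p : Poly) (x : E3) :
    HasGradientAt (polyFun p) (WithLp.toLp 2 fun i => polyFun (MvPolynomial.pderiv i p) x) x := by
  induction p using MvPolynomial.induction_on with
  | C a =>
    have h : (WithLp.toLp 2 fun i => polyFun (MvPolynomial.pderiv i (MvPolynomial.C a : Poly)) x)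
        = (0 : E3) := by
      ext i; simp [polyFun]
    rw [h]
    have : polyFun (MvPolynomial.C a) = fun _ => a := by funext y; simp [polyFun]
    rw [this]
    exact hasGradientAt_const x a
  | add p q hp hq =>
    rw [hasGradientAt_iff_hasFDerivAt] at hp hq ⊢
    have h := hp.add hq
    rw [← map_add] at h
    convert! h using 2
    · funext y; simp [polyFun]
    · ext i; simp [polyFun]
  | mul_X p j hp =>
    rw [hasGradientAt_iff_hasFDerivAt] at hp ⊢
    have hX : HasFDerivAt (fun y : E3 => y j) (EuclideanSpace.proj j : E3 →L[ℝ] ℝ) x :=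
      (EuclideanSpace.proj j : E3 →L[ℝ] ℝ).hasFDerivAt
    convert! hp.mul hX using 1
    · funext y; simp [polyFun]
    · ext v
      simp [PiLp.inner_apply, Fin.sum_univ_three, polyFun, MvPolynomial.pderiv_X, Pi.single_apply]
      fin_cases j <;> simp <;> ring

theorem gradient_polyFun (p : Poly) (x : E3) :
    gradient (polyFun p) x = WithLp.toLp 2 fun i => polyFun (MvPolynomial.pderiv i p) x :=
  (hasGradientAt_polyFun p x).gradient

theorem contDiff_polyFun (p : Poly) : ContDiff ℝ ∞ (polyFun p) := by
  induction p using MvPolynomial.induction_on with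
  | C a =>
    have : polyFun (MvPolynomial.C a) = fun _ => a := by funext y; simp [polyFun]
    rw [this]; exact contDiff_const
  | add p q hp hq =>
    have : polyFun (p + q) = fun y => polyFun p y + polyFun q y := by funext y; simp [polyFun]
    rw [this]; exact hp.add hq
  | mul_X p j hp =>
    have : polyFun (p * MvPolynomial.X j) = fun y => polyFun p y * y j := by
      funext y; simp [polyFun]
    rw [this]; exact hp.mul (EuclideanSpace.proj j : E3 →L[ℝ] ℝ).contDiff

theorem surfCurl_polyFun (p : Poly) (x : S2) :
    surfCurl (polyFun p) x = WithLp.toLp 2 fun i => polyFun (angMom i p) x := by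
  unfold surfCurl
  rw [gradient_polyFun]
  congr 1
  funext i
  fin_cases i <;>
  simp [cross_apply, angMom_zero_apply, angMom_one_apply, angMom_two_apply, polyFun]

/-! ### Invariance of the surface measure -/

/-- The action of a linear isometry on the sphere. -/
def sphereMap (e : E3 ≃ₗᵢ[ℝ] E3) (x : S2) : S2 :=
  ⟨e x, by rw [mem_sphere_zero_iff_norm, e.norm_map, norm_eq_of_mem_sphere x]⟩

theorem continuous_sphereMap (e : E3 ≃ₗᵢ[ℝ] E3) : Continuous (sphereMap e) :=
  Continuous.subtype_mk (e.continuous.comp continuous_subtype_val) _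

-- The surface measure of a set is defined through the volume of the cone `(0,1) • s` over it. The
-- cone over the preimage is the preimage of the cone, and an isometry preserves volume.
open scoped Pointwise in
theorem measurePreserving_sphereMap (e : E3 ≃ₗᵢ[ℝ] E3) :
    MeasurePreserving (sphereMap e) surf surf := by
  refine ⟨(continuous_sphereMap e).measurable, ?_⟩
  ext s hs
  rw [Measure.map_apply (continuous_sphereMap e).measurable hs]
  unfold surf
  rw [Measure.toSphere_apply' _ hs,
    Measure.toSphere_apply' _ ((continuous_sphereMap e).measurable hs)]
  congr 1
  have h : Ioo (0 : ℝ) 1 • ((↑) '' (sphereMap e ⁻¹' s) : Set E3) =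
      e.toMeasurableEquiv ⁻¹' (Ioo (0 : ℝ) 1 • ((↑) '' s : Set E3)) := by
    ext z
    simp only [Set.mem_smul, mem_image, mem_preimage]
    constructor
    · rintro ⟨r, hr, _, ⟨x, hx, rfl⟩, rfl⟩
      exact ⟨r, hr, _, ⟨_, hx, rfl⟩, by simp [sphereMap]⟩
    · rintro ⟨r, hr, _, ⟨x, hx, rfl⟩, h⟩
      have hx' : sphereMap e (sphereMap e.symm x) = x := by ext1; simp [sphereMap]
      refine ⟨r, hr, _, ⟨sphereMap e.symm x, by rwa [hx'], rfl⟩, ?_⟩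
      have : z = e.symm (r • (x : E3)) := by rw [h]; simp
      rw [this]; simp [sphereMap]
  rw [h]
  exact e.measurePreserving.measure_preimage_equiv _

/-- The rotation by the angle `θ` in the plane of the coordinates `i + 1` and `i + 2`. -/
def rotMap (i : Fin 3) (θ : ℝ) (x : E3) : E3 :=
  WithLp.toLp 2 fun j => if j = i + 1 then Real.cos θ * x (i + 1) - Real.sin θ * x (i + 2)
    else if j = i + 2 then Real.sin θ * x (i + 1) + Real.cos θ * x (i + 2) else x j

theorem norm_rotMap (i : Fin 3) (θ : ℝ) (x : E3) : ‖rotMap i θ x‖ = ‖x‖ := by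
  rw [EuclideanSpace.norm_eq, EuclideanSpace.norm_eq]
  congr 1
  have h := Real.sin_sq_add_cos_sq θ
  fin_cases i
  · simp [rotMap, Fin.sum_univ_three]
    linear_combination (x.ofLp 1 ^ 2 + x.ofLp 2 ^ 2) * h
  · simp [rotMap, Fin.sum_univ_three]
    linear_combination (x.ofLp 0 ^ 2 + x.ofLp 2 ^ 2) * h
  · simp [rotMap, Fin.sum_univ_three]
    linear_combination (x.ofLp 0 ^ 2 + x.ofLp 1 ^ 2) * h

/-- `rotMap` as a linear isometry. -/
def rot (i : Fin 3) (θ : ℝ) : E3 ≃ₗᵢ[ℝ] E3 :=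
  LinearIsometry.toLinearIsometryEquiv
    { toFun := rotMap i θ
      map_add' := fun x y => by
        ext j; simp only [rotMap, PiLp.add_apply]; split_ifs <;> ring
      map_smul' := fun c x => by
        ext j; simp only [rotMap, PiLp.smul_apply, smul_eq_mul, RingHom.id_apply]
        split_ifs <;> ring
      norm_map' := norm_rotMap i θ } rfl

theorem rot_apply (i : Fin 3) (θ : ℝ) (x : E3) : rot i θ x = rotMap i θ x := rfl

theorem surfCurl_apply (F : E3 → ℝ) (x : S2) (i : Fin 3) :
    surfCurl F x i = (x : E3) (i + 1) * gradient F x (i + 2) -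
      (x : E3) (i + 2) * gradient F x (i + 1) := by
  unfold surfCurl
  fin_cases i <;> simp [cross_apply]

/-- The components of the surface curl are the infinitesimal generators of the rotations about the
coordinate axes. -/
theorem hasDerivAt_comp_rot {F : E3 → ℝ} (hF : ContDiff ℝ ∞ F) (i : Fin 3) (x : S2) (θ : ℝ) :
    HasDerivAt (fun θ => F (rot i θ x)) (surfCurl F (sphereMap (rot i θ) x) i) θ := by
  have h1 : HasFDerivAt F (InnerProductSpace.toDual ℝ E3 (gradient F (rot i θ x))) (rot i θ x) :=
    ((hF.differentiable (by simp)) _).hasGradientAt.hasFDerivAt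
  have h2 : HasDerivAt (fun θ => rot i θ (x : E3)) (WithLp.toLp 2 fun j =>
      if j = i + 1 then -Real.sin θ * (x : E3) (i + 1) - Real.cos θ * (x : E3) (i + 2)
      else if j = i + 2 then Real.cos θ * (x : E3) (i + 1) + -Real.sin θ * (x : E3) (i + 2)
      else 0) θ := by
    have hl : HasDerivAt (fun θ => fun j : Fin 3 => rotMap i θ (x : E3) j) (fun j =>
        if j = i + 1 then -Real.sin θ * (x : E3) (i + 1) - Real.cos θ * (x : E3) (i + 2)
        else if j = i + 2 then Real.cos θ * (x : E3) (i + 1) + -Real.sin θ * (x : E3) (i + 2)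
        else 0) θ := by
      rw [hasDerivAt_pi]
      intro j
      simp only [rotMap]
      split_ifs
      · exact ((Real.hasDerivAt_cos θ).mul_const _).sub ((Real.hasDerivAt_sin θ).mul_const _)
      · exact ((Real.hasDerivAt_sin θ).mul_const _).add ((Real.hasDerivAt_cos θ).mul_const _)
      · exact hasDerivAt_const _ _
    exact ((EuclideanSpace.equiv (Fin 3) ℝ).symm.toContinuousLinearMap.hasFDerivAt).comp_hasDerivAt
      θ hl
  have h3 := h1.comp_hasDerivAt θ h2
  refine h3.congr_deriv ?_
  rw [surfCurl_apply, InnerProductSpace.toDual_apply_apply, inner_eq_sum]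
  have : ((sphereMap (rot i θ) x : S2) : E3) = rot i θ x := rfl
  rw [this]
  generalize gradient F (rot i θ x) = g
  rw [rot_apply]
  fin_cases i <;> simp [rotMap] <;> ring

theorem integrable_of_continuous {E : Type*} [NormedAddCommGroup E] {f : S2 → E}
    (hf : Continuous f) : Integrable f surf :=
  hf.integrable_of_hasCompactSupport (HasCompactSupport.of_compactSpace f)

theorem exists_bound_of_continuous {E : Type*} [NormedAddCommGroup E] {f : S2 → E}
    (hf : Continuous f) : ∃ C, ∀ x, ‖f x‖ ≤ C := by
  obtain ⟨C, hC⟩ := isCompact_univ.exists_bound_of_continuousOn hf.continuousOn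
  exact ⟨C, fun x => hC x (mem_univ x)⟩

/-- The components of a surface curl have mean zero. -/
theorem integral_surfCurl {F : E3 → ℝ} (hF : ContDiff ℝ ∞ F) (i : Fin 3) :
    ∫ x, surfCurl F x i ∂surf = 0 := by
  have hc : Continuous fun x : S2 => surfCurl F x i :=
    (EuclideanSpace.proj i : E3 →L[ℝ] ℝ).continuous.comp (continuous_surfCurl hF)
  have hFc : Continuous fun x : S2 => F x := hF.continuous.comp continuous_subtype_val
  obtain ⟨C, hC⟩ := exists_bound_of_continuous hc
  have h1 := hasDerivAt_integral_of_dominated_loc_of_deriv_le (μ := surf) (x₀ := (0 : ℝ))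
    (s := univ) (F := fun θ (x : S2) => F (rot i θ x))
    (F' := fun θ (x : S2) => surfCurl F (sphereMap (rot i θ) x) i) (bound := fun _ => C)
    univ_mem (Eventually.of_forall fun θ =>
      (hFc.comp (continuous_sphereMap (rot i θ))).aestronglyMeasurable)
    (integrable_of_continuous (hFc.comp (continuous_sphereMap (rot i 0))))
    (hc.comp (continuous_sphereMap (rot i 0))).aestronglyMeasurable
    (Eventually.of_forall fun x θ _ => hC _) (integrable_const C)
    (Eventually.of_forall fun x θ _ => hasDerivAt_comp_rot hF i x θ)
  have inv : ∀ (G : S2 → ℝ), Continuous G → ∀ θ, ∫ x, G (sphereMap (rot i θ) x) ∂surf =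
      ∫ x, G x ∂surf := by
    intro G hG θ
    have hm := measurePreserving_sphereMap (rot i θ)
    rw [← hm.map_eq, integral_map hm.measurable.aemeasurable
      (hG.aestronglyMeasurable), hm.map_eq]
  -- By invariance of the measure this function of `θ` is constant, while its derivative at `0` is
  -- the integral in question.
  have h2 : (fun θ => ∫ x : S2, F (rot i θ x) ∂surf) = fun _ => ∫ x : S2, F x ∂surf := by
    funext θ
    exact inv (fun x => F x) hFc θ
  have h3 := h1.2
  rw [h2] at h3
  rw [← inv _ hc 0]
  exact h3.unique (hasDerivAt_const _ _)

theorem surf_real_univ : surf.real univ = 4 * Real.pi := by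
  unfold surf
  rw [Measure.toSphere_real_apply_univ, Measure.real, EuclideanSpace.volume_ball_fin_three]
  simp
  rw [ENNReal.toReal_ofReal (by positivity)]
  ring

/-! ### Integration of polynomials over the sphere -/

theorem continuous_polyFun_sphere (p : Poly) : Continuous fun x : S2 => polyFun p x :=
  (continuous_polyFun p).comp continuous_subtype_val

/-- The integral of a polynomial over the sphere. -/
def sphInt : Poly →ₗ[ℝ] ℝ where
  toFun p := ∫ x : S2, polyFun p x ∂surf
  map_add' p q := by
    simp only [polyFun_add]
    exact integral_add (integrable_of_continuous (continuous_polyFun_sphere p))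
      (integrable_of_continuous (continuous_polyFun_sphere q))
  map_smul' c p := by
    simp only [polyFun_smul, RingHom.id_apply, smul_eq_mul]
    exact integral_const_mul _ _

theorem sphInt_apply (p : Poly) : sphInt p = ∫ x : S2, polyFun p x ∂surf := rfl

theorem sphInt_congr {p q : Poly} (h : ∀ x : S2, polyFun p x = polyFun q x) :
    sphInt p = sphInt q :=
  integral_congr_ae (Eventually.of_forall h)

theorem sphInt_one : sphInt 1 = 4 * Real.pi := by
  simp [sphInt_apply, polyFun_one, surf_real_univ]

theorem sphInt_angMom (i : Fin 3) (p : Poly) : sphInt (angMom i p) = 0 := by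
  have h := integral_surfCurl (contDiff_polyFun p) i
  rw [sphInt_apply]
  simpa only [surfCurl_polyFun] using h

/-- Integration by parts: Leibniz' rule, and `angMom i (p * q)` has mean zero. -/
theorem sphInt_angMom_mul (i : Fin 3) (p q : Poly) :
    sphInt (angMom i p * q) = -sphInt (p * angMom i q) := by
  have h := sphInt_angMom i (p * q)
  rw [Derivation.leibniz, map_add, smul_eq_mul, smul_eq_mul, mul_comm q] at h
  linarith

theorem sphInt_C_mul (c : ℝ) (p : Poly) : sphInt (MvPolynomial.C c * p) = c * sphInt p := by
  rw [← MvPolynomial.smul_eq_C_mul, map_smul, smul_eq_mul]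

/-- Green's formula on the sphere for harmonic polynomials. -/
theorem sphInt_sum_angMom_mul_angMom {q : Poly} {n : ℕ} (hq : q ∈ harmonicPoly n) (p : Poly) :
    sphInt (∑ i, angMom i p * angMom i q) = eigen n * sphInt (p * q) := by
  have h : ∑ i, p * angMom i (angMom i q) = -(MvPolynomial.C (eigen n) * (p * q)) := by
    rw [← Finset.mul_sum, sum_angMom_angMom_harmonic hq]; ring
  calc sphInt (∑ i, angMom i p * angMom i q)
      = -sphInt (∑ i, p * angMom i (angMom i q)) := by
        simp only [map_sum, sphInt_angMom_mul, Finset.sum_neg_distrib]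
    _ = _ := by rw [h, map_neg, sphInt_C_mul, neg_neg]

theorem eigen_strictMono : StrictMono eigen := by
  intro a b h
  have : (a : ℝ) < b := by exact_mod_cast h
  have ha : (0 : ℝ) ≤ a := a.cast_nonneg
  unfold eigen
  nlinarith

theorem eigen_nonneg (n : ℕ) : 0 ≤ eigen n := by unfold eigen; positivity

theorem eigen_pos {n : ℕ} (h : 0 < n) : 0 < eigen n := by
  have : (0 : ℝ) < n := by exact_mod_cast h
  unfold eigen; positivity

/-- Green's formula may be read with either factor as the eigenfunction; the two eigenvalues differ.
-/
theorem sphInt_mul_eq_zero {p q : Poly} {m n : ℕ} (hp : p ∈ harmonicPoly m)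
    (hq : q ∈ harmonicPoly n) (h : m ≠ n) : sphInt (p * q) = 0 := by
  have h1 := sphInt_sum_angMom_mul_angMom hq p
  have h2 := sphInt_sum_angMom_mul_angMom hp q
  simp only [mul_comm (angMom _ q), mul_comm q p] at h2
  have h3 : (eigen m - eigen n) * sphInt (p * q) = 0 := by linarith
  rcases mul_eq_zero.mp h3 with h4 | h4
  · exact absurd (eigen_strictMono.injective (sub_eq_zero.mp h4)) h
  · exact h4

/-! ### Legendre polynomials -/

theorem polynomial_C_two : (Polynomial.C 2 : Polynomial ℝ) = 2 := rfl

theorem iterate_derivative_X_mul_succ (m : ℕ) (w : Polynomial ℝ) :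
    Polynomial.derivative^[m + 1] (Polynomial.X * w) =
      Polynomial.X * Polynomial.derivative^[m + 1] w +
        ((m : Polynomial ℝ) + 1) * Polynomial.derivative^[m] w := by
  induction m with
  | zero => simp [Polynomial.derivative_mul]; ring
  | succ m ih =>
    rw [Function.iterate_succ_apply', ih]
    simp only [Polynomial.derivative_add, Polynomial.derivative_mul, Polynomial.derivative_X,
      Polynomial.derivative_one, Polynomial.derivative_natCast, Function.iterate_succ_apply',
      Nat.cast_add, Nat.cast_one]
    ring

theorem iterate_derivative_X_sq_sub_one_mul (m : ℕ) (w : Polynomial ℝ) :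
    Polynomial.derivative^[m + 1] ((Polynomial.X ^ 2 - 1) * Polynomial.derivative w) =
      (Polynomial.X ^ 2 - 1) * Polynomial.derivative^[m + 2] w +
        2 * ((m : Polynomial ℝ) + 1) * Polynomial.X * Polynomial.derivative^[m + 1] w +
        (m : Polynomial ℝ) * ((m : Polynomial ℝ) + 1) * Polynomial.derivative^[m] w := by
  induction m with
  | zero =>
    simp [Polynomial.derivative_mul, Polynomial.derivative_pow, polynomial_C_two]; ring
  | succ m ih =>
    rw [Function.iterate_succ_apply', ih]
    simp only [Polynomial.derivative_add, Polynomial.derivative_mul, Polynomial.derivative_X,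
      Polynomial.derivative_sub, Polynomial.derivative_pow, Polynomial.derivative_ofNat,
      Polynomial.derivative_one, Polynomial.derivative_natCast, Function.iterate_succ_apply',
      Nat.cast_add, Nat.cast_one]
    simp [polynomial_C_two]
    ring

/-- The operator `h ↦ (1 - t²) h'' - 2 t h' + ℓ (ℓ + 1) h` of Legendre's equation. -/
def legendreOp (n : ℕ) (h : Polynomial ℝ) : Polynomial ℝ :=
  (1 - Polynomial.X ^ 2) * Polynomial.derivative (Polynomial.derivative h) -
    2 * Polynomial.X * Polynomial.derivative h + Polynomial.C (eigen n) * h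

theorem C_eigen (n : ℕ) :
    (Polynomial.C (eigen n) : Polynomial ℝ) = (n : Polynomial ℝ) * ((n : Polynomial ℝ) + 1) := by
  simp [eigen]

/-- `u = (X² - 1)ⁿ` satisfies `(X² - 1) u' = 2 n X u`; differentiating `n + 1` times gives
Legendre's equation for the `n`-th derivative of `u`. -/
theorem legendreOp_legendre (n : ℕ) : legendreOp n (legendre n) = 0 := by
  set u : Polynomial ℝ := (Polynomial.X ^ 2 - 1) ^ n with hu
  have h1 : (Polynomial.X ^ 2 - 1) * Polynomial.derivative u =
      Polynomial.X * (2 * (n : Polynomial ℝ) * u) := by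
    cases n with
    | zero => simp [hu]
    | succ k =>
      rw [hu, Polynomial.derivative_pow]
      simp
      ring
  have h2 := congrArg (Polynomial.derivative^[n + 1]) h1
  have h3 : ∀ m, Polynomial.derivative^[m] (2 * (n : Polynomial ℝ) * u) =
      2 * (n : Polynomial ℝ) * Polynomial.derivative^[m] u := by
    intro m
    have : (2 * (n : Polynomial ℝ) : Polynomial ℝ) = Polynomial.C (2 * (n : ℝ)) := by
      simp [polynomial_C_two]
    rw [this, Polynomial.iterate_derivative_C_mul]
  rw [iterate_derivative_X_sq_sub_one_mul, iterate_derivative_X_mul_succ, h3, h3] at h2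
  have hv : legendre n = Polynomial.C ((2 ^ n * (n.factorial : ℝ))⁻¹) *
    Polynomial.derivative^[n] u := rfl
  rw [legendreOp, hv, C_eigen]
  simp only [Polynomial.derivative_C_mul, ← Function.iterate_succ_apply']
  linear_combination -Polynomial.C ((2 ^ n * (n.factorial : ℝ))⁻¹) * h2

/-- At an `n`-fold zero only the term in which all `n` derivatives fall on the power survives. With
`q = (X + 1)ⁿ` this normalizes the Legendre polynomials at `1`. -/
theorem eval_iterate_derivative_sub_pow_mul (a : ℝ) (n : ℕ) (q : Polynomial ℝ) :
    (Polynomial.derivative^[n] ((Polynomial.X - Polynomial.C a) ^ n * q)).eval a =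
      n.factorial * q.eval a := by
  induction n generalizing q with
  | zero => simp
  | succ n ih =>
    have : Polynomial.derivative ((Polynomial.X - Polynomial.C a) ^ (n + 1) * q) =
        (Polynomial.X - Polynomial.C a) ^ n * (((n : Polynomial ℝ) + 1) * q +
          (Polynomial.X - Polynomial.C a) * Polynomial.derivative q) := by
      rw [Polynomial.derivative_mul, Polynomial.derivative_pow]
      simp
      ring
    rw [Function.iterate_succ_apply, this, ih]
    simp [Nat.factorial_succ]
    ring

theorem legendre_eval_one (n : ℕ) : (legendre n).eval 1 = 1 := by
  have h : ((Polynomial.X ^ 2 - 1) ^ n : Polynomial ℝ) =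
      (Polynomial.X - Polynomial.C 1) ^ n * (Polynomial.X + 1) ^ n := by
    rw [← mul_pow]; congr 1; simp; ring
  rw [legendre, h, Polynomial.eval_mul, eval_iterate_derivative_sub_pow_mul]
  have : (n.factorial : ℝ) ≠ 0 := by exact_mod_cast n.factorial_ne_zero
  simp
  norm_num
  field_simp

theorem natDegree_legendre_le (n : ℕ) : (legendre n).natDegree ≤ n := by
  refine (Polynomial.natDegree_C_mul_le _ _).trans ?_
  refine (Polynomial.natDegree_iterate_derivative _ _).trans ?_
  have h : ((Polynomial.X ^ 2 - 1) ^ n : Polynomial ℝ).natDegree ≤ n * 2 := by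
    refine Polynomial.natDegree_pow_le_of_le n ?_
    exact (Polynomial.natDegree_sub_le _ _).trans (by simp)
  omega

theorem integral_eval_derivative (q : Polynomial ℝ) (a b : ℝ) :
    ∫ t in a..b, q.derivative.eval t = q.eval b - q.eval a :=
  intervalIntegral.integral_eq_sub_of_hasDerivAt (fun t _ => q.hasDerivAt t)
    (q.derivative.continuous.intervalIntegrable _ _)

theorem polynomial_intervalIntegrable (q : Polynomial ℝ) (a b : ℝ) :
    IntervalIntegrable (fun t => q.eval t) volume a b :=
  q.continuous.intervalIntegrable _ _

/-- Integration over `[-1, 1]`. -/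
def polyInt : Polynomial ℝ →ₗ[ℝ] ℝ where
  toFun h := ∫ t in (-1 : ℝ)..1, h.eval t
  map_add' p q := by
    simp only [Polynomial.eval_add]
    exact intervalIntegral.integral_add (polynomial_intervalIntegrable p _ _)
      (polynomial_intervalIntegrable q _ _)
  map_smul' c p := by
    simp only [Polynomial.eval_smul, smul_eq_mul, RingHom.id_apply]
    exact intervalIntegral.integral_const_mul _ _

theorem polyInt_apply (h : Polynomial ℝ) : polyInt h = ∫ t in (-1 : ℝ)..1, h.eval t := rfl

theorem polyInt_derivative (q : Polynomial ℝ) :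
    polyInt (Polynomial.derivative q) = q.eval 1 - q.eval (-1) :=
  integral_eval_derivative q _ _

/-- Integration over `[-1, 1]` against a Legendre polynomial. -/
def legendreInt (n : ℕ) : Polynomial ℝ →ₗ[ℝ] ℝ :=
  polyInt ∘ₗ LinearMap.mulRight ℝ (legendre n)

theorem legendreInt_apply (n : ℕ) (h : Polynomial ℝ) :
    legendreInt n h = polyInt (h * legendre n) := rfl

/-- The Legendre operator is symmetric. -/
theorem polyInt_legendreOp_mul (n : ℕ) (h g : Polynomial ℝ) :
    polyInt (legendreOp n h * g) = polyInt (h * legendreOp n g) := by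
  -- Lagrange's identity: the difference is the derivative of the Wronskian times `1 - X²`, which
  -- vanishes at both endpoints.
  have h1 : legendreOp n h * g - h * legendreOp n g = Polynomial.derivative
      ((1 - Polynomial.X ^ 2) *
        (Polynomial.derivative h * g - h * Polynomial.derivative g)) := by
    simp only [legendreOp, Polynomial.derivative_mul, Polynomial.derivative_sub,
      Polynomial.derivative_one, Polynomial.derivative_X_pow]
    simp [polynomial_C_two]
    ring
  have h2 := congrArg polyInt h1
  rw [polyInt_derivative, map_sub] at h2
  simp at h2
  linarith

theorem legendreInt_legendreOp (n : ℕ) (h : Polynomial ℝ) :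
    legendreInt n (legendreOp n h) = 0 := by
  rw [legendreInt_apply, polyInt_legendreOp_mul, legendreOp_legendre, mul_zero, map_zero]

/-- On monomials the operator is triangular with diagonal entries `λ_n - λ_k`, which vanish only for
`k = n`. A functional that kills its range is therefore determined by its value at `X ^ n`. -/
theorem legendreOp_X_pow (n k : ℕ) : legendreOp n (Polynomial.X ^ k) =
    ((k : ℝ) * (k - 1)) • Polynomial.X ^ (k - 2) + (eigen n - eigen k) • Polynomial.X ^ k := by
  rw [legendreOp]
  simp only [Polynomial.smul_eq_C_mul, map_sub, map_mul]
  rw [C_eigen, C_eigen]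
  rcases k with _ | _ | k
  · simp
  · simp; ring
  · simp [Polynomial.derivative_pow]
    ring

/-- The recursion expresses the value at `X ^ k` by that at `X ^ (k - 2)` unless `k = n`, so the
value at `X ^ n` matters only from degree `n` on. -/
theorem functional_X_pow_eq_zero {n : ℕ} {Λ : Polynomial ℝ →ₗ[ℝ] ℝ}
    (hΛ : ∀ h, Λ (legendreOp n h) = 0) (k : ℕ) (hk : n ≤ k → Λ (Polynomial.X ^ n) = 0) :
    Λ (Polynomial.X ^ k) = 0 := by
  induction k using Nat.strong_induction_on with
  | _ k ih =>
    by_cases hkn : k = n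
    · rw [hkn]; exact hk hkn.ge
    have h1 := hΛ (Polynomial.X ^ k)
    rw [legendreOp_X_pow, map_add, map_smul, map_smul, smul_eq_mul, smul_eq_mul] at h1
    have h2 : (k : ℝ) * (k - 1) * Λ (Polynomial.X ^ (k - 2)) = 0 := by
      rcases k with _ | _ | k
      · simp
      · simp
      · rw [ih (k + 2 - 2) (by omega) fun h => hk (by omega), mul_zero]
    rw [h2, zero_add] at h1
    refine (mul_eq_zero.mp h1).resolve_left ?_
    exact fun h => hkn (eigen_strictMono.injective (sub_eq_zero.mp h)).symm

theorem functional_eq_zero_of_degree_lt {n : ℕ} {Λ : Polynomial ℝ →ₗ[ℝ] ℝ}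
    (hΛ : ∀ h, Λ (legendreOp n h) = 0) {p : Polynomial ℝ} (hp : p.degree < n) : Λ p = 0 := by
  rw [p.as_sum_range_C_mul_X_pow, map_sum]
  refine Finset.sum_eq_zero fun i hi => ?_
  rw [← Polynomial.smul_eq_C_mul, map_smul]
  by_cases hc : p.coeff i = 0
  · rw [hc, zero_smul]
  have : i < n := by exact_mod_cast (Polynomial.le_degree_of_ne_zero hc).trans_lt hp
  rw [functional_X_pow_eq_zero hΛ i fun h => absurd h (by omega), smul_zero]

theorem functional_eq_zero {n : ℕ} {Λ : Polynomial ℝ →ₗ[ℝ] ℝ}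
    (hΛ : ∀ h, Λ (legendreOp n h) = 0) (hn : Λ (Polynomial.X ^ n) = 0) (p : Polynomial ℝ) :
    Λ p = 0 := by
  rw [p.as_sum_range_C_mul_X_pow, map_sum]
  refine Finset.sum_eq_zero fun i _ => ?_
  rw [← Polynomial.smul_eq_C_mul, map_smul, functional_X_pow_eq_zero hΛ i fun _ => hn, smul_zero]

/-- In `r = (1 + X) P' - n P` the coefficient of `Xⁿ` cancels, so `r` is orthogonal to `P`.
Integrating `((1 + X) P²)' = (2n + 1) P² + 2 r P` over `[-1, 1]` then gives `2 = (2n + 1) ∫ P²`. -/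
theorem legendreInt_legendre (n : ℕ) : legendreInt n (legendre n) = 2 / (2 * n + 1) := by
  set P := legendre n with hP
  set r : Polynomial ℝ := (1 + Polynomial.X) * Polynomial.derivative P -
    (n : Polynomial ℝ) * P with hr
  have hdeg : r.degree < n := by
    rw [Polynomial.degree_lt_iff_coeff_zero]
    intro m hm
    have hc : ∀ j, n < j → P.coeff j = 0 := fun j hj =>
      Polynomial.coeff_eq_zero_of_natDegree_lt ((natDegree_legendre_le n).trans_lt hj)
    rw [hr, add_mul, one_mul, Polynomial.coeff_sub, Polynomial.coeff_add,
      Polynomial.coeff_natCast_mul, Polynomial.coeff_derivative, hc _ (by omega)]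
    cases m with
    | zero =>
      obtain rfl : n = 0 := by omega
      simp
    | succ m =>
      rw [Polynomial.coeff_X_mul, Polynomial.coeff_derivative]
      rcases hm.lt_or_eq with h | h
      · rw [hc _ h]; ring
      · rw [h]; push_cast; ring
  have h1 := functional_eq_zero_of_degree_lt (legendreInt_legendreOp n) hdeg
  have h2 := polyInt_derivative ((1 + Polynomial.X) * P ^ 2)
  have h3 : Polynomial.derivative ((1 + Polynomial.X) * P ^ 2) =
      (2 * (n : ℝ) + 1) • (P * P) + (2 : ℝ) • (r * P) := by
    rw [hr]
    simp only [Polynomial.smul_eq_C_mul, Polynomial.derivative_mul, Polynomial.derivative_pow]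
    simp
    rw [polynomial_C_two]; ring
  rw [h3, map_add, map_smul, map_smul] at h2
  rw [legendreInt_apply, ← hP] at h1
  rw [h1] at h2
  simp [hP, legendre_eval_one] at h2
  rw [legendreInt_apply, eq_div_iff (by positivity)]
  linarith

/-! ### Zonal polynomials -/

/-- The linear form `x ↦ x · y`. -/
def linPoly (y : E3) : Poly := ∑ i, MvPolynomial.C (y i) * MvPolynomial.X i

theorem polyFun_linPoly (y x : E3) : polyFun (linPoly y) x = ⟪x, y⟫ := by
  simp [linPoly, Fin.sum_univ_three, polyFun, inner_eq_sum, mul_comm]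

theorem linPoly_mem_harmonicPoly (y : E3) : linPoly y ∈ harmonicPoly 1 := by
  rw [mem_harmonicPoly]
  constructor
  · refine MvPolynomial.IsHomogeneous.sum _ _ _ fun i _ => ?_
    exact (MvPolynomial.isHomogeneous_X ℝ i).C_mul _
  · simp [polyLaplacian_apply, linPoly, Fin.sum_univ_three, MvPolynomial.pderiv_X]

theorem pderiv_linPoly (i : Fin 3) (y : E3) :
    MvPolynomial.pderiv i (linPoly y) = MvPolynomial.C (y i) := by
  fin_cases i <;> simp [linPoly, Fin.sum_univ_three, MvPolynomial.pderiv_X]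

/-- The zonal polynomial `x ↦ h (x · y)`. -/
def zonal (h : Polynomial ℝ) (y : E3) : Poly := Polynomial.aeval (linPoly y) h

theorem polyFun_zonal (h : Polynomial ℝ) (y x : E3) : polyFun (zonal h y) x = h.eval ⟪x, y⟫ := by
  rw [← polyFun_linPoly, zonal]
  induction h using Polynomial.induction_on' with
  | add p q hp hq => simp only [map_add, polyFun_add, hp, hq, Polynomial.eval_add]
  | monomial n a => simp [Polynomial.aeval_monomial, polyFun]

theorem angMom_zonal (i : Fin 3) (h : Polynomial ℝ) (y : E3) :
    angMom i (zonal h y) = zonal (Polynomial.derivative h) y * angMom i (linPoly y) := by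
  rw [zonal, Derivation.map_aeval, smul_eq_mul, zonal]

theorem sum_angMom_linPoly_sq (x y : S2) :
    ∑ i, polyFun (angMom i (linPoly y)) x ^ 2 = 1 - ⟪(x : E3), y⟫ ^ 2 := by
  have hx : ‖(x : E3)‖ ^ 2 = 1 := by rw [norm_eq_of_mem_sphere x]; norm_num
  have hy : ‖(y : E3)‖ ^ 2 = 1 := by rw [norm_eq_of_mem_sphere y]; norm_num
  rw [← real_inner_self_eq_norm_sq, inner_eq_sum] at hx hy
  simp only [Fin.sum_univ_three, angMom_zero_apply, angMom_one_apply, angMom_two_apply,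
    pderiv_linPoly, polyFun_sub, polyFun_mul, polyFun_C, polyFun_X, inner_eq_sum]
  linear_combination (y.1 0 * y.1 0 + y.1 1 * y.1 1 + y.1 2 * y.1 2) * hx + hy

/-- Chain rule for the Casimir operator: with `t = x · y` the squares of the first derivatives of
`t` sum to `1 - t²`, and the second derivatives to `-2 t`, `t` being a harmonic of degree one. -/
theorem polyFun_sum_angMom_zonal (h : Polynomial ℝ) (x y : S2) :
    polyFun (∑ i, angMom i (angMom i (zonal h y))) x =
      (legendreOp 0 h).eval ⟪(x : E3), y⟫ := by
  have h1 : ∑ i, angMom i (angMom i (zonal h y)) =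
      zonal (Polynomial.derivative (Polynomial.derivative h)) y *
        ∑ i, angMom i (linPoly y) ^ 2 +
      zonal (Polynomial.derivative h) y * ∑ i, angMom i (angMom i (linPoly y)) := by
    rw [Finset.mul_sum, Finset.mul_sum, ← Finset.sum_add_distrib]
    refine Finset.sum_congr rfl fun i _ => ?_
    rw [angMom_zonal, Derivation.leibniz, angMom_zonal, smul_eq_mul, smul_eq_mul]
    ring
  rw [h1, sum_angMom_angMom_harmonic (linPoly_mem_harmonicPoly y), polyFun_add, polyFun_mul,
    polyFun_mul, polyFun_sum]
  simp only [polyFun_pow]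
  rw [sum_angMom_linPoly_sq, polyFun_neg, polyFun_mul, polyFun_C, polyFun_zonal, polyFun_zonal,
    polyFun_linPoly]
  simp [legendreOp, eigen]
  ring

/-! ### The Funk–Hecke formula -/

/-- Integration of a zonal function against a polynomial. -/
def zonalInt (y : E3) (q : Poly) : Polynomial ℝ →ₗ[ℝ] ℝ :=
  sphInt ∘ₗ LinearMap.mulRight ℝ q ∘ₗ (Polynomial.aeval (linPoly y)).toLinearMap

theorem zonalInt_apply (y : E3) (q : Poly) (h : Polynomial ℝ) :
    zonalInt y q h = sphInt (zonal h y * q) := rfl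

/-- Two integrations by parts move the Casimir operator from the zonal function to `q`, where it is
multiplication by `-λ_n`. -/
theorem zonalInt_legendreOp {n : ℕ} {q : Poly} (hq : q ∈ harmonicPoly n) (y : S2)
    (h : Polynomial ℝ) : zonalInt y q (legendreOp n h) = 0 := by
  have h1 : ∀ g, sphInt ((∑ i, angMom i (angMom i (zonal h y))) * g) =
      sphInt (zonal h y * ∑ i, angMom i (angMom i g)) := by
    intro g
    simp only [Finset.sum_mul, Finset.mul_sum, map_sum, sphInt_angMom_mul, neg_neg]
  have h2 := h1 q
  rw [sum_angMom_angMom_harmonic hq] at h2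
  have h3 : legendreOp n h = legendreOp 0 h + eigen n • h := by
    simp [legendreOp, eigen, Polynomial.smul_eq_C_mul]
  rw [h3, map_add, map_smul, zonalInt_apply, zonalInt_apply]
  have h4 : sphInt (zonal (legendreOp 0 h) y * q) =
      sphInt ((∑ i, angMom i (angMom i (zonal h y))) * q) :=
    sphInt_congr fun x => by
      rw [polyFun_mul, polyFun_mul, polyFun_sum_angMom_zonal, polyFun_zonal]
  rw [h4, h2, mul_neg, map_neg, mul_left_comm, sphInt_C_mul, smul_eq_mul]
  ring

theorem legendreInt_X_pow_ne_zero (n : ℕ) : legendreInt n (Polynomial.X ^ n) ≠ 0 := by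
  intro h
  have h1 := functional_eq_zero (legendreInt_legendreOp n) h (legendre n)
  rw [legendreInt_legendre] at h1
  have : (0 : ℝ) < 2 / (2 * n + 1) := by positivity
  exact this.ne' h1

/-- Both functionals vanish on the range of `legendreOp n`, and such functionals are multiples of
one another because the value at `X ^ n` determines them. -/
theorem exists_zonalInt_eq {n : ℕ} {q : Poly} (hq : q ∈ harmonicPoly n) (y : S2) :
    ∃ c : ℝ, ∀ h, zonalInt y q h = c * legendreInt n h := by
  refine ⟨zonalInt y q (Polynomial.X ^ n) / legendreInt n (Polynomial.X ^ n), fun h => ?_⟩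
  have hM := legendreInt_X_pow_ne_zero n
  set c := zonalInt y q (Polynomial.X ^ n) / legendreInt n (Polynomial.X ^ n) with hc
  have h1 := functional_eq_zero (n := n) (Λ := zonalInt y q - c • legendreInt n)
    (fun h => by
      simp [zonalInt_legendreOp hq, legendreInt_legendreOp])
    (by simp [hc, hM]) h
  simpa [sub_eq_zero] using h1

theorem legendre_zero : legendre 0 = 1 := by simp [legendre]

/-- Archimedes' theorem for polynomials. -/
theorem sphInt_zonal (h : Polynomial ℝ) (y : S2) :
    sphInt (zonal h y) = 2 * Real.pi * polyInt h := by
  have h1 : (1 : Poly) ∈ harmonicPoly 0 := by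
    rw [mem_harmonicPoly]
    exact ⟨MvPolynomial.isHomogeneous_one _ _, by simp [polyLaplacian_apply]⟩
  obtain ⟨c, hc⟩ := exists_zonalInt_eq h1 y
  have h2 := hc 1
  have h3 := hc h
  simp only [zonalInt_apply, legendreInt_apply, legendre_zero, mul_one] at h2 h3
  have h4 : polyInt 1 = 2 := by
    rw [polyInt_apply]; norm_num
  have h5 : zonal 1 (y : E3) = 1 := by simp [zonal]
  rw [h4, h5, sphInt_one] at h2
  rw [h3, show c = 2 * Real.pi by linarith]

theorem inner_le_one (x y : S2) : ⟪(x : E3), y⟫ ≤ 1 := by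
  have := real_inner_le_norm (x : E3) y
  rwa [norm_eq_of_mem_sphere x, norm_eq_of_mem_sphere y, one_mul] at this

theorem neg_one_le_inner (x y : S2) : -1 ≤ ⟪(x : E3), y⟫ := by
  have := neg_le_of_abs_le (abs_real_inner_le_norm (x : E3) y)
  rwa [norm_eq_of_mem_sphere x, norm_eq_of_mem_sphere y, one_mul] at this

theorem inner_self_sphere (x : S2) : ⟪(x : E3), x⟫ = 1 := by
  rw [real_inner_self_eq_norm_sq, norm_eq_of_mem_sphere x]; norm_num

theorem inner_lt_one_of_ne {x y : S2} (h : x ≠ y) : ⟪(x : E3), y⟫ < 1 :=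
  (inner_lt_one_iff_real_of_norm_eq_one (norm_eq_of_mem_sphere x) (norm_eq_of_mem_sphere y)).mpr
    fun h' => h (Subtype.ext h')

instance surf_isOpenPosMeasure : surf.IsOpenPosMeasure := by
  unfold surf; infer_instance

/-- Concentration of the powers of `(1 + x · y) / 2` at the pole. -/
theorem tendsto_peak (y : S2) (q : Poly) :
    Tendsto (fun m : ℕ => (sphInt (zonal ((Polynomial.C (1 / 2) * (1 + Polynomial.X)) ^ m) y))⁻¹ *
      zonalInt y q ((Polynomial.C (1 / 2) * (1 + Polynomial.X)) ^ m)) atTop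
      (𝓝 (polyFun q y)) := by
  have h := tendsto_setIntegral_pow_smul_of_unique_maximum_of_isCompact_of_continuousOn
    (μ := surf) (s := univ) (x₀ := y) isCompact_univ
    (c := fun x : S2 => 1 / 2 * (1 + ⟪(x : E3), y⟫)) (g := fun x : S2 => polyFun q x)
    (by fun_prop)
    (fun x _ hx => by have := inner_lt_one_of_ne hx; rw [inner_self_sphere]; linarith)
    (fun x _ => by have := neg_one_le_inner x y; linarith)
    (by rw [inner_self_sphere]; norm_num) (by simp) (continuous_polyFun_sphere q).continuousOn
  refine h.congr fun m => ?_
  simp only [Measure.restrict_univ, smul_eq_mul, zonalInt_apply, sphInt_apply, polyFun_mul,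
    polyFun_zonal]
  simp

/-- The Funk–Hecke formula for polynomial kernels. -/
theorem sphInt_zonal_mul {n : ℕ} {q : Poly} (hq : q ∈ harmonicPoly n) (y : S2)
    (h : Polynomial ℝ) :
    sphInt (zonal h y * q) = 2 * Real.pi * polyInt (h * legendre n) * polyFun q y := by
  obtain ⟨c, hc⟩ := exists_zonalInt_eq hq y
  have h1 := tendsto_peak y q
  have h2 := (tendsto_peak y (zonal (legendre n) y)).const_mul (c / (2 * Real.pi))
  rw [polyFun_zonal, inner_self_sphere, legendre_eval_one, mul_one] at h2
  -- The constant is read off at the pole: the peak averages of `q` tend to `q(y)`, those of `P_n(x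
  -- · y)` to `P_n(1) = 1`, and the two averages differ by the factor `c / (2π)`.
  have h3 : c / (2 * Real.pi) = polyFun q y := by
    refine tendsto_nhds_unique h2 (h1.congr fun m => ?_)
    rw [hc, zonalInt_apply, legendreInt_apply]
    have : ∀ g, zonal g (y : E3) * zonal (legendre n) y = zonal (g * legendre n) y := by
      intro g; simp [zonal]
    rw [this, sphInt_zonal (_ * _)]
    field_simp
  have h4 := hc h
  rw [zonalInt_apply, legendreInt_apply] at h4
  rw [h4, ← h3]
  field_simp

/-! ### Surface gradients and curls of polynomials -/

/-- The cross product on `E3`. -/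
def crossE (a b : E3) : E3 := WithLp.toLp 2 (a.ofLp ⨯₃ b.ofLp)

theorem crossE_zero (a b : E3) : crossE a b 0 = a 1 * b 2 - a 2 * b 1 := by
  simp [crossE, cross_apply]

theorem crossE_one (a b : E3) : crossE a b 1 = a 2 * b 0 - a 0 * b 2 := by
  simp [crossE, cross_apply]

theorem crossE_two (a b : E3) : crossE a b 2 = a 0 * b 1 - a 1 * b 0 := by
  simp [crossE, cross_apply]

theorem surfCurl_eq_crossE (F : E3 → ℝ) (x : S2) : surfCurl F x = crossE x (gradient F x) := rfl

theorem sphere_sum_sq (x : S2) : (x : E3) 0 * (x : E3) 0 + (x : E3) 1 * (x : E3) 1 +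
    (x : E3) 2 * (x : E3) 2 = 1 := by
  rw [← inner_eq_sum, inner_self_sphere]

theorem inner_surfGrad_surfGrad (F G : E3 → ℝ) (x : S2) :
    ⟪surfGrad F x, surfGrad G x⟫ = ⟪surfCurl F x, surfCurl G x⟫ := by
  have h := sphere_sum_sq x
  rw [surfCurl_eq_crossE, surfCurl_eq_crossE, surfGrad, surfGrad]
  generalize gradient F x = a
  generalize gradient G x = b
  simp only [inner_eq_sum, crossE_zero, crossE_one, crossE_two, PiLp.sub_apply, PiLp.smul_apply,
    smul_eq_mul]
  linear_combination ((x.1 0 * a 0 + x.1 1 * a 1 + x.1 2 * a 2) *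
    (x.1 0 * b 0 + x.1 1 * b 1 + x.1 2 * b 2) -
      (a 0 * b 0 + a 1 * b 1 + a 2 * b 2)) * h

theorem inner_surfCurl_surfGrad (F G : E3 → ℝ) (x : S2) :
    ⟪surfCurl F x, surfGrad G x⟫ = ⟪surfCurl F x, gradient G x⟫ := by
  rw [surfCurl_eq_crossE, surfGrad]
  simp only [inner_eq_sum, crossE_zero, crossE_one, crossE_two, PiLp.sub_apply, PiLp.smul_apply,
    smul_eq_mul]
  ring

theorem inner_surfGrad_surfCurl (F G : E3 → ℝ) (x : S2) :
    ⟪surfGrad F x, surfCurl G x⟫ = -⟪surfCurl F x, gradient G x⟫ := by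
  rw [surfCurl_eq_crossE, surfCurl_eq_crossE, surfGrad]
  simp only [inner_eq_sum, crossE_zero, crossE_one, crossE_two, PiLp.sub_apply, PiLp.smul_apply,
    smul_eq_mul]
  ring

theorem inner_self_surfGrad (F : E3 → ℝ) (x : S2) : ⟪(x : E3), surfGrad F x⟫ = 0 := by
  rw [surfGrad, inner_sub_right, inner_smul_right, inner_self_sphere, mul_one, sub_self]

theorem inner_self_surfCurl (F : E3 → ℝ) (x : S2) : ⟪(x : E3), surfCurl F x⟫ = 0 := by
  rw [surfCurl_eq_crossE]
  simp only [inner_eq_sum, crossE_zero, crossE_one, crossE_two]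
  ring

theorem inner_surfCurl_polyFun (p q : Poly) (x : S2) :
    ⟪surfCurl (polyFun p) x, surfCurl (polyFun q) x⟫ =
      polyFun (∑ i, angMom i p * angMom i q) x := by
  rw [surfCurl_polyFun, surfCurl_polyFun, polyFun_sum, inner_eq_sum, Fin.sum_univ_three]
  simp [polyFun_mul]

theorem integral_surfCurl_surfCurl {n : ℕ} {q : Poly} (hq : q ∈ harmonicPoly n) (p : Poly) :
    ∫ x, ⟪surfCurl (polyFun p) x, surfCurl (polyFun q) x⟫ ∂surf = eigen n * sphInt (p * q) := by
  simp only [inner_surfCurl_polyFun]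
  exact sphInt_sum_angMom_mul_angMom hq p

theorem integral_surfGrad_surfGrad {n : ℕ} {q : Poly} (hq : q ∈ harmonicPoly n) (p : Poly) :
    ∫ x, ⟪surfGrad (polyFun p) x, surfGrad (polyFun q) x⟫ ∂surf = eigen n * sphInt (p * q) := by
  simp only [inner_surfGrad_surfGrad]
  exact integral_surfCurl_surfCurl hq p

/-- Because `∑ (x × ∇)_i ∂_i q = 0`, the integrand is `∑ (x × ∇)_i (φ ∂_i q)`, and each summand has
mean zero. -/
theorem integral_surfCurl_gradient {φ : E3 → ℝ} (hφ : ContDiff ℝ ∞ φ) (q : Poly) :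
    ∫ x : S2, ⟪surfCurl φ x, gradient (polyFun q) x⟫ ∂surf = 0 := by
  have hc : ∀ i, Continuous fun x : S2 =>
      surfCurl (fun z => φ z * polyFun (MvPolynomial.pderiv i q) z) x i := fun i =>
    (EuclideanSpace.proj i : E3 →L[ℝ] ℝ).continuous.comp
      (continuous_surfCurl (hφ.mul (contDiff_polyFun _)))
  have h : ∀ x : S2, ⟪surfCurl φ x, gradient (polyFun q) x⟫ =
      ∑ i, surfCurl (fun z => φ z * polyFun (MvPolynomial.pderiv i q) z) x i := by
    intro x
    have hg : ∀ i, gradient (fun z => φ z * polyFun (MvPolynomial.pderiv i q) z) (x : E3) =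
        φ x • gradient (polyFun (MvPolynomial.pderiv i q)) x +
          polyFun (MvPolynomial.pderiv i q) x • gradient φ x := by
      intro i
      have h1 := (hφ.differentiable (by simp) (x : E3)).hasGradientAt
      have h2 := hasGradientAt_polyFun (MvPolynomial.pderiv i q) (x : E3)
      rw [gradient_polyFun]
      refine HasGradientAt.gradient ?_
      rw [hasGradientAt_iff_hasFDerivAt] at h1 h2 ⊢
      rw [map_add, map_smul, map_smul]
      exact h1.mul h2
    have h3 : polyFun (∑ i, angMom i (MvPolynomial.pderiv i q)) x = 0 := by
      rw [sum_angMom_pderiv, polyFun_zero]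
    simp only [surfCurl_apply, hg, gradient_polyFun]
    rw [surfCurl_eq_crossE]
    simp only [Fin.sum_univ_three, angMom_apply, polyFun_add, polyFun_sub, polyFun_mul,
      polyFun_X] at h3
    simp only [inner_eq_sum, crossE_zero, crossE_one, crossE_two, Fin.sum_univ_three,
      PiLp.add_apply, PiLp.smul_apply, smul_eq_mul]
    simp only [zero_add, Fin.isValue, Fin.reduceAdd] at h3 ⊢
    linear_combination (-φ x) * h3
  simp only [h]
  rw [integral_finsetSum _ fun i _ => integrable_of_continuous (hc i)]
  exact Finset.sum_eq_zero fun i _ => integral_surfCurl (hφ.mul (contDiff_polyFun _)) i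

theorem integral_surfCurl_surfGrad {φ : E3 → ℝ} (hφ : ContDiff ℝ ∞ φ) (q : Poly) :
    ∫ x : S2, ⟪surfCurl φ x, surfGrad (polyFun q) x⟫ ∂surf = 0 := by
  simp only [inner_surfCurl_surfGrad]
  exact integral_surfCurl_gradient hφ q

theorem integral_surfGrad_surfCurl {φ : E3 → ℝ} (hφ : ContDiff ℝ ∞ φ) (q : Poly) :
    ∫ x : S2, ⟪surfGrad φ x, surfCurl (polyFun q) x⟫ ∂surf = 0 := by
  simp only [inner_surfGrad_surfCurl]
  rw [integral_neg, integral_surfCurl_gradient hφ q, neg_zero]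

/-! ### Rotational derivatives -/

/-- The derivation `w · (x × ∇)` on polynomials. -/
def rotDer (w : E3) : Derivation ℝ Poly Poly := ∑ i, w i • angMom i

theorem rotDer_apply (w : E3) (p : Poly) : rotDer w p = ∑ i, w i • angMom i p := by
  simp [rotDer, Fin.sum_univ_three]

theorem rotDer_mem_harmonicPoly (w : E3) {q : Poly} {n : ℕ} (hq : q ∈ harmonicPoly n) :
    rotDer w q ∈ harmonicPoly n := by
  rw [rotDer_apply]
  exact Submodule.sum_mem _ fun i _ => Submodule.smul_mem _ _ (angMom_mem_harmonicPoly i hq)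

theorem sphInt_rotDer_mul (w : E3) (p q : Poly) :
    sphInt (rotDer w p * q) = -sphInt (p * rotDer w q) := by
  simp only [rotDer_apply, Finset.sum_mul, Finset.mul_sum, map_sum, smul_mul_assoc, mul_smul_comm,
    map_smul, sphInt_angMom_mul, smul_neg, Finset.sum_neg_distrib]

theorem rotDer_zonal (w : E3) (h : Polynomial ℝ) (y : E3) :
    rotDer w (zonal h y) = zonal (Polynomial.derivative h) y * rotDer w (linPoly y) := by
  rw [zonal, Derivation.map_aeval, smul_eq_mul, zonal]

theorem polyFun_rotDer (w : E3) (q : Poly) (y : E3) :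
    polyFun (rotDer w q) y = ⟪crossE w y, gradient (polyFun q) y⟫ := by
  rw [rotDer_apply, polyFun_sum, gradient_polyFun]
  simp only [polyFun_smul, Fin.sum_univ_three, angMom_zero_apply, angMom_one_apply,
    angMom_two_apply, polyFun_sub, polyFun_mul, polyFun_X, inner_eq_sum, crossE_zero, crossE_one,
    crossE_two]
  ring

/-- For a unit vector `y ⊥ w` one has `(y × w) × y = w`. Thus a derivative in a tangent direction at
`y` is the value of a rotational derivative, an operator that maps harmonics to harmonics. -/
theorem polyFun_rotDer_cross {w : E3} {y : S2} (h : ⟪w, (y : E3)⟫ = 0) (q : Poly) :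
    polyFun (rotDer (crossE y w) q) y = ⟪w, gradient (polyFun q) y⟫ := by
  have hy := sphere_sum_sq y
  rw [polyFun_rotDer]
  congr 1
  rw [inner_eq_sum] at h
  ext i
  fin_cases i <;>
  simp only [Fin.zero_eta, Fin.mk_one, Fin.reduceFinMk, crossE_zero, crossE_one, crossE_two]
  · linear_combination w 0 * hy - y.1 0 * h
  · linear_combination w 1 * hy - y.1 1 * h
  · linear_combination w 2 * hy - y.1 2 * h

theorem polyFun_rotDer_cross_linPoly {w : E3} {y : S2} (h : ⟪w, (y : E3)⟫ = 0) (x : E3) :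
    polyFun (rotDer (crossE y w) (linPoly y)) x = -⟪x, w⟫ := by
  have hy := sphere_sum_sq y
  rw [polyFun_rotDer, gradient_polyFun]
  simp only [pderiv_linPoly, polyFun_C]
  rw [inner_eq_sum] at h
  simp only [inner_eq_sum, crossE_zero, crossE_one, crossE_two]
  linear_combination (-(x 0 * w 0 + x 1 * w 1 + x 2 * w 2)) * hy +
    (x 0 * y.1 0 + x 1 * y.1 1 + x 2 * y.1 2) * h

theorem exists_derivative_eq (K : Polynomial ℝ) : ∃ g, Polynomial.derivative g = K := by
  induction K using Polynomial.induction_on' with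
  | add p q hp hq =>
    obtain ⟨g, rfl⟩ := hp
    obtain ⟨g', rfl⟩ := hq
    exact ⟨g + g', Polynomial.derivative_add⟩
  | monomial n a =>
    refine ⟨Polynomial.monomial (n + 1) (a / (n + 1)), ?_⟩
    have : ((n : ℝ) + 1) ≠ 0 := by positivity
    rw [Polynomial.derivative_monomial]
    simp [this]

/-- The kernel `K (x · y) (x · w)`, `w ⊥ y`, acts on harmonics as a multiple of the derivative in
the direction `w`. -/
theorem sphInt_zonal_linPoly_mul {n : ℕ} {q : Poly} (hq : q ∈ harmonicPoly n) {w : E3} {y : S2}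
    (h : ⟪w, (y : E3)⟫ = 0) (K : Polynomial ℝ) :
    eigen n * sphInt (zonal K y * linPoly w * q) = -(2 * Real.pi *
      polyInt (Polynomial.derivative ((1 - Polynomial.X ^ 2) * K) * legendre n)) *
        ⟪w, gradient (polyFun q) y⟫ := by
  obtain ⟨g, rfl⟩ := exists_derivative_eq K
  -- With `K = g'`, the kernel `K(x·y) (x·w)` is minus a rotational derivative of `g(x·y)`; the
  -- derivative is moved onto `q`.
  have h1 : sphInt (zonal (Polynomial.derivative g) y * linPoly w * q) =
      sphInt (zonal g y * rotDer (crossE y w) q) := by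
    have h2 := sphInt_rotDer_mul (crossE y w) (zonal g y) q
    rw [rotDer_zonal] at h2
    rw [← neg_inj, ← h2, ← map_neg]
    refine sphInt_congr fun x => ?_
    rw [polyFun_neg, polyFun_mul, polyFun_mul, polyFun_mul, polyFun_mul,
      polyFun_rotDer_cross_linPoly h, polyFun_linPoly]
    ring
  rw [h1, sphInt_zonal_mul (rotDer_mem_harmonicPoly _ hq), polyFun_rotDer_cross h]
  have h2 := legendreInt_legendreOp n g
  -- Legendre's operator trades `λ_n ∫ g P_n` for `-∫ ((1 - t²) g')' P_n`, which removes the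
  -- primitive `g` from the result.
  have h3 : legendreOp n g =
      Polynomial.derivative ((1 - Polynomial.X ^ 2) * Polynomial.derivative g) + eigen n • g := by
    simp only [legendreOp, Polynomial.smul_eq_C_mul, Polynomial.derivative_mul]
    simp
    ring
  rw [h3, map_add, map_smul, legendreInt_apply, legendreInt_apply, smul_eq_mul] at h2
  linear_combination 2 * Real.pi * ⟪w, gradient (polyFun q) y⟫ * h2

/-! ### Pointwise bounds for harmonics by their `L₂` norm -/

theorem inner_polyToL2 (p q : Poly) : ⟪polyToL2 p, polyToL2 q⟫ = sphInt (p * q) := by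
  have h : ∀ p : Poly, polyToL2 p =ᵐ[surf] fun x => polyFun p x := fun p =>
    ContinuousMap.coeFn_toLp (p := 2) (𝕜 := ℝ) surf
      (⟨fun x : S2 => polyFun p x, continuous_polyFun_sphere p⟩ : C(S2, ℝ))
  rw [L2.inner_def, sphInt_apply]
  refine integral_congr_ae ?_
  filter_upwards [h p, h q] with x h1 h2
  rw [h1, h2, polyFun_mul]
  simp [mul_comm]

theorem sphInt_mul_sq_le (p q : Poly) :
    sphInt (p * q) ^ 2 ≤ sphInt (p * p) * sphInt (q * q) := by
  have := real_inner_mul_inner_self_le (polyToL2 p) (polyToL2 q)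
  simp only [inner_polyToL2] at this
  rwa [sq]

theorem sphInt_mono {p q : Poly} (h : ∀ x : S2, polyFun p x ≤ polyFun q x) :
    sphInt p ≤ sphInt q :=
  integral_mono (integrable_of_continuous (continuous_polyFun_sphere p))
    (integrable_of_continuous (continuous_polyFun_sphere q)) h

theorem polyInt_legendre_derivative_sq (n : ℕ) :
    polyInt ((1 - Polynomial.X ^ 2) * Polynomial.derivative (legendre n) ^ 2) =
      eigen n * (2 / (2 * n + 1)) := by
  have h1 : Polynomial.derivative
      ((1 - Polynomial.X ^ 2) * Polynomial.derivative (legendre n) * legendre n) =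
      (1 - Polynomial.X ^ 2) * Polynomial.derivative (legendre n) ^ 2 -
        eigen n • (legendre n * legendre n) := by
    have := legendreOp_legendre n
    rw [legendreOp] at this
    simp only [Polynomial.smul_eq_C_mul, Polynomial.derivative_mul]
    simp
    linear_combination legendre n * this
  have h2 := polyInt_derivative
    ((1 - Polynomial.X ^ 2) * Polynomial.derivative (legendre n) * legendre n)
  have h3 := legendreInt_legendre n
  rw [legendreInt_apply] at h3
  rw [h1, map_sub, map_smul, h3] at h2
  simp at h2
  linarith

/-- Pointwise bound for the derivative of a spherical harmonic by its `L₂` norm. -/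
theorem inner_gradient_sq_le {n : ℕ} {q : Poly} (hq : q ∈ harmonicPoly n) {w : E3} {y : S2}
    (h : ⟪w, (y : E3)⟫ = 0) :
    ⟪w, gradient (polyFun q) y⟫ ^ 2 ≤
      (2 * n + 1) / (4 * Real.pi) * eigen n * ‖w‖ ^ 2 * sphInt (q * q) := by
  set P := legendre n
  set w' := crossE y w
  have hp := Real.pi_pos
  -- `P_n(x · y)` is the reproducing kernel up to a factor. The derivative of `q` at `y` is
  -- reproduced by it, then moved onto the kernel by parts and estimated by Cauchy–Schwarz.
  have h1 := sphInt_zonal_mul (rotDer_mem_harmonicPoly w' hq) y P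
  have h0 := legendreInt_legendre n
  rw [legendreInt_apply] at h0
  rw [h0, polyFun_rotDer_cross h] at h1
  have h2 := sphInt_rotDer_mul w' (zonal P y) q
  rw [h1] at h2
  have h3 := sphInt_mul_sq_le (rotDer w' (zonal P y)) q
  rw [h2] at h3
  -- Since `(x·w)² ≤ |w|² (1 - t²)`, the squared derivative of the kernel is dominated by a zonal
  -- function, whose integral is one-dimensional.
  have hr : sphInt (rotDer w' (zonal P y) * rotDer w' (zonal P y)) ≤
      ‖w‖ ^ 2 * (2 * Real.pi * (eigen n * (2 / (2 * n + 1)))) := by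
    rw [← polyInt_legendre_derivative_sq, ← sphInt_zonal _ y, ← smul_eq_mul (‖w‖ ^ 2),
      ← sphInt.map_smul]
    refine sphInt_mono fun x => ?_
    rw [rotDer_zonal, polyFun_smul, polyFun_mul, polyFun_mul, polyFun_zonal, polyFun_zonal,
      polyFun_rotDer_cross_linPoly h]
    have hx := sphere_sum_sq x
    have hy := sphere_sum_sq y
    have hb : ⟪(x : E3), w⟫ ^ 2 ≤ ‖w‖ ^ 2 * (1 - ⟪(x : E3), y⟫ ^ 2) := by
      have e1 : ⟪(x : E3), w⟫ = ⟪(x : E3) - ⟪(x : E3), y⟫ • (y : E3), w⟫ := by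
        rw [inner_sub_left, real_inner_smul_left, real_inner_comm w (y : E3), h, mul_zero, sub_zero]
      have e2 : ‖(x : E3) - ⟪(x : E3), y⟫ • (y : E3)‖ ^ 2 = 1 - ⟪(x : E3), y⟫ ^ 2 := by
        rw [← real_inner_self_eq_norm_sq]
        simp only [inner_eq_sum, PiLp.sub_apply, PiLp.smul_apply, smul_eq_mul]
        linear_combination hx + (x.1 0 * y.1 0 + x.1 1 * y.1 1 + x.1 2 * y.1 2) ^ 2 * hy
      rw [← e2, e1, ← mul_pow, mul_comm]
      exact sq_le_sq' (neg_le_of_abs_le (abs_real_inner_le_norm _ _)) (real_inner_le_norm _ _)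
    simp only [Polynomial.eval_mul, Polynomial.eval_pow, Polynomial.eval_sub, Polynomial.eval_one,
      Polynomial.eval_X]
    nlinarith [mul_le_mul_of_nonneg_left hb
      (sq_nonneg ((Polynomial.derivative P).eval ⟪(x : E3), y⟫))]
  have hqq : 0 ≤ sphInt (q * q) := by
    rw [← inner_polyToL2]; exact real_inner_self_nonneg
  have h4 := h3.trans (mul_le_mul_of_nonneg_right hr hqq)
  have hn : (0 : ℝ) < 2 * n + 1 := by positivity
  set c : ℝ := (2 * n + 1) / (4 * Real.pi) with hc
  have hc0 : 0 < c := by positivity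
  have e1 : 2 * Real.pi * (2 / (2 * (n : ℝ) + 1)) = c⁻¹ := by
    rw [hc]; field_simp; norm_num
  have e2 : 2 * Real.pi * (eigen n * (2 / (2 * n + 1))) = eigen n * c⁻¹ := by
    rw [← e1]; ring
  rw [e2, e1] at h4
  have h5 := mul_le_mul_of_nonneg_left h4 (sq_nonneg c)
  calc _ = c ^ 2 * (-(c⁻¹ * ⟪w, gradient (polyFun q) y⟫)) ^ 2 := by field_simp
    _ ≤ _ := h5
    _ = _ := by field_simp

/-! ### Decomposition of polynomials into harmonics -/

theorem pderiv_normSqPoly (i : Fin 3) :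
    MvPolynomial.pderiv i normSqPoly = 2 * MvPolynomial.X i := by
  fin_cases i <;> simp [normSqPoly, Fin.sum_univ_three, MvPolynomial.pderiv_X]

/-- The `6` is `Δ|x|²`; the `4 d` comes from the cross term `2 ∇|x|² · ∇g` through Euler's identity.
-/
theorem polyLaplacian_normSqPoly_mul {g : Poly} {d : ℕ} (hg : g.IsHomogeneous d) :
    polyLaplacian (normSqPoly * g) =
      (6 + 4 * (d : ℝ)) • g + normSqPoly * polyLaplacian g := by
  have h := euler_identity hg
  have h6 : (MvPolynomial.C (6 + 4 * (d : ℝ)) : Poly) = 6 + 4 * (d : Poly) := by simp; rfl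
  rw [MvPolynomial.smul_eq_C_mul, h6]
  have h2 : ∀ i : Fin 3, MvPolynomial.pderiv i (2 : Poly) = 0 := fun i => by
    simpa using (MvPolynomial.pderiv i : Derivation ℝ Poly Poly).map_natCast 2
  simp only [polyLaplacian_apply, MvPolynomial.pderiv_mul, pderiv_normSqPoly, map_add,
    MvPolynomial.pderiv_X_self, h2]
  linear_combination 4 * h

theorem isHomogeneous_normSqPoly : normSqPoly.IsHomogeneous 2 :=
  MvPolynomial.IsHomogeneous.sum _ _ _ fun i _ => by
    simpa using (MvPolynomial.isHomogeneous_X ℝ i).pow 2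

theorem isHomogeneous_normSqPoly_pow_mul {h : Poly} {m : ℕ} (hh : h.IsHomogeneous m) (j : ℕ) :
    (normSqPoly ^ j * h).IsHomogeneous (m + 2 * j) := by
  rw [add_comm]; exact (isHomogeneous_normSqPoly.pow j).mul hh

/-- Positivity of the factor is the point: it makes `g ↦ Δ(|x|² g)` surjective on `harmSpan`. -/
theorem exists_polyLaplacian_normSqPoly_pow_mul {h : Poly} {m : ℕ} (hh : h ∈ harmonicPoly m)
    (j : ℕ) : ∃ c : ℝ, 0 < c ∧
      polyLaplacian (normSqPoly * (normSqPoly ^ j * h)) = c • (normSqPoly ^ j * h) := by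
  rw [mem_harmonicPoly] at hh
  induction j with
  | zero =>
    refine ⟨6 + 4 * m, by positivity, ?_⟩
    rw [pow_zero, one_mul, polyLaplacian_normSqPoly_mul hh.1, hh.2, mul_zero, add_zero]
  | succ j ih =>
    obtain ⟨c, hc, h1⟩ := ih
    refine ⟨6 + 4 * (m + 2 * (j + 1) : ℕ) + c, by positivity, ?_⟩
    rw [polyLaplacian_normSqPoly_mul (isHomogeneous_normSqPoly_pow_mul hh.1 (j + 1)), pow_succ',
      mul_assoc, h1, add_smul _ c, mul_smul_comm]

/-- The span of the polynomials `|x|^{2j} h` of degree `n` with `h` harmonic. -/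
def harmSpan (n : ℕ) : Submodule ℝ Poly :=
  Submodule.span ℝ {q | ∃ (m j : ℕ) (h : Poly), h ∈ harmonicPoly m ∧ m + 2 * j = n ∧
    q = normSqPoly ^ j * h}

theorem isHomogeneous_of_mem_harmSpan {n : ℕ} {q : Poly} (hq : q ∈ harmSpan n) :
    q.IsHomogeneous n := by
  have h : harmSpan n ≤ MvPolynomial.homogeneousSubmodule (Fin 3) ℝ n := by
    refine Submodule.span_le.mpr ?_
    rintro _ ⟨m, j, h, hh, rfl, rfl⟩
    exact isHomogeneous_normSqPoly_pow_mul (mem_harmonicPoly.mp hh).1 j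
  exact h hq

theorem normSqPoly_mul_mem_harmSpan {n : ℕ} {q : Poly} (hq : q ∈ harmSpan n) :
    normSqPoly * q ∈ harmSpan (n + 2) := by
  have h : harmSpan n ≤ (harmSpan (n + 2)).comap (LinearMap.mulLeft ℝ normSqPoly) := by
    refine Submodule.span_le.mpr ?_
    rintro _ ⟨m, j, h, hh, rfl, rfl⟩
    exact Submodule.subset_span ⟨m, j + 1, h, hh, by ring, by simp [pow_succ']; ring⟩
  exact h hq

theorem exists_polyLaplacian_eq {n : ℕ} {s : Poly} (hs : s ∈ harmSpan n) :
    ∃ r ∈ harmSpan n, polyLaplacian (normSqPoly * r) = s := by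
  have h : harmSpan n ≤
      (harmSpan n).map (polyLaplacian ∘ₗ LinearMap.mulLeft ℝ normSqPoly) := by
    refine Submodule.span_le.mpr ?_
    rintro _ ⟨m, j, h, hh, hmj, rfl⟩
    obtain ⟨c, hc, h1⟩ := exists_polyLaplacian_normSqPoly_pow_mul hh j
    refine ⟨c⁻¹ • (normSqPoly ^ j * h), Submodule.smul_mem _ _
      (Submodule.subset_span ⟨m, j, h, hh, hmj, rfl⟩), ?_⟩
    rw [map_smul, LinearMap.comp_apply, LinearMap.mulLeft_apply, h1, smul_smul,
      inv_mul_cancel₀ hc.ne', one_smul]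
  obtain ⟨r, hr, h1⟩ := h hs
  exact ⟨r, hr, h1⟩

theorem pderiv_pderiv_eq_zero {q : Poly} {n : ℕ} (hq : q.IsHomogeneous n) (hn : n < 2)
    (i : Fin 3) : MvPolynomial.pderiv i (MvPolynomial.pderiv i q) = 0 := by
  have h : (MvPolynomial.pderiv i q).IsHomogeneous 0 := by
    have := hq.pderiv (i := i)
    rwa [show n - 1 = 0 by omega] at this
  rw [← MvPolynomial.totalDegree_zero_iff_isHomogeneous,
    MvPolynomial.totalDegree_eq_zero_iff_eq_C] at h
  rw [h, MvPolynomial.pderiv_C]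

/-- Homogeneous polynomials are sums of harmonic ones multiplied by powers of `|x|²`. -/
theorem mem_harmSpan {n : ℕ} {q : Poly} (hq : q.IsHomogeneous n) : q ∈ harmSpan n := by
  induction n using Nat.strong_induction_on generalizing q with
  | _ n ih =>
    have harm : ∀ {h : Poly}, h ∈ harmonicPoly n → h ∈ harmSpan n := fun {h} hh =>
      Submodule.subset_span ⟨n, 0, h, hh, by ring, by simp⟩
    by_cases hn : n < 2
    · refine harm (mem_harmonicPoly.mpr ⟨hq, ?_⟩)
      rw [polyLaplacian_apply]
      simp only [pderiv_pderiv_eq_zero hq hn, add_zero]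
    · obtain ⟨k, rfl⟩ : ∃ k, n = k + 2 := ⟨n - 2, by omega⟩
      have h1 : (polyLaplacian q).IsHomogeneous k := by
        rw [polyLaplacian_apply]
        have h2 : ∀ i : Fin 3,
            (MvPolynomial.pderiv i (MvPolynomial.pderiv i q)).IsHomogeneous k := fun i => by
          simpa using (hq.pderiv (i := i)).pderiv (i := i)
        exact ((h2 0).add (h2 1)).add (h2 2)
      -- `r` is chosen with `Δ(|x|² r) = Δq`, so that `q - |x|² r` is harmonic.
      obtain ⟨r, hr, h3⟩ := exists_polyLaplacian_eq (ih k (by omega) h1)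
      have h4 := normSqPoly_mul_mem_harmSpan hr
      rw [← sub_add_cancel q (normSqPoly * r)]
      refine Submodule.add_mem _ (harm (mem_harmonicPoly.mpr
        ⟨hq.sub (isHomogeneous_of_mem_harmSpan h4), ?_⟩)) h4
      rw [map_sub, h3, sub_self]

theorem sphInt_normSqPoly_pow_mul (j : ℕ) (p : Poly) : sphInt (normSqPoly ^ j * p) = sphInt p :=
  sphInt_congr fun x => by
    rw [polyFun_mul, polyFun_pow, polyFun_normSqPoly_sphere, one_pow, one_mul]

/-- Harmonics of degree `n` are orthogonal to polynomials of smaller degree. -/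
theorem sphInt_mul_eq_zero_of_totalDegree_lt {n : ℕ} {q h : Poly} (hh : h ∈ harmonicPoly n)
    (hq : q.totalDegree < n) : sphInt (q * h) = 0 := by
  have key : ∀ d < n, ∀ p : Poly, p.IsHomogeneous d → sphInt (p * h) = 0 := by
    intro d hd p hp
    have h1 : harmSpan d ≤ LinearMap.ker (sphInt ∘ₗ LinearMap.mulRight ℝ h) := by
      refine Submodule.span_le.mpr ?_
      rintro _ ⟨m, j, g, hg, hmj, rfl⟩
      change sphInt (normSqPoly ^ j * g * h) = 0
      rw [mul_assoc, sphInt_normSqPoly_pow_mul]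
      exact sphInt_mul_eq_zero hg hh (by omega)
    exact h1 (mem_harmSpan hp)
  rw [← MvPolynomial.sum_homogeneousComponent q, Finset.sum_mul, map_sum]
  refine Finset.sum_eq_zero fun d hd => key d ?_ _ (MvPolynomial.homogeneousComponent_isHomogeneous d q)
  rw [Finset.mem_range] at hd
  omega

/-! ### Completeness of the scalar harmonics -/

/-- Restriction of polynomials to the sphere, as an algebra homomorphism. -/
def polyToC : Poly →ₐ[ℝ] C(S2, ℝ) :=
  MvPolynomial.aeval fun i =>
    (⟨fun x : S2 => (x : E3) i, by fun_prop⟩ : C(S2, ℝ))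

theorem polyToC_apply (p : Poly) (x : S2) : polyToC p x = polyFun p x := by
  induction p using MvPolynomial.induction_on with
  | C a => simp [polyToC, polyFun]
  | add p q hp hq => rw [map_add, ContinuousMap.add_apply, hp, hq, polyFun_add]
  | mul_X p i hp =>
    rw [map_mul, ContinuousMap.mul_apply, hp, polyFun_mul, polyFun_X]
    simp [polyToC]

theorem polyToL2_eq (p : Poly) :
    polyToL2 p = ContinuousMap.toLp (E := ℝ) 2 surf ℝ (polyToC p) := by
  unfold polyToL2
  rw [LinearMap.comp_apply]
  exact congrArg (ContinuousMap.toLp (E := ℝ) 2 surf ℝ)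
    (ContinuousMap.ext fun x => (polyToC_apply p x).symm)

/-- Stone–Weierstrass: the coordinates separate points. -/
theorem denseRange_polyToC : DenseRange polyToC := by
  have h := ContinuousMap.subalgebra_topologicalClosure_eq_top_of_separatesPoints polyToC.range
    (by
      intro x y hxy
      have : ∃ i, (x : E3) i ≠ (y : E3) i := by
        by_contra! h
        exact hxy (Subtype.ext (PiLp.ext h))
      obtain ⟨i, hi⟩ := this
      refine ⟨_, ⟨polyToC (MvPolynomial.X i), ⟨_, rfl⟩, rfl⟩, ?_⟩
      simpa [polyToC_apply, polyFun_X] using hi)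
  have h2 : closure (range polyToC) = univ := by
    have := congrArg (fun s : Subalgebra ℝ C(S2, ℝ) => (s : Set C(S2, ℝ))) h
    simpa [Subalgebra.topologicalClosure_coe] using this
  exact dense_iff_closure_eq.mpr h2

theorem denseRange_polyToL2 : DenseRange polyToL2 := by
  have h1 : DenseRange (ContinuousMap.toLp (E := ℝ) 2 surf ℝ) :=
    ContinuousMap.toLp_denseRange ℝ (μ := surf) ℝ (by simp)
  have h2 := h1.comp denseRange_polyToC (ContinuousMap.toLp (E := ℝ) 2 surf ℝ).continuous
  convert! h2 using 1
  funext p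
  exact polyToL2_eq p

theorem polyToL2_normSqPoly_pow_mul (j : ℕ) (p : Poly) :
    polyToL2 (normSqPoly ^ j * p) = polyToL2 p := by
  rw [polyToL2_eq, polyToL2_eq]
  congr 1
  ext x
  rw [polyToC_apply, polyToC_apply, polyFun_mul, polyFun_pow, polyFun_normSqPoly_sphere, one_pow,
    one_mul]

/-- On the sphere `|x|² = 1`, so orthogonality to harmonics already means orthogonality to all
polynomials, which are dense. -/
theorem eq_zero_of_inner_harmonic {u : Lp ℝ 2 surf}
    (hu : ∀ n, ∀ p ∈ harmonicPoly n, ⟪polyToL2 p, u⟫ = 0) : u = 0 := by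
  have h1 : ∀ p : Poly, ⟪polyToL2 p, u⟫ = 0 := by
    intro p
    rw [← MvPolynomial.sum_homogeneousComponent p, map_sum, sum_inner]
    refine Finset.sum_eq_zero fun d _ => ?_
    have h2 : harmSpan d ≤ LinearMap.ker ((innerₗ (Lp ℝ 2 surf)).flip u ∘ₗ polyToL2) := by
      refine Submodule.span_le.mpr ?_
      rintro _ ⟨m, j, g, hg, hmj, rfl⟩
      change ⟪polyToL2 (normSqPoly ^ j * g), u⟫ = 0
      rw [polyToL2_normSqPoly_pow_mul, hu m g hg]
    exact h2 (mem_harmSpan (MvPolynomial.homogeneousComponent_isHomogeneous d p))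
  have h2 : ∀ v, ⟪v, u⟫ = 0 := by
    intro v
    refine denseRange_polyToL2.induction_on (p := fun v => ⟪v, u⟫ = 0) v ?_ h1
    exact isClosed_eq (by fun_prop) continuous_const
  exact inner_self_eq_zero.mp (h2 u)

/-! ### Completeness of the vector harmonics -/

theorem surfGrad_polyFun_apply (p : Poly) (x : S2) (j : Fin 3) :
    surfGrad (polyFun p) x j = polyFun (MvPolynomial.pderiv j p) x -
      (∑ k, (x : E3) k * polyFun (MvPolynomial.pderiv k p) x) * (x : E3) j := by
  rw [surfGrad, gradient_polyFun, Fin.sum_univ_three]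
  simp [inner_eq_sum]

/-- The surface gradient on polynomials. -/
def gradC : Poly →ₗ[ℝ] C(S2, E3) where
  toFun p := ⟨surfGrad (polyFun p), continuous_surfGrad (contDiff_polyFun p)⟩
  map_add' p q := by
    ext x j
    simp only [ContinuousMap.coe_mk, ContinuousMap.add_apply, PiLp.add_apply,
      surfGrad_polyFun_apply, map_add, polyFun_add, Fin.sum_univ_three]
    ring
  map_smul' c p := by
    ext x j
    simp only [ContinuousMap.coe_mk, ContinuousMap.smul_apply, PiLp.smul_apply, RingHom.id_apply,
      surfGrad_polyFun_apply, polyFun_smul, Fin.sum_univ_three, smul_eq_mul,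
      Derivation.map_smul]
    ring

/-- The surface curl on polynomials. -/
def curlC : Poly →ₗ[ℝ] C(S2, E3) where
  toFun p := ⟨surfCurl (polyFun p), continuous_surfCurl (contDiff_polyFun p)⟩
  map_add' p q := by
    ext x j
    simp only [ContinuousMap.coe_mk, ContinuousMap.add_apply, PiLp.add_apply,
      surfCurl_polyFun, map_add, polyFun_add]
  map_smul' c p := by
    ext x j
    simp only [ContinuousMap.coe_mk, ContinuousMap.smul_apply, PiLp.smul_apply, RingHom.id_apply,
      surfCurl_polyFun, Derivation.map_smul, polyFun_smul, smul_eq_mul]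

theorem gradC_apply (p : Poly) (x : S2) : gradC p x = surfGrad (polyFun p) x := rfl

theorem curlC_apply (p : Poly) (x : S2) : curlC p x = surfCurl (polyFun p) x := rfl

/-- The gradient of `|x|²` is radial, hence has no tangential part, and `|x|² = 1` on the sphere. -/
theorem gradC_normSqPoly_mul (p : Poly) : gradC (normSqPoly * p) = gradC p := by
  ext x j
  have hx := sphere_sum_sq x
  rw [gradC_apply, gradC_apply, surfGrad_polyFun_apply, surfGrad_polyFun_apply]
  simp only [MvPolynomial.pderiv_mul, pderiv_normSqPoly, polyFun_add, polyFun_mul,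
    polyFun_normSqPoly_sphere, polyFun_X, Fin.sum_univ_three]
  linear_combination (-2 * polyFun p x * x.1 j * polyFun 2 x / 2) * hx

/-- Tangential parts of harmonic polynomial fields are surface gradients and curls. -/
theorem smul_tangential_eq {n : ℕ} {p : Poly} (hp : p ∈ harmonicPoly n) (i : Fin 3) (x : S2) :
    (eigen n * polyFun p x) • (EuclideanSpace.single i (1 : ℝ) - (x : E3) i • (x : E3)) =
      (n : ℝ) • gradC (MvPolynomial.X i * p) x - gradC (MvPolynomial.pderiv i p) x -
        curlC (angMom i p) x := by
  rw [mem_harmonicPoly] at hp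
  have hx := sphere_sum_sq x
  have e0 := euler_identity hp.1
  have e1 : ∀ j : Fin 3, MvPolynomial.pderiv j (MvPolynomial.X 0 * MvPolynomial.pderiv 0 p +
      MvPolynomial.X 1 * MvPolynomial.pderiv 1 p + MvPolynomial.X 2 * MvPolynomial.pderiv 2 p) =
      (n : Poly) * MvPolynomial.pderiv j p := by
    intro j
    rw [e0, ← nsmul_eq_mul, map_nsmul, nsmul_eq_mul]
  have hn : polyFun (n : Poly) x = n := by simp [polyFun]
  have hE := congrArg (fun q => polyFun q x) e0
  have hD := congrArg (fun q => polyFun q x) hp.2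
  have h0 := congrArg (fun q => polyFun q x) (e1 0)
  have h1 := congrArg (fun q => polyFun q x) (e1 1)
  have h2 := congrArg (fun q => polyFun q x) (e1 2)
  simp only [map_add, pderiv_X_mul, pderiv_comm 1 0, pderiv_comm 2 0, pderiv_comm 2 1,
    polyLaplacian_apply, polyFun_add, polyFun_mul, polyFun_X, hn, polyFun_zero,
    if_true, if_false, Fin.reduceEq, Fin.isValue, zero_add] at hE hD h0 h1 h2
  ext j
  simp only [PiLp.sub_apply, PiLp.smul_apply, smul_eq_mul, gradC_apply, curlC_apply,
    surfGrad_polyFun_apply, surfCurl_polyFun]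
  -- Nine scalar identities, valid modulo `|x|² = 1`, Euler's identity, its first derivatives and
  -- `Δp = 0`.
  fin_cases i <;> fin_cases j <;>
  simp only [Fin.zero_eta, Fin.mk_one, Fin.reduceFinMk, Fin.sum_univ_three, angMom_zero_apply,
    angMom_one_apply, angMom_two_apply, map_sub, pderiv_X_mul, pderiv_comm 1 0, pderiv_comm 2 0,
    pderiv_comm 2 1, polyFun_add, polyFun_sub, polyFun_mul, polyFun_X, polyFun_zero, eigen,
    if_true, if_false, Fin.reduceEq, Fin.isValue, zero_add, PiLp.single_apply]
  · linear_combination (n * x.1 0 * x.1 0 - n) * hE -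
      polyFun (MvPolynomial.pderiv 0 (MvPolynomial.pderiv 0 p)) x * hx +
      (x.1 1 ^ 2 + x.1 2 ^ 2) * hD - x.1 1 * h1 - x.1 2 * h2
  · linear_combination n * x.1 0 * x.1 1 * hE -
      polyFun (MvPolynomial.pderiv 0 (MvPolynomial.pderiv 1 p)) x * hx -
      x.1 0 * x.1 1 * hD + x.1 0 * h1
  · linear_combination n * x.1 0 * x.1 2 * hE -
      polyFun (MvPolynomial.pderiv 0 (MvPolynomial.pderiv 2 p)) x * hx -
      x.1 0 * x.1 2 * hD + x.1 0 * h2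
  · linear_combination n * x.1 1 * x.1 0 * hE -
      polyFun (MvPolynomial.pderiv 0 (MvPolynomial.pderiv 1 p)) x * hx -
      x.1 1 * x.1 0 * hD + x.1 1 * h0
  · linear_combination (n * x.1 1 * x.1 1 - n) * hE -
      polyFun (MvPolynomial.pderiv 1 (MvPolynomial.pderiv 1 p)) x * hx +
      (x.1 0 ^ 2 + x.1 2 ^ 2) * hD - x.1 0 * h0 - x.1 2 * h2
  · linear_combination n * x.1 1 * x.1 2 * hE -
      polyFun (MvPolynomial.pderiv 1 (MvPolynomial.pderiv 2 p)) x * hx -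
      x.1 1 * x.1 2 * hD + x.1 1 * h2
  · linear_combination n * x.1 2 * x.1 0 * hE -
      polyFun (MvPolynomial.pderiv 0 (MvPolynomial.pderiv 2 p)) x * hx -
      x.1 2 * x.1 0 * hD + x.1 2 * h0
  · linear_combination n * x.1 2 * x.1 1 * hE -
      polyFun (MvPolynomial.pderiv 1 (MvPolynomial.pderiv 2 p)) x * hx -
      x.1 2 * x.1 1 * hD + x.1 2 * h1
  · linear_combination (n * x.1 2 * x.1 2 - n) * hE -
      polyFun (MvPolynomial.pderiv 2 (MvPolynomial.pderiv 2 p)) x * hx +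
      (x.1 0 ^ 2 + x.1 1 ^ 2) * hD - x.1 0 * h0 - x.1 1 * h1

/-! ### Vector spherical harmonics in `L₂` -/

/-- The surface curl (`true`) and the surface gradient (`false`) of polynomials. -/
def vecC (b : Bool) : Poly →ₗ[ℝ] C(S2, E3) := if b then curlC else gradC

/-- The surface curl and the surface gradient of polynomials as elements of `L₂`. -/
def vecL2 (b : Bool) : Poly →ₗ[ℝ] Lp E3 2 surf :=
  (ContinuousMap.toLp (E := E3) 2 surf ℝ).toLinearMap ∘ₗ vecC b

theorem vecC_true_apply (p : Poly) (x : S2) : vecC true p x = surfCurl (polyFun p) x := rfl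

theorem vecC_false_apply (p : Poly) (x : S2) : vecC false p x = surfGrad (polyFun p) x := rfl

theorem inner_vecL2 (b : Bool) (p : Poly) (u : Lp E3 2 surf) :
    ⟪vecL2 b p, u⟫ = ∫ x, ⟪vecC b p x, u x⟫ ∂surf := inner_toLp_eq _ u

theorem inner_toLp_toLp (f g : C(S2, E3)) :
    ⟪ContinuousMap.toLp (E := E3) 2 surf ℝ f, ContinuousMap.toLp (E := E3) 2 surf ℝ g⟫ =
      ∫ x, ⟪f x, g x⟫ ∂surf := by
  rw [inner_toLp_eq]
  refine integral_congr_ae ?_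
  filter_upwards [ContinuousMap.coeFn_toLp (p := 2) (𝕜 := ℝ) surf g] with x hx
  rw [hx]

theorem inner_vecL2_vecL2 (b : Bool) {n : ℕ} {q : Poly} (hq : q ∈ harmonicPoly n) (p : Poly) :
    ⟪vecL2 b p, vecL2 b q⟫ = eigen n * sphInt (p * q) := by
  refine (inner_toLp_toLp (vecC b p) (vecC b q)).trans ?_
  cases b
  · exact integral_surfGrad_surfGrad hq p
  · exact integral_surfCurl_surfCurl hq p

theorem inner_vecL2_of_ne {b c : Bool} (h : b ≠ c) (p q : Poly) : ⟪vecL2 b p, vecL2 c q⟫ = 0 := by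
  refine (inner_toLp_toLp (vecC b p) (vecC c q)).trans ?_
  cases b <;> cases c
  · exact absurd rfl h
  · exact integral_surfGrad_surfCurl (contDiff_polyFun p) q
  · exact integral_surfCurl_surfGrad (contDiff_polyFun p) q
  · exact absurd rfl h

theorem inner_self_vecC (b : Bool) (p : Poly) (x : S2) : ⟪(x : E3), vecC b p x⟫ = 0 := by
  cases b
  · exact inner_self_surfGrad _ x
  · exact inner_self_surfCurl _ x

theorem toLp_mem_tangentL2 {f : C(S2, E3)} (hf : ∀ x : S2, ⟪(x : E3), f x⟫ = 0) :
    ContinuousMap.toLp (E := E3) 2 surf ℝ f ∈ tangentL2 := by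
  change ∀ᵐ x : S2 ∂surf, _
  filter_upwards [ContinuousMap.coeFn_toLp (p := 2) (𝕜 := ℝ) surf f] with x hx
  rw [hx, hf x]

theorem vecL2_mem_tangentL2 (b : Bool) (p : Poly) : vecL2 b p ∈ tangentL2 :=
  toLp_mem_tangentL2 (inner_self_vecC b p)

theorem vecC_normSqPoly_pow_mul (b : Bool) (j : ℕ) (p : Poly) :
    vecC b (normSqPoly ^ j * p) = vecC b p := by
  induction j with
  | zero => simp
  | succ j ih =>
    rw [pow_succ', mul_assoc, ← ih]
    cases b
    · exact gradC_normSqPoly_mul _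
    · ext x i
      rw [vecC_true_apply, vecC_true_apply, surfCurl_polyFun, surfCurl_polyFun]
      simp [Derivation.leibniz, angMom_normSqPoly, polyFun_mul, polyFun_normSqPoly_sphere]

theorem vecC_C (b : Bool) (c : ℝ) : vecC b (MvPolynomial.C c) = 0 := by
  ext x i
  cases b
  · rw [vecC_false_apply, surfGrad_polyFun_apply]; simp [polyFun_zero]
  · rw [vecC_true_apply, surfCurl_polyFun]; simp [polyFun_zero]

theorem eq_C_of_mem_harmonicPoly_zero {p : Poly} (hp : p ∈ harmonicPoly 0) :
    ∃ c, p = MvPolynomial.C c := by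
  have h := (mem_harmonicPoly.mp hp).1
  rw [← MvPolynomial.totalDegree_zero_iff_isHomogeneous,
    MvPolynomial.totalDegree_eq_zero_iff_eq_C] at h
  exact ⟨_, h⟩

/-- Powers of `|x|²` drop out on the sphere and constants have zero curl and gradient, so harmonics
of positive degree account for all polynomial potentials. -/
theorem inner_vecL2_eq_zero {u : Lp E3 2 surf}
    (hu : ∀ b n, ∀ p ∈ harmonicPoly (n + 1), ⟪vecL2 b p, u⟫ = 0) (b : Bool) (p : Poly) :
    ⟪vecL2 b p, u⟫ = 0 := by
  rw [← MvPolynomial.sum_homogeneousComponent p, map_sum, sum_inner]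
  refine Finset.sum_eq_zero fun d _ => ?_
  have h2 : harmSpan d ≤ LinearMap.ker ((innerₗ (Lp E3 2 surf)).flip u ∘ₗ vecL2 b) := by
    refine Submodule.span_le.mpr ?_
    rintro _ ⟨m, j, g, hg, hmj, rfl⟩
    change ⟪vecL2 b (normSqPoly ^ j * g), u⟫ = 0
    have : vecL2 b (normSqPoly ^ j * g) = vecL2 b g :=
      congrArg (ContinuousMap.toLp (E := E3) 2 surf ℝ) (vecC_normSqPoly_pow_mul b j g)
    rw [this]
    cases m with
    | zero =>
      obtain ⟨c, rfl⟩ := eq_C_of_mem_harmonicPoly_zero hg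
      have : vecL2 b (MvPolynomial.C c) = 0 := by
        have := congrArg (ContinuousMap.toLp (E := E3) 2 surf ℝ) (vecC_C b c)
        rwa [map_zero] at this
      rw [this, inner_zero_left]
    | succ m => exact hu b m g hg
  exact h2 (mem_harmSpan (MvPolynomial.homogeneousComponent_isHomogeneous d p))

theorem polyToL2_coeFn (p : Poly) : polyToL2 p =ᵐ[surf] fun x => polyFun p x :=
  ContinuousMap.coeFn_toLp (p := 2) (𝕜 := ℝ) surf
    (⟨fun x : S2 => polyFun p x, continuous_polyFun_sphere p⟩ : C(S2, ℝ))

theorem integrable_inner_continuous_Lp (f : C(S2, E3)) (u : Lp E3 2 surf) :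
    Integrable (fun x => ⟪f x, u x⟫) surf := by
  have h := L2.integrable_inner (𝕜 := ℝ) (ContinuousMap.toLp (E := E3) 2 surf ℝ f) u
  refine h.congr ?_
  filter_upwards [ContinuousMap.coeFn_toLp (p := 2) (𝕜 := ℝ) surf f] with x hx
  rw [hx]

/-- Completeness of the vector spherical harmonics. -/
theorem eq_zero_of_inner_vecL2 {u : Lp E3 2 surf} (hut : u ∈ tangentL2)
    (hu : ∀ b n, ∀ p ∈ harmonicPoly (n + 1), ⟪vecL2 b p, u⟫ = 0) : u = 0 := by
  have hall := inner_vecL2_eq_zero hu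
  -- Since `u` is tangential, `u_i = u · (e_i - x_i x)`, and a harmonic times this vector is a
  -- combination of gradients and curls. So each Cartesian component of `u` is orthogonal to all
  -- scalar harmonics.
  have hcomp : ∀ i, (EuclideanSpace.proj i : E3 →L[ℝ] ℝ).compLp u = 0 := by
    intro i
    refine eq_zero_of_inner_harmonic fun n p hp => ?_
    have h1 : ⟪polyToL2 p, (EuclideanSpace.proj i : E3 →L[ℝ] ℝ).compLp u⟫ =
        ∫ x : S2, ⟪polyFun p x • (EuclideanSpace.single i (1 : ℝ) - (x : E3) i • (x : E3)), u x⟫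
          ∂surf := by
      rw [L2.inner_def]
      refine integral_congr_ae ?_
      filter_upwards [polyToL2_coeFn p, (EuclideanSpace.proj i : E3 →L[ℝ] ℝ).coeFn_compLp u, hut]
        with x h1 h2 h3
      rw [h1, h2, real_inner_smul_left, inner_sub_left, real_inner_smul_left, h3]
      simp [EuclideanSpace.inner_single_left, mul_comm]
    rw [h1]
    cases n with
    -- `λ_0 = 0` makes the general identity empty in degree zero; there `e_i - x_i x` is itself the
    -- surface gradient of `x_i`.
    | zero =>
      obtain ⟨c, rfl⟩ := eq_C_of_mem_harmonicPoly_zero hp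
      have h2 : ∀ x : S2, polyFun (MvPolynomial.C c) x •
          (EuclideanSpace.single i (1 : ℝ) - (x : E3) i • (x : E3)) =
          vecC false (c • MvPolynomial.X i) x := by
        intro x
        ext j
        rw [map_smul, ContinuousMap.smul_apply, vecC_false_apply, PiLp.smul_apply, PiLp.smul_apply,
          surfGrad_polyFun_apply, polyFun_C]
        fin_cases i <;> fin_cases j <;>
        simp [polyFun_one, polyFun_zero, Fin.sum_univ_three, MvPolynomial.pderiv_X]
      simp only [h2]
      rw [← inner_vecL2]
      exact hall _ _
    | succ n =>
      have h2 : ∀ x : S2, eigen (n + 1) *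
          ⟪polyFun p x • (EuclideanSpace.single i (1 : ℝ) - (x : E3) i • (x : E3)), u x⟫ =
          ((n + 1 : ℕ) : ℝ) * ⟪vecC false (MvPolynomial.X i * p) x, u x⟫ -
            ⟪vecC false (MvPolynomial.pderiv i p) x, u x⟫ -
            ⟪vecC true (angMom i p) x, u x⟫ := by
        intro x
        rw [← real_inner_smul_left, smul_smul, smul_tangential_eq hp i x, inner_sub_left,
          inner_sub_left, real_inner_smul_left]
        rfl
      have h3 := congrArg (fun g : S2 → ℝ => ∫ x, g x ∂surf) (funext h2)
      simp only [integral_const_mul] at h3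
      have i1 := integrable_inner_continuous_Lp (vecC false (MvPolynomial.X i * p)) u
      have i2 := integrable_inner_continuous_Lp (vecC false (MvPolynomial.pderiv i p)) u
      have i3 := integrable_inner_continuous_Lp (vecC true (angMom i p)) u
      have i4 : Integrable (fun x => ((n + 1 : ℕ) : ℝ) *
          ⟪vecC false (MvPolynomial.X i * p) x, u x⟫ -
            ⟪vecC false (MvPolynomial.pderiv i p) x, u x⟫) surf := (i1.const_mul _).sub i2
      rw [integral_sub i4 i3, integral_sub (i1.const_mul _) i2,
        integral_const_mul, ← inner_vecL2, ← inner_vecL2, ← inner_vecL2, hall, hall, hall,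
        mul_zero, sub_zero, sub_zero] at h3
      exact (mul_eq_zero.mp h3).resolve_left (eigen_pos n.succ_pos).ne'
  rw [Lp.eq_zero_iff_ae_eq_zero]
  have h := fun i => Lp.eq_zero_iff_ae_eq_zero.mp (hcomp i)
  filter_upwards [h 0, h 1, h 2, (EuclideanSpace.proj 0 : E3 →L[ℝ] ℝ).coeFn_compLp u,
    (EuclideanSpace.proj 1 : E3 →L[ℝ] ℝ).coeFn_compLp u,
    (EuclideanSpace.proj 2 : E3 →L[ℝ] ℝ).coeFn_compLp u] with x h0 h1 h2 h3 h4 h5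
  ext j
  fin_cases j
  · exact h3.symm.trans h0
  · exact h4.symm.trans h1
  · exact h5.symm.trans h2

/-! ### The orthonormal bases -/

/-- The polynomial of the spherical harmonic `Y_{ℓ,k}`. -/
def Ypoly (ℓ : ℕ) (k : Order ℓ) : Poly := (exists_harmonicPoly ℓ k).choose

theorem Y_eq (ℓ : ℕ) (k : Order ℓ) : Y ℓ k = polyFun (Ypoly ℓ k) := rfl

theorem Ypoly_mem (ℓ : ℕ) (k : Order ℓ) : Ypoly ℓ k ∈ harmonicPoly ℓ :=
  (exists_harmonicPoly ℓ k).choose_spec.1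

theorem polyToL2_Ypoly (ℓ : ℕ) (k : Order ℓ) :
    polyToL2 (Ypoly ℓ k) = (stdOrthonormalBasis ℝ (sphHarm ℓ) k : Lp ℝ 2 surf) :=
  (exists_harmonicPoly ℓ k).choose_spec.2

theorem sphInt_Ypoly_mul_Ypoly (ℓ : ℕ) (k k' : Order ℓ) :
    sphInt (Ypoly ℓ k * Ypoly ℓ k') = if k = k' then 1 else 0 := by
  rw [← inner_polyToL2, polyToL2_Ypoly, polyToL2_Ypoly, ← Submodule.coe_inner,
    orthonormal_iff_ite.mp (stdOrthonormalBasis ℝ (sphHarm ℓ)).orthonormal]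

theorem orthonormal_Ypoly :
    Orthonormal ℝ fun i : Σ ℓ : ℕ, Order ℓ => polyToL2 (Ypoly i.1 i.2) := by
  rw [orthonormal_iff_ite]
  rintro ⟨ℓ, k⟩ ⟨m, k'⟩
  rw [inner_polyToL2]
  by_cases h : ℓ = m
  · subst h
    rw [sphInt_Ypoly_mul_Ypoly]
    simp
  · rw [sphInt_mul_eq_zero (Ypoly_mem ℓ k) (Ypoly_mem m k') h, if_neg]
    intro h'
    exact h (congrArg Sigma.fst h')

/-- Index set of the vector spherical harmonics. -/
abbrev VecIndex : Type := Σ ℓ : ℕ, Bool × Order (ℓ + 1)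

/-- The vector spherical harmonics as elements of `L₂`. -/
def vecHarm (i : VecIndex) : tangentL2 :=
  ⟨(√(eigen (i.1 + 1)))⁻¹ • vecL2 i.2.1 (Ypoly (i.1 + 1) i.2.2),
    tangentL2.smul_mem _ (vecL2_mem_tangentL2 _ _)⟩

theorem orthonormal_vecHarm : Orthonormal ℝ vecHarm := by
  rw [orthonormal_iff_ite]
  rintro ⟨ℓ, b, k⟩ ⟨m, c, k'⟩
  change ⟪(√(eigen (ℓ + 1)))⁻¹ • vecL2 b (Ypoly (ℓ + 1) k),
    (√(eigen (m + 1)))⁻¹ • vecL2 c (Ypoly (m + 1) k')⟫ = _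
  rw [real_inner_smul_left, inner_smul_right]
  by_cases h : b = c
  · subst h
    rw [inner_vecL2_vecL2 b (Ypoly_mem _ _)]
    by_cases h : ℓ = m
    · subst h
      have hp := eigen_pos ℓ.succ_pos
      have h1 : (√(eigen (ℓ + 1)))⁻¹ * ((√(eigen (ℓ + 1)))⁻¹ * eigen (ℓ + 1)) = 1 := by
        rw [← mul_assoc, ← mul_inv, Real.mul_self_sqrt hp.le, inv_mul_cancel₀ hp.ne']
      rw [sphInt_Ypoly_mul_Ypoly, ← mul_assoc, ← mul_assoc, mul_assoc (√(eigen (ℓ + 1)))⁻¹, h1,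
        one_mul]
      simp
    · rw [sphInt_mul_eq_zero (Ypoly_mem _ k) (Ypoly_mem _ k') (by omega), if_neg]
      · ring
      · intro h'
        exact h (congrArg Sigma.fst h')
  · rw [inner_vecL2_of_ne h, if_neg]
    · ring
    · intro h'
      have h1 : ℓ = m := congrArg Sigma.fst h'
      subst h1
      simp at h'
      exact h h'.1

theorem exists_sum_Ypoly {n : ℕ} {p : Poly} (hp : p ∈ harmonicPoly n) :
    ∃ c : Order n → ℝ, polyToL2 p = polyToL2 (∑ k, c k • Ypoly n k) := by
  have hmem : polyToL2 p ∈ sphHarm n := Submodule.mem_map_of_mem hp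
  refine ⟨fun k => ((stdOrthonormalBasis ℝ (sphHarm n)).repr ⟨_, hmem⟩) k, ?_⟩
  have h := congrArg (Submodule.subtype _)
    ((stdOrthonormalBasis ℝ (sphHarm n)).sum_repr ⟨_, hmem⟩)
  simp only [map_sum, map_smul, polyToL2_Ypoly]
  simpa using h.symm

/-- By Green's formula the squared norm of a curl or gradient of a harmonic is `λ_n` times that of
the potential. This transports basis expansions, available only in `L₂`, to vector harmonics. -/
theorem vecL2_eq_of_polyToL2_eq (b : Bool) {n : ℕ} {p q : Poly} (hp : p ∈ harmonicPoly n)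
    (hq : q ∈ harmonicPoly n) (h : polyToL2 p = polyToL2 q) : vecL2 b p = vecL2 b q := by
  rw [← sub_eq_zero, ← map_sub, ← inner_self_eq_zero (𝕜 := ℝ),
    inner_vecL2_vecL2 b (Submodule.sub_mem _ hp hq), ← inner_polyToL2, map_sub, h, sub_self,
    inner_zero_left, mul_zero]

theorem vecHarm_span_orthogonal : (Submodule.span ℝ (Set.range vecHarm))ᗮ = ⊥ := by
  rw [Submodule.eq_bot_iff]
  intro u hu
  rw [Submodule.mem_orthogonal] at hu
  have h1 : ∀ i, ⟪vecHarm i, u⟫ = 0 := fun i => hu _ (Submodule.subset_span ⟨i, rfl⟩)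
  refine Subtype.ext (eq_zero_of_inner_vecL2 u.2 fun b n p hp => ?_)
  obtain ⟨c, hc⟩ := exists_sum_Ypoly hp
  rw [vecL2_eq_of_polyToL2_eq b hp (Submodule.sum_mem _ fun k _ =>
    Submodule.smul_mem _ _ (Ypoly_mem (n + 1) k)) hc, map_sum, sum_inner]
  refine Finset.sum_eq_zero fun k _ => ?_
  have h2 : ⟪(√(eigen (n + 1)))⁻¹ • vecL2 b (Ypoly (n + 1) k), (u : Lp E3 2 surf)⟫ = 0 :=
    h1 ⟨n, b, k⟩
  rw [real_inner_smul_left] at h2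
  have h3 : (√(eigen (n + 1)))⁻¹ ≠ 0 := inv_ne_zero (Real.sqrt_pos.mpr (eigen_pos n.succ_pos)).ne'
  rw [map_smul, real_inner_smul_left, (mul_eq_zero.mp h2).resolve_left h3, mul_zero]

instance tangentL2_completeSpace : CompleteSpace tangentL2 :=
  isClosed_tangentL2.completeSpace_coe

/-- The Hilbert basis of vector spherical harmonics. -/
def vecBasis : HilbertBasis VecIndex ℝ tangentL2 :=
  HilbertBasis.mkOfOrthogonalEqBot orthonormal_vecHarm vecHarm_span_orthogonal

theorem vecBasis_apply (i : VecIndex) : vecBasis i = vecHarm i := by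
  rw [vecBasis, HilbertBasis.coe_mkOfOrthogonalEqBot]

/-- The squared norm of the component of degree `ℓ + 1` of a tangential field. -/
def levelSq (u : tangentL2) (ℓ : ℕ) : ℝ := ∑ j : Bool × Order (ℓ + 1), ⟪vecHarm ⟨ℓ, j⟩, u⟫ ^ 2

theorem levelSq_nonneg (u : tangentL2) (ℓ : ℕ) : 0 ≤ levelSq u ℓ :=
  Finset.sum_nonneg fun _ _ => sq_nonneg _

/-- Parseval's identity. -/
theorem hasSum_levelSq (u : tangentL2) : HasSum (levelSq u) (‖u‖ ^ 2) := by
  have h := vecBasis.hasSum_inner_mul_inner u u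
  rw [real_inner_self_eq_norm_sq] at h
  have h2 : HasSum (fun i : VecIndex => ⟪vecHarm i, u⟫ ^ 2) (‖u‖ ^ 2) := by
    refine h.congr_fun ?_
    intro i
    rw [vecBasis_apply, real_inner_comm u, sq]
  exact h2.sigma fun ℓ => hasSum_fintype _

/-! ### Partial sums of the expansion into vector harmonics -/

/-- A continuous tangential field as an element of `L₂`. -/
def tang (f : C(S2, E3)) (hf : ∀ x : S2, ⟪(x : E3), f x⟫ = 0) : tangentL2 :=
  ⟨ContinuousMap.toLp (E := E3) 2 surf ℝ f, toLp_mem_tangentL2 hf⟩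

/-- The polynomial generating the component of type `b` and degree `ℓ + 1`. -/
def harmPart (u : tangentL2) (ℓ : ℕ) (b : Bool) : Poly :=
  ∑ k, ((√(eigen (ℓ + 1)))⁻¹ * ⟪vecHarm ⟨ℓ, b, k⟩, u⟫) • Ypoly (ℓ + 1) k

theorem harmPart_mem (u : tangentL2) (ℓ : ℕ) (b : Bool) :
    harmPart u ℓ b ∈ harmonicPoly (ℓ + 1) :=
  Submodule.sum_mem _ fun k _ => Submodule.smul_mem _ _ (Ypoly_mem _ k)

/-- The partial sum of the components of degree at most `n`. -/
def partialSum (u : tangentL2) (n : ℕ) : C(S2, E3) :=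
  ∑ ℓ ∈ Finset.range n, ∑ b, vecC b (harmPart u ℓ b)

theorem inner_self_partialSum (u : tangentL2) (n : ℕ) (x : S2) :
    ⟪(x : E3), partialSum u n x⟫ = 0 := by
  rw [partialSum, ContinuousMap.sum_apply, inner_sum]
  refine Finset.sum_eq_zero fun ℓ _ => ?_
  rw [ContinuousMap.sum_apply, inner_sum]
  exact Finset.sum_eq_zero fun b _ => inner_self_vecC b _ x

/-- The partial sum in `L₂`. -/
def partialSumL2 (u : tangentL2) (n : ℕ) : tangentL2 :=
  tang (partialSum u n) (inner_self_partialSum u n)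

theorem partialSumL2_eq (u : tangentL2) (n : ℕ) : partialSumL2 u n =
    ∑ ℓ ∈ Finset.range n, ∑ j : Bool × Order (ℓ + 1),
      ⟪vecHarm ⟨ℓ, j⟩, u⟫ • vecHarm ⟨ℓ, j⟩ := by
  refine Subtype.ext ?_
  change ContinuousMap.toLp (E := E3) 2 surf ℝ
    (∑ ℓ ∈ Finset.range n, ∑ b, vecC b (harmPart u ℓ b)) = _
  rw [map_sum, AddSubmonoidClass.coe_finsetSum]
  refine Finset.sum_congr rfl fun ℓ _ => ?_
  rw [map_sum, AddSubmonoidClass.coe_finsetSum, Fintype.sum_prod_type]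
  refine Finset.sum_congr rfl fun b _ => ?_
  have : ContinuousMap.toLp (E := E3) 2 surf ℝ (vecC b (harmPart u ℓ b)) =
      vecL2 b (harmPart u ℓ b) := rfl
  rw [this, harmPart, map_sum]
  refine Finset.sum_congr rfl fun k _ => ?_
  rw [map_smul, SetLike.val_smul, vecHarm, smul_smul, mul_comm]

theorem inner_vecHarm_partialSumL2 (u : tangentL2) (n m : ℕ) (j : Bool × Order (m + 1)) :
    ⟪vecHarm ⟨m, j⟩, partialSumL2 u n⟫ = if m < n then ⟪vecHarm ⟨m, j⟩, u⟫ else 0 := by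
  have ho := orthonormal_iff_ite.mp orthonormal_vecHarm
  rw [partialSumL2_eq, inner_sum]
  have h1 : ∀ ℓ, ⟪vecHarm ⟨m, j⟩, ∑ i : Bool × Order (ℓ + 1),
      ⟪vecHarm ⟨ℓ, i⟩, u⟫ • vecHarm ⟨ℓ, i⟩⟫ = if ℓ = m then ⟪vecHarm ⟨m, j⟩, u⟫ else 0 := by
    intro ℓ
    rw [inner_sum]
    have h2 : ∀ i : Bool × Order (ℓ + 1), ⟪vecHarm ⟨m, j⟩, ⟪vecHarm ⟨ℓ, i⟩, u⟫ • vecHarm ⟨ℓ, i⟩⟫ =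
        ⟪vecHarm ⟨ℓ, i⟩, u⟫ * if (⟨m, j⟩ : VecIndex) = ⟨ℓ, i⟩ then 1 else 0 := fun i => by
      rw [← ho]
      exact real_inner_smul_right (vecHarm ⟨m, j⟩) (vecHarm ⟨ℓ, i⟩) ⟪vecHarm ⟨ℓ, i⟩, u⟫
    simp only [h2]
    by_cases h : ℓ = m
    · subst h
      simp
    · rw [if_neg h]
      refine Finset.sum_eq_zero fun i _ => ?_
      rw [if_neg, mul_zero]
      intro h'
      exact h (congrArg Sigma.fst h').symm
  simp only [h1, Finset.sum_ite_eq', Finset.mem_range]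

theorem levelSq_sub_partialSumL2 (u : tangentL2) (n ℓ : ℕ) :
    levelSq (u - partialSumL2 u n) ℓ = if ℓ < n then 0 else levelSq u ℓ := by
  simp only [levelSq, inner_sub_right, inner_vecHarm_partialSumL2]
  split_ifs <;> simp

theorem hasSum_tail (u : tangentL2) (n : ℕ) :
    HasSum (fun ℓ => if ℓ < n then 0 else levelSq u ℓ) (‖u - partialSumL2 u n‖ ^ 2) := by
  have h := hasSum_levelSq (u - partialSumL2 u n)
  rwa [funext (levelSq_sub_partialSumL2 u n)] at h

/-! ### Sobolev norms and errors of best approximation -/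

/-- The terms of the squared Sobolev norm of a tangential `L₂` field. -/
def sobTerm (σ : ℝ) (u : tangentL2) (ℓ : ℕ) : ℝ := (1 + eigen (ℓ + 1)) ^ σ * levelSq u ℓ

/-- The squared Sobolev norm. -/
def sobSq (σ : ℝ) (u : tangentL2) : ℝ := ∑' ℓ, sobTerm σ u ℓ

theorem one_add_eigen_pos (n : ℕ) : 0 < 1 + eigen n := by
  have := eigen_nonneg n; linarith

theorem sobTerm_nonneg (σ : ℝ) (u : tangentL2) (ℓ : ℕ) : 0 ≤ sobTerm σ u ℓ :=
  mul_nonneg (Real.rpow_nonneg (one_add_eigen_pos _).le _) (levelSq_nonneg u ℓ)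

theorem sobSq_nonneg (σ : ℝ) (u : tangentL2) : 0 ≤ sobSq σ u :=
  tsum_nonneg (sobTerm_nonneg σ u)

theorem succ_rpow_le {σ : ℝ} (hσ : 0 ≤ σ) (ℓ : ℕ) :
    ((ℓ + 1 : ℕ) : ℝ) ^ (2 * σ) ≤ (1 + eigen (ℓ + 1)) ^ σ := by
  rw [Real.rpow_mul (by positivity), Real.rpow_two]
  refine Real.rpow_le_rpow (by positivity) ?_ hσ
  unfold eigen
  push_cast
  nlinarith [(Nat.cast_nonneg ℓ : (0 : ℝ) ≤ ℓ)]

/-- The differences of the sequence `n ↦ n ^ (2 σ)`. -/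
def rpowDiff (σ : ℝ) (n : ℕ) : ℝ := ((n + 1 : ℕ) : ℝ) ^ (2 * σ) - (n : ℝ) ^ (2 * σ)

theorem rpowDiff_nonneg {σ : ℝ} (hσ : 0 ≤ σ) (n : ℕ) : 0 ≤ rpowDiff σ n :=
  sub_nonneg.mpr (Real.rpow_le_rpow n.cast_nonneg (by push_cast; linarith) (by linarith))

theorem sum_rpowDiff {σ : ℝ} (hσ : 0 < σ) (k : ℕ) :
    ∑ n ∈ Finset.range k, rpowDiff σ n = (k : ℝ) ^ (2 * σ) := by
  have h := Finset.sum_range_sub (fun n : ℕ => (n : ℝ) ^ (2 * σ)) k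
  rw [Nat.cast_zero, Real.zero_rpow (by linarith), sub_zero] at h
  exact h

/-- Weighted sums of the squared errors of best approximation are controlled by the Sobolev
norm. -/
theorem sum_rpowDiff_mul_tail_le {σ : ℝ} (hσ : 0 < σ) {u : tangentL2}
    (hu : Summable (sobTerm σ u)) (M : ℕ) :
    ∑ n ∈ Finset.range M, rpowDiff σ n * ‖u - partialSumL2 u n‖ ^ 2 ≤ sobSq σ u := by
  have h1 : HasSum (fun ℓ => ∑ n ∈ Finset.range M,
      rpowDiff σ n * (if ℓ < n then 0 else levelSq u ℓ))
      (∑ n ∈ Finset.range M, rpowDiff σ n * ‖u - partialSumL2 u n‖ ^ 2) :=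
    hasSum_sum fun n _ => (hasSum_tail u n).mul_left _
  refine hasSum_le (fun ℓ => ?_) h1 hu.hasSum
  have hL := levelSq_nonneg u ℓ
  -- Degree index `ℓ` enters the tails with `n ≤ ℓ` only, and the weights of these telescope to `(ℓ
  -- + 1)^(2σ)`.
  calc ∑ n ∈ Finset.range M, rpowDiff σ n * (if ℓ < n then 0 else levelSq u ℓ)
      = ∑ n ∈ Finset.range M with n ≤ ℓ, rpowDiff σ n * levelSq u ℓ := by
        rw [Finset.sum_filter]
        refine Finset.sum_congr rfl fun n _ => ?_
        by_cases h : ℓ < n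
        · rw [if_pos h, if_neg (by omega), mul_zero]
        · rw [if_neg h, if_pos (by omega)]
    _ ≤ ∑ n ∈ Finset.range (ℓ + 1), rpowDiff σ n * levelSq u ℓ := by
        refine Finset.sum_le_sum_of_subset_of_nonneg ?_ fun n _ _ =>
          mul_nonneg (rpowDiff_nonneg hσ.le n) hL
        intro n hn
        rw [Finset.mem_filter] at hn
        exact Finset.mem_range.mpr (by omega)
    _ = ((ℓ + 1 : ℕ) : ℝ) ^ (2 * σ) * levelSq u ℓ := by
        rw [← Finset.sum_mul, sum_rpowDiff hσ]
    _ ≤ _ := mul_le_mul_of_nonneg_right (succ_rpow_le hσ.le ℓ) hL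

theorem norm_sq_le_sobSq {σ : ℝ} (hσ : 0 < σ) {u : tangentL2} (hu : Summable (sobTerm σ u)) :
    ‖u‖ ^ 2 ≤ sobSq σ u := by
  refine hasSum_le (fun ℓ => ?_) (hasSum_levelSq u) hu.hasSum
  refine le_mul_of_one_le_left (levelSq_nonneg u ℓ) ?_
  exact Real.one_le_rpow (by have := eigen_nonneg (ℓ + 1); linarith) hσ.le

/-! ### Uniform bounds -/

/-- The bound for directional derivatives is used in the direction of the surface gradient itself;
the curl has the same length. -/
theorem norm_vecC_sq_le (b : Bool) {n : ℕ} {p : Poly} (hp : p ∈ harmonicPoly n) (x : S2) :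
    ‖vecC b p x‖ ^ 2 ≤ (2 * n + 1) / (4 * Real.pi) * eigen n * sphInt (p * p) := by
  have h1 : ‖vecC b p x‖ ^ 2 = ‖surfGrad (polyFun p) x‖ ^ 2 := by
    cases b
    · rfl
    · rw [← real_inner_self_eq_norm_sq, ← real_inner_self_eq_norm_sq, inner_surfGrad_surfGrad,
        vecC_true_apply]
  rw [h1]
  set w := surfGrad (polyFun p) x with hw
  have h2 : ⟪w, (x : E3)⟫ = 0 := by rw [real_inner_comm]; exact inner_self_surfGrad _ x
  have h3 : ⟪w, gradient (polyFun p) x⟫ = ‖w‖ ^ 2 := by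
    have : gradient (polyFun p) x = w + ⟪(x : E3), gradient (polyFun p) x⟫ • (x : E3) := by
      rw [hw, surfGrad]; abel
    rw [this, inner_add_right, inner_smul_right, h2, mul_zero, add_zero,
      real_inner_self_eq_norm_sq]
  have h4 := inner_gradient_sq_le hp h2
  rw [h3] at h4
  rcases (sq_nonneg ‖w‖).eq_or_lt with h | h
  · rw [← h]
    have : 0 ≤ sphInt (p * p) := by rw [← inner_polyToL2]; exact real_inner_self_nonneg
    have := eigen_nonneg n
    have := Real.pi_pos
    positivity
  · refine le_of_mul_le_mul_right ?_ h
    nlinarith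

theorem sphInt_sum_Ypoly_mul_self (n : ℕ) (c : Order n → ℝ) :
    sphInt ((∑ k, c k • Ypoly n k) * ∑ k, c k • Ypoly n k) = ∑ k, c k ^ 2 := by
  simp only [Finset.sum_mul, Finset.mul_sum, map_sum, smul_mul_assoc, mul_smul_comm, map_smul,
    sphInt_Ypoly_mul_Ypoly, smul_eq_mul]
  simp [sq]

theorem norm_vecC_harmPart_sq_le (u : tangentL2) (ℓ : ℕ) (b : Bool) (x : S2) :
    ‖vecC b (harmPart u ℓ b) x‖ ^ 2 ≤
      (2 * (ℓ : ℝ) + 3) / (4 * Real.pi) * ∑ k, ⟪vecHarm ⟨ℓ, b, k⟩, u⟫ ^ 2 := by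
  refine (norm_vecC_sq_le b (harmPart_mem u ℓ b) x).trans_eq ?_
  have hp := eigen_pos ℓ.succ_pos
  rw [harmPart, sphInt_sum_Ypoly_mul_self]
  simp only [mul_pow, inv_pow, Real.sq_sqrt hp.le]
  rw [← Finset.mul_sum]
  push_cast
  field_simp
  ring

/-- The constant of the embedding of the Sobolev space of order `σ > 1` into bounded fields. -/
def sobConst (σ : ℝ) : ℝ :=
  ∑' ℓ : ℕ, (2 * (ℓ : ℝ) + 3) / (4 * Real.pi) * (1 + eigen (ℓ + 1)) ^ (-σ)

theorem sobConst_term_nonneg (σ : ℝ) (ℓ : ℕ) :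
    0 ≤ (2 * (ℓ : ℝ) + 3) / (4 * Real.pi) * (1 + eigen (ℓ + 1)) ^ (-σ) := by
  have := one_add_eigen_pos (ℓ + 1)
  have := Real.pi_pos
  positivity

/-- The terms are `O(ℓ^(1 - 2σ))`; this is where `σ > 1` is needed. -/
theorem summable_sobConst {σ : ℝ} (hσ : 1 < σ) : Summable fun ℓ : ℕ =>
    (2 * (ℓ : ℝ) + 3) / (4 * Real.pi) * (1 + eigen (ℓ + 1)) ^ (-σ) := by
  have h1 : Summable fun n : ℕ => (n : ℝ) ^ (1 - 2 * σ) :=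
    Real.summable_nat_rpow.mpr (by linarith)
  have h2 := ((summable_nat_add_iff 1).mpr h1).mul_left (3 / (4 * Real.pi))
  refine Summable.of_nonneg_of_le (sobConst_term_nonneg σ) (fun ℓ => ?_) h2
  have hp := Real.pi_pos
  have hℓ : (0 : ℝ) < ((ℓ + 1 : ℕ) : ℝ) := by positivity
  rw [sub_eq_add_neg, Real.rpow_add hℓ, Real.rpow_one, ← mul_assoc]
  refine mul_le_mul ?_ ?_ (Real.rpow_nonneg (one_add_eigen_pos _).le _) (by positivity)
  · rw [div_mul_eq_mul_div]
    gcongr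
    push_cast
    linarith [(Nat.cast_nonneg ℓ : (0 : ℝ) ≤ ℓ)]
  · rw [Real.rpow_neg (one_add_eigen_pos _).le, Real.rpow_neg hℓ.le]
    exact inv_anti₀ (by positivity) (succ_rpow_le (by linarith) ℓ)

theorem sobConst_nonneg (σ : ℝ) : 0 ≤ sobConst σ := tsum_nonneg (sobConst_term_nonneg σ)

/-- Sobolev embedding by Cauchy–Schwarz against the series of `sobConst`; the `4` is the square of
the number of types. Only partial sums have to be bounded, so no pointwise convergence of the
expansion enters. -/
theorem norm_partialSum_sq_le {σ : ℝ} (hσ : 1 < σ) {u : tangentL2}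
    (hu : Summable (sobTerm σ u)) (n : ℕ) (x : S2) :
    ‖partialSum u n x‖ ^ 2 ≤ 4 * sobConst σ * sobSq σ u := by
  have hpi := Real.pi_pos
  have h1 : ‖partialSum u n x‖ ≤ ∑ ℓ ∈ Finset.range n,
      2 * (√((2 * (ℓ : ℝ) + 3) / (4 * Real.pi) * (1 + eigen (ℓ + 1)) ^ (-σ)) *
        √(sobTerm σ u ℓ)) := by
    rw [partialSum, ContinuousMap.sum_apply]
    refine (norm_sum_le _ _).trans (Finset.sum_le_sum fun ℓ _ => ?_)
    have hw := one_add_eigen_pos (ℓ + 1)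
    have h2 : ∀ b, ‖vecC b (harmPart u ℓ b) x‖ ≤
        √((2 * (ℓ : ℝ) + 3) / (4 * Real.pi) * (1 + eigen (ℓ + 1)) ^ (-σ)) *
          √(sobTerm σ u ℓ) := by
      intro b
      rw [← Real.sqrt_mul (sobConst_term_nonneg σ ℓ)]
      refine Real.le_sqrt_of_sq_le ((norm_vecC_harmPart_sq_le u ℓ b x).trans ?_)
      have h3 : ∑ k, ⟪vecHarm ⟨ℓ, b, k⟩, u⟫ ^ 2 ≤ levelSq u ℓ := by
        rw [levelSq, Fintype.sum_prod_type]
        exact Finset.single_le_sum (f := fun b => ∑ k, ⟪vecHarm ⟨ℓ, b, k⟩, u⟫ ^ 2)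
          (fun b _ => Finset.sum_nonneg fun _ _ => sq_nonneg _) (Finset.mem_univ b)
      have h4 : (1 + eigen (ℓ + 1)) ^ (-σ) * (1 + eigen (ℓ + 1)) ^ σ = 1 := by
        rw [← Real.rpow_add hw, neg_add_cancel, Real.rpow_zero]
      rw [sobTerm, mul_assoc _ _ (_ * _), ← mul_assoc _ _ (levelSq u ℓ), h4, one_mul]
      gcongr
    rw [ContinuousMap.sum_apply, Fintype.sum_bool, two_mul]
    exact (norm_add_le _ _).trans (add_le_add (h2 true) (h2 false))
  rw [← Finset.mul_sum] at h1
  have h2 := Finset.sum_mul_sq_le_sq_mul_sq (Finset.range n)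
    (fun ℓ : ℕ => √((2 * (ℓ : ℝ) + 3) / (4 * Real.pi) * (1 + eigen (ℓ + 1)) ^ (-σ)))
    (fun ℓ => √(sobTerm σ u ℓ))
  simp only [Real.sq_sqrt (sobConst_term_nonneg σ _), Real.sq_sqrt (sobTerm_nonneg σ u _)] at h2
  have h3 := (summable_sobConst hσ).sum_le_tsum (Finset.range n)
    (fun ℓ _ => sobConst_term_nonneg σ ℓ)
  have h4 := hu.sum_le_tsum (Finset.range n) (fun ℓ _ => sobTerm_nonneg σ u ℓ)
  calc ‖partialSum u n x‖ ^ 2 ≤ _ := pow_le_pow_left₀ (norm_nonneg _) h1 2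
    _ = 4 * _ := by rw [mul_pow]; norm_num; rfl
    _ ≤ 4 * (sobConst σ * sobSq σ u) := by
        refine mul_le_mul_of_nonneg_left (h2.trans ?_) (by norm_num)
        exact mul_le_mul h3 h4 (Finset.sum_nonneg fun ℓ _ => sobTerm_nonneg σ u ℓ)
          (sobConst_nonneg σ)
    _ = _ := by ring

/-! ### Polynomial fields -/

/-- Fields on the sphere with polynomial components of degree at most `d`. -/
def polyFields (d : ℕ) : Submodule ℝ (S2 → E3) where
  carrier := {f | ∀ j, ∃ c : Poly, c.totalDegree ≤ d ∧ ∀ x, f x j = polyFun c x}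
  zero_mem' j := ⟨0, by simp, fun x => by simp [polyFun_zero]⟩
  add_mem' := by
    intro f g hf hg j
    obtain ⟨a, ha, ha'⟩ := hf j
    obtain ⟨b, hb, hb'⟩ := hg j
    exact ⟨a + b, (MvPolynomial.totalDegree_add _ _).trans (max_le ha hb), fun x => by
      rw [polyFun_add, Pi.add_apply, PiLp.add_apply, ha', hb']⟩
  smul_mem' := by
    intro r f hf j
    obtain ⟨a, ha, ha'⟩ := hf j
    exact ⟨r • a, (MvPolynomial.totalDegree_smul_le _ _).trans ha, fun x => by
      rw [polyFun_smul, Pi.smul_apply, PiLp.smul_apply, ha', smul_eq_mul]⟩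

/-- By Euler's identity the surface gradient is `∂_j p - n x_j p` on the sphere, of degree `n + 1`;
the curl keeps the degree `n`. -/
theorem vecC_mem_polyFields (b : Bool) {n d : ℕ} (hd : n + 1 ≤ d) {p : Poly}
    (hp : p ∈ harmonicPoly n) : (fun x => vecC b p x) ∈ polyFields d := by
  have hh := (mem_harmonicPoly.mp hp).1
  intro j
  cases b
  · refine ⟨MvPolynomial.pderiv j p - (n : ℝ) • (p * MvPolynomial.X j), ?_, fun x => ?_⟩
    · refine (MvPolynomial.totalDegree_sub _ _).trans (max_le ?_ ?_)
      · exact (hh.pderiv (i := j)).totalDegree_le.trans (by omega)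
      · exact (MvPolynomial.totalDegree_smul_le _ _).trans
          ((hh.mul (MvPolynomial.isHomogeneous_X ℝ j)).totalDegree_le.trans hd)
    · have he := congrArg (fun q => polyFun q x) (euler_identity hh)
      simp only [polyFun_add, polyFun_mul, polyFun_X] at he
      have hn : polyFun (n : Poly) x = n := by simp [polyFun]
      rw [hn] at he
      change surfGrad (polyFun p) x j = _
      rw [surfGrad_polyFun_apply, Fin.sum_univ_three, he, polyFun_sub,
        polyFun_smul, polyFun_mul, polyFun_X]
      ring
  · refine ⟨angMom j p, (isHomogeneous_angMom j hh).totalDegree_le.trans (by omega), fun x => ?_⟩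
    change surfCurl (polyFun p) x j = _
    rw [surfCurl_polyFun]

theorem partialSum_mem_polyFields (u : tangentL2) (n : ℕ) :
    (fun x => partialSum u n x) ∈ polyFields (n + 1) := by
  have h : (fun x => partialSum u n x) = ∑ ℓ ∈ Finset.range n, ∑ b,
      fun x => vecC b (harmPart u ℓ b) x := by
    funext x
    simp [partialSum]
  rw [h]
  refine Submodule.sum_mem _ fun ℓ hℓ => Submodule.sum_mem _ fun b _ => ?_
  exact vecC_mem_polyFields b (by rw [Finset.mem_range] at hℓ; omega) (harmPart_mem u ℓ b)

theorem exists_poly_inner {d : ℕ} {f g : S2 → E3} (hf : f ∈ polyFields d)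
    (hg : g ∈ polyFields d) :
    ∃ q : Poly, q.totalDegree ≤ 2 * d ∧ ∀ x, ⟪f x, g x⟫ = polyFun q x := by
  choose a ha ha' using hf
  choose b hb hb' using hg
  refine ⟨∑ j, a j * b j, ?_, fun x => ?_⟩
  · refine MvPolynomial.totalDegree_finsetSum_le fun j _ => ?_
    have := (MvPolynomial.totalDegree_mul (a j) (b j)).trans (add_le_add (ha j) (hb j))
    omega
  · rw [inner_eq_sum, polyFun_sum, Fin.sum_univ_three]
    simp only [polyFun_mul, ha', hb']

/-! ### Inner products of Sobolev fields -/

theorem norm_toLp_sq (f : C(S2, E3)) :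
    ‖ContinuousMap.toLp (E := E3) 2 surf ℝ f‖ ^ 2 = ∫ x, ‖f x‖ ^ 2 ∂surf := by
  rw [← real_inner_self_eq_norm_sq, inner_toLp_toLp]
  simp only [real_inner_self_eq_norm_sq]

theorem inner_toLp_toLp_real (f g : C(S2, ℝ)) :
    ⟪ContinuousMap.toLp (E := ℝ) 2 surf ℝ f, ContinuousMap.toLp (E := ℝ) 2 surf ℝ g⟫ =
      ∫ x, f x * g x ∂surf := by
  rw [L2.inner_def]
  refine integral_congr_ae ?_
  filter_upwards [ContinuousMap.coeFn_toLp (p := 2) (𝕜 := ℝ) surf f,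
    ContinuousMap.coeFn_toLp (p := 2) (𝕜 := ℝ) surf g] with x h1 h2
  rw [h1, h2]
  simp [mul_comm]

theorem norm_toLp_sq_real (f : C(S2, ℝ)) :
    ‖ContinuousMap.toLp (E := ℝ) 2 surf ℝ f‖ ^ 2 = ∫ x, f x ^ 2 ∂surf := by
  rw [← real_inner_self_eq_norm_sq, inner_toLp_toLp_real]
  simp only [sq]

/-- The squared norm of the component of degree `ℓ` of a continuous function. -/
def scalarLevelSq (h : C(S2, ℝ)) (ℓ : ℕ) : ℝ :=
  ∑ k : Order ℓ, (∫ x, h x * Y ℓ k x ∂surf) ^ 2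

theorem scalarLevelSq_nonneg (h : C(S2, ℝ)) (ℓ : ℕ) : 0 ≤ scalarLevelSq h ℓ :=
  Finset.sum_nonneg fun _ _ => sq_nonneg _

theorem scalarSobolevTerm_eq (σ : ℝ) (h : C(S2, ℝ)) (ℓ : ℕ) :
    scalarSobolevTerm σ h ℓ = (1 + eigen ℓ) ^ σ * scalarLevelSq h ℓ := by
  rw [scalarSobolevTerm, scalarLevelSq, Finset.mul_sum]

/-- Harmonics of degree above that of `q` do not see `q`, so this is Bessel's inequality for `h -
q`. -/
theorem sum_scalarLevelSq_sub_le {q : Poly} (h : C(S2, ℝ)) (s : Finset ℕ)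
    (hs : ∀ ℓ ∈ s, q.totalDegree < ℓ) :
    ∑ ℓ ∈ s, scalarLevelSq h ℓ ≤ ∫ x, (h x - polyFun q x) ^ 2 ∂surf := by
  set H := ContinuousMap.toLp (E := ℝ) 2 surf ℝ h with hH
  have h1 := orthonormal_Ypoly.sum_inner_products_le (H - polyToL2 q)
    (s := s.sigma fun _ => Finset.univ)
  have h2 : ‖H - polyToL2 q‖ ^ 2 = ∫ x, (h x - polyFun q x) ^ 2 ∂surf := by
    rw [polyToL2_eq, hH, ← map_sub, norm_toLp_sq_real]
    simp only [ContinuousMap.sub_apply, polyToC_apply]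
  rw [h2, Finset.sum_sigma] at h1
  refine le_of_eq_of_le (Finset.sum_congr rfl fun ℓ hℓ => Finset.sum_congr rfl fun k _ => ?_) h1
  rw [inner_sub_right, inner_polyToL2, mul_comm (Ypoly ℓ k),
    sphInt_mul_eq_zero_of_totalDegree_lt (Ypoly_mem ℓ k) (hs ℓ hℓ), sub_zero, polyToL2_eq, hH,
    inner_toLp_toLp_real, Real.norm_eq_abs, sq_abs]
  congr 1
  refine integral_congr_ae (Eventually.of_forall fun x => ?_)
  simp only [polyToC_apply, Y_eq]
  ring

theorem sum_scalarLevelSq_le (h : C(S2, ℝ)) (s : Finset ℕ) :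
    ∑ ℓ ∈ s, scalarLevelSq h ℓ ≤ ∫ x, h x ^ 2 ∂surf := by
  have h1 := orthonormal_Ypoly.sum_inner_products_le (ContinuousMap.toLp (E := ℝ) 2 surf ℝ h)
    (s := s.sigma fun _ => Finset.univ)
  rw [norm_toLp_sq_real, Finset.sum_sigma] at h1
  refine le_of_eq_of_le (Finset.sum_congr rfl fun ℓ hℓ => Finset.sum_congr rfl fun k _ => ?_) h1
  rw [polyToL2_eq, inner_toLp_toLp_real, Real.norm_eq_abs, sq_abs]
  congr 1
  refine integral_congr_ae (Eventually.of_forall fun x => ?_)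
  simp only [polyToC_apply, Y_eq]
  ring

/-- The pointwise inner product of two continuous fields. -/
def innerC (f g : C(S2, E3)) : C(S2, ℝ) := ⟨fun x => ⟪f x, g x⟫, f.continuous.inner g.continuous⟩

theorem norm_tang_sub_partialSumL2_sq {f : C(S2, E3)} (hf : ∀ x : S2, ⟪(x : E3), f x⟫ = 0)
    (n : ℕ) : ‖tang f hf - partialSumL2 (tang f hf) n‖ ^ 2 =
      ∫ x, ‖f x - partialSum (tang f hf) n x‖ ^ 2 ∂surf := by
  have : ‖tang f hf - partialSumL2 (tang f hf) n‖ =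
      ‖ContinuousMap.toLp (E := E3) 2 surf ℝ (f - partialSum (tang f hf) n)‖ := by
    rw [map_sub]; rfl
  rw [this, norm_toLp_sq]
  rfl

theorem integrable_norm_sub_sq (f g : C(S2, E3)) :
    Integrable (fun x => ‖f x - g x‖ ^ 2) surf :=
  integrable_of_continuous ((f.continuous.sub g.continuous).norm.pow 2)

/-- The error of approximation of an inner product by polynomials. -/
theorem integral_inner_sub_sq_le {f g p q : C(S2, E3)} {A B : ℝ} (hA : ∀ x, ‖g x‖ ^ 2 ≤ A)
    (hB : ∀ x, ‖p x‖ ^ 2 ≤ B) :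
    ∫ x, (⟪f x, g x⟫ - ⟪p x, q x⟫) ^ 2 ∂surf ≤
      2 * A * ∫ x, ‖f x - p x‖ ^ 2 ∂surf + 2 * B * ∫ x, ‖g x - q x‖ ^ 2 ∂surf := by
  rw [← integral_const_mul, ← integral_const_mul, ← integral_add
    ((integrable_norm_sub_sq f p).const_mul _) ((integrable_norm_sub_sq g q).const_mul _)]
  refine integral_mono (integrable_of_continuous (by fun_prop))
    (((integrable_norm_sub_sq f p).const_mul _).add ((integrable_norm_sub_sq g q).const_mul _))
    fun x => ?_
  -- This splitting pairs each approximation error with `g` or with the approximant `p`, so no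
  -- uniform bound on `f` is required.
  have h1 : ⟪f x, g x⟫ - ⟪p x, q x⟫ = ⟪f x - p x, g x⟫ + ⟪p x, g x - q x⟫ := by
    rw [inner_sub_left, inner_sub_right]; ring
  have h2 : ⟪f x - p x, g x⟫ ^ 2 ≤ ‖f x - p x‖ ^ 2 * A := by
    refine le_trans ?_ (mul_le_mul_of_nonneg_left (hA x) (sq_nonneg _))
    rw [← mul_pow]
    exact sq_le_sq' (neg_le_of_abs_le (abs_real_inner_le_norm _ _)) (real_inner_le_norm _ _)
  have h3 : ⟪p x, g x - q x⟫ ^ 2 ≤ B * ‖g x - q x‖ ^ 2 := by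
    refine le_trans ?_ (mul_le_mul_of_nonneg_right (hB x) (sq_nonneg _))
    rw [← mul_pow]
    exact sq_le_sq' (neg_le_of_abs_le (abs_real_inner_le_norm _ _)) (real_inner_le_norm _ _)
  change (⟪f x, g x⟫ - ⟪p x, q x⟫) ^ 2 ≤ 2 * A * ‖f x - p x‖ ^ 2 + 2 * B * ‖g x - q x‖ ^ 2
  rw [h1]
  nlinarith [sq_nonneg (⟪f x - p x, g x⟫ - ⟪p x, g x - q x⟫)]

/-- `(ℓ - 1) / 2` counts the `n` with `2n + 2 < ℓ`, the tails in which degree `ℓ` occurs. The term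
`9 ^ σ` covers `ℓ ≤ 2`, where this count vanishes. -/
theorem one_add_eigen_rpow_le {σ : ℝ} (hσ : 0 < σ) (ℓ : ℕ) :
    (1 + eigen ℓ) ^ σ ≤ 9 ^ σ + 25 ^ σ * (((ℓ - 1) / 2 : ℕ) : ℝ) ^ (2 * σ) := by
  set k := (ℓ - 1) / 2 with hk
  have hℓ : (0 : ℝ) ≤ ℓ := ℓ.cast_nonneg
  have h0 : (0 : ℝ) ≤ 9 ^ σ := by positivity
  have h1 : (0 : ℝ) ≤ 25 ^ σ * (k : ℝ) ^ (2 * σ) := by positivity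
  rcases Nat.eq_zero_or_pos k with hk0 | hk0
  · have : (ℓ : ℝ) ≤ 2 := by
      have : ℓ ≤ 2 := by omega
      exact_mod_cast this
    have h2 : (1 + eigen ℓ) ^ σ ≤ 9 ^ σ :=
      Real.rpow_le_rpow (one_add_eigen_pos _).le (by unfold eigen; nlinarith) hσ.le
    linarith
  · have h3 : (ℓ : ℝ) ≤ 2 * k + 2 := by
      have : ℓ ≤ 2 * k + 2 := by omega
      exact_mod_cast this
    have h4 : (1 : ℝ) ≤ k := by exact_mod_cast hk0
    have h2 : (1 + eigen ℓ) ^ σ ≤ (25 * (k : ℝ) ^ 2) ^ σ :=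
      Real.rpow_le_rpow (one_add_eigen_pos _).le (by unfold eigen; nlinarith) hσ.le
    rw [Real.mul_rpow (by norm_num) (by positivity), ← Real.rpow_two, ← Real.rpow_mul (by positivity)]
      at h2
    linarith

/-- The constant of the product estimate. -/
def prodConst (σ : ℝ) : ℝ := (4 * 9 ^ σ + 16 * 25 ^ σ) * sobConst σ

theorem prodConst_nonneg (σ : ℝ) : 0 ≤ prodConst σ :=
  mul_nonneg (by positivity) (sobConst_nonneg σ)

/-- The inner product of the partial sums with index `n` is a polynomial of degree at most `2n + 2`.
Beyond that degree the harmonics of `f · g` are bounded by the `L₂` tails of `f` and `g`, whose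
weighted sums are Sobolev norms. -/
theorem sum_rpowDiff_mul_scalarLevelSq_le {σ : ℝ} (hσ : 1 < σ) {f g : C(S2, E3)}
    (hf : ∀ x : S2, ⟪(x : E3), f x⟫ = 0) (hg : ∀ x : S2, ⟪(x : E3), g x⟫ = 0)
    (hfs : Summable (sobTerm σ (tang f hf))) (hgs : Summable (sobTerm σ (tang g hg)))
    (hgb : ∀ x, ‖g x‖ ^ 2 ≤ 4 * sobConst σ * sobSq σ (tang g hg)) (L : ℕ) :
    ∑ n ∈ Finset.range L, rpowDiff σ n *
      ∑ ℓ ∈ Finset.range L with 2 * n + 2 < ℓ, scalarLevelSq (innerC f g) ℓ ≤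
      16 * sobConst σ * (sobSq σ (tang f hf) * sobSq σ (tang g hg)) := by
  set u := tang f hf
  set v := tang g hg
  have hσ0 : 0 < σ := by linarith
  set A := 4 * sobConst σ * sobSq σ v
  set B := 4 * sobConst σ * sobSq σ u
  have hA : 0 ≤ A := mul_nonneg (mul_nonneg (by norm_num) (sobConst_nonneg σ)) (sobSq_nonneg σ v)
  have hB : 0 ≤ B := mul_nonneg (mul_nonneg (by norm_num) (sobConst_nonneg σ)) (sobSq_nonneg σ u)
  have key : ∀ n, ∑ ℓ ∈ Finset.range L with 2 * n + 2 < ℓ, scalarLevelSq (innerC f g) ℓ ≤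
      2 * A * ‖u - partialSumL2 u n‖ ^ 2 + 2 * B * ‖v - partialSumL2 v n‖ ^ 2 := by
    intro n
    obtain ⟨q, hq, hq'⟩ := exists_poly_inner (partialSum_mem_polyFields u n)
      (partialSum_mem_polyFields v n)
    rw [norm_tang_sub_partialSumL2_sq, norm_tang_sub_partialSumL2_sq]
    refine le_trans (sum_scalarLevelSq_sub_le (q := q) (innerC f g) _ fun ℓ hℓ => ?_) ?_
    · rw [Finset.mem_filter] at hℓ
      omega
    · simp only [← hq']
      exact integral_inner_sub_sq_le hgb (norm_partialSum_sq_le hσ hfs n)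
  calc _ ≤ ∑ n ∈ Finset.range L, rpowDiff σ n *
        (2 * A * ‖u - partialSumL2 u n‖ ^ 2 + 2 * B * ‖v - partialSumL2 v n‖ ^ 2) :=
        Finset.sum_le_sum fun n _ => mul_le_mul_of_nonneg_left (key n) (rpowDiff_nonneg hσ0.le n)
    _ = 2 * A * ∑ n ∈ Finset.range L, rpowDiff σ n * ‖u - partialSumL2 u n‖ ^ 2 +
        2 * B * ∑ n ∈ Finset.range L, rpowDiff σ n * ‖v - partialSumL2 v n‖ ^ 2 := by
        rw [Finset.mul_sum, Finset.mul_sum, ← Finset.sum_add_distrib]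
        exact Finset.sum_congr rfl fun n _ => by ring
    _ ≤ 2 * A * sobSq σ u + 2 * B * sobSq σ v := by
        have h1 := sum_rpowDiff_mul_tail_le hσ0 hfs L
        have h2 := sum_rpowDiff_mul_tail_le hσ0 hgs L
        gcongr
    _ = _ := by ring

theorem sum_scalarSobolevTerm_le {σ : ℝ} (hσ : 1 < σ) {f g : C(S2, E3)}
    (hf : ∀ x : S2, ⟪(x : E3), f x⟫ = 0) (hg : ∀ x : S2, ⟪(x : E3), g x⟫ = 0)
    (hfs : Summable (sobTerm σ (tang f hf))) (hgs : Summable (sobTerm σ (tang g hg)))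
    (hgb : ∀ x, ‖g x‖ ^ 2 ≤ 4 * sobConst σ * sobSq σ (tang g hg)) (L : ℕ) :
    ∑ ℓ ∈ Finset.range L, scalarSobolevTerm σ (innerC f g) ℓ ≤
      prodConst σ * (sobSq σ (tang f hf) * sobSq σ (tang g hg)) := by
  have hσ0 : 0 < σ := by linarith
  have h1 := sum_rpowDiff_mul_scalarLevelSq_le hσ hf hg hfs hgs hgb L
  set h := innerC f g with hh
  set u := tang f hf with hu
  set v := tang g hg
  have h2 : ∑ ℓ ∈ Finset.range L, scalarLevelSq h ℓ ≤
      4 * sobConst σ * (sobSq σ u * sobSq σ v) := by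
    refine (sum_scalarLevelSq_le h _).trans ?_
    have h3 : ‖u‖ ^ 2 = ∫ x, ‖f x‖ ^ 2 ∂surf := norm_toLp_sq f
    calc ∫ x, h x ^ 2 ∂surf ≤ ∫ x, (4 * sobConst σ * sobSq σ v) * ‖f x‖ ^ 2 ∂surf := by
          refine integral_mono (integrable_of_continuous (by fun_prop))
            (integrable_of_continuous (by fun_prop)) fun x => ?_
          refine le_trans ?_ (mul_le_mul_of_nonneg_right (hgb x) (sq_nonneg _))
          rw [mul_comm, ← mul_pow]
          change ⟪f x, g x⟫ ^ 2 ≤ _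
          exact sq_le_sq' (neg_le_of_abs_le (abs_real_inner_le_norm _ _))
            (real_inner_le_norm _ _)
      _ = (4 * sobConst σ * sobSq σ v) * ‖u‖ ^ 2 := by rw [integral_const_mul, h3]
      _ ≤ (4 * sobConst σ * sobSq σ v) * sobSq σ u := by
          refine mul_le_mul_of_nonneg_left (norm_sq_le_sobSq hσ0 hfs) ?_
          exact mul_nonneg (mul_nonneg (by norm_num) (sobConst_nonneg σ)) (sobSq_nonneg σ v)
      _ = _ := by ring
  -- Abel summation: the power of `(ℓ - 1) / 2` is the telescoped sum of weights over `2n + 2 < ℓ`.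
  have h3 : ∑ ℓ ∈ Finset.range L, (((ℓ - 1) / 2 : ℕ) : ℝ) ^ (2 * σ) * scalarLevelSq h ℓ ≤
      ∑ n ∈ Finset.range L, rpowDiff σ n *
        ∑ ℓ ∈ Finset.range L with 2 * n + 2 < ℓ, scalarLevelSq h ℓ := by
    simp only [Finset.mul_sum, Finset.sum_filter]
    rw [Finset.sum_comm]
    refine Finset.sum_le_sum fun ℓ hℓ => ?_
    rw [Finset.mem_range] at hℓ
    simp only [mul_ite, mul_zero]
    rw [← sum_rpowDiff hσ0, Finset.sum_mul, ← Finset.sum_filter]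
    refine le_of_eq (Finset.sum_congr ?_ fun n _ => rfl)
    ext n
    simp only [Finset.mem_range, Finset.mem_filter]
    omega
  calc ∑ ℓ ∈ Finset.range L, scalarSobolevTerm σ h ℓ
      ≤ ∑ ℓ ∈ Finset.range L, (9 ^ σ * scalarLevelSq h ℓ +
          25 ^ σ * ((((ℓ - 1) / 2 : ℕ) : ℝ) ^ (2 * σ) * scalarLevelSq h ℓ)) := by
        refine Finset.sum_le_sum fun ℓ _ => ?_
        rw [scalarSobolevTerm_eq]
        have := mul_le_mul_of_nonneg_right (one_add_eigen_rpow_le hσ0 ℓ) (scalarLevelSq_nonneg h ℓ)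
        linarith
    _ = 9 ^ σ * ∑ ℓ ∈ Finset.range L, scalarLevelSq h ℓ + 25 ^ σ *
          ∑ ℓ ∈ Finset.range L, (((ℓ - 1) / 2 : ℕ) : ℝ) ^ (2 * σ) * scalarLevelSq h ℓ := by
        rw [Finset.sum_add_distrib, Finset.mul_sum, Finset.mul_sum]
    _ ≤ 9 ^ σ * (4 * sobConst σ * (sobSq σ u * sobSq σ v)) +
          25 ^ σ * (16 * sobConst σ * (sobSq σ u * sobSq σ v)) := by
        have := h3.trans h1
        gcongr
    _ = _ := by rw [prodConst]; ring

/-- The product estimate: inner products of Sobolev fields of order `σ > 1` are Sobolev functions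
of the same order. -/
theorem memScalarSobolev_innerC {σ : ℝ} (hσ : 1 < σ) {f g : C(S2, E3)}
    (hf : ∀ x : S2, ⟪(x : E3), f x⟫ = 0) (hg : ∀ x : S2, ⟪(x : E3), g x⟫ = 0)
    (hfs : Summable (sobTerm σ (tang f hf))) (hgs : Summable (sobTerm σ (tang g hg)))
    (hgb : ∀ x, ‖g x‖ ^ 2 ≤ 4 * sobConst σ * sobSq σ (tang g hg)) :
    MemScalarSobolev σ (innerC f g) ∧ scalarSobolevNorm σ (innerC f g) ^ 2 ≤
      prodConst σ * (sobSq σ (tang f hf) * sobSq σ (tang g hg)) := by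
  have h0 : ∀ ℓ, 0 ≤ scalarSobolevTerm σ (innerC f g) ℓ := fun ℓ => by
    rw [scalarSobolevTerm_eq]
    exact mul_nonneg (Real.rpow_nonneg (one_add_eigen_pos _).le _) (scalarLevelSq_nonneg _ ℓ)
  have h1 := sum_scalarSobolevTerm_le hσ hf hg hfs hgs hgb
  refine ⟨⟨?_, summable_of_sum_range_le h0 h1⟩, ?_⟩
  · exact (innerC f g).continuous.memLp_of_hasCompactSupport
      (HasCompactSupport.of_compactSpace _)
  · rw [scalarSobolevNorm, Real.sq_sqrt (tsum_nonneg h0)]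
    exact Real.tsum_le_of_sum_range_le h0 h1

/-! ### Matrix kernels as surface gradients and curls -/

/-- The operator `z ↦ x × z` (`true`), or the projection onto the tangent space (`false`). -/
def tanOp (c : Bool) (x : S2) (z : E3) : E3 := bif c then crossE x z else z - ⟪(x : E3), z⟫ • (x : E3)

/-- The tangent vector `v × y` (`true`), or the tangential part of `v` at `y` (`false`). -/
def tanVec (c : Bool) (y : S2) (v : E3) : E3 := bif c then crossE v y else v - ⟪(y : E3), v⟫ • (y : E3)

/-- The kernel field with coefficients `a` (derivative part) and `b`. -/
def kerField (c : Bool) (a b : ℝ) (x y : S2) (v : E3) : E3 :=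
  tanOp c x ((a * ⟪(x : E3), tanVec c y v⟫) • (y : E3) + b • tanVec c y v)

theorem vecC_eq_tanOp (c : Bool) (p : Poly) (x : S2) :
    vecC c p x = tanOp c x (gradient (polyFun p) x) := by
  cases c <;> rfl

theorem tanOp_add (c : Bool) (x : S2) (z z' : E3) :
    tanOp c x (z + z') = tanOp c x z + tanOp c x z' := by
  cases c
  · simp only [tanOp, cond_false, inner_add_right, add_smul]; abel
  · ext j
    fin_cases j <;>
    simp only [tanOp, cond_true, Fin.zero_eta, Fin.mk_one, Fin.reduceFinMk, PiLp.add_apply,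
      crossE_zero, crossE_one, crossE_two] <;> ring

theorem tanOp_smul (c : Bool) (x : S2) (r : ℝ) (z : E3) :
    tanOp c x (r • z) = r • tanOp c x z := by
  cases c
  · simp only [tanOp, cond_false, real_inner_smul_right, smul_sub, smul_smul]
  · ext j
    fin_cases j <;>
    simp only [tanOp, cond_true, Fin.zero_eta, Fin.mk_one, Fin.reduceFinMk, PiLp.smul_apply,
      smul_eq_mul, crossE_zero, crossE_one, crossE_two] <;> ring

theorem kerField_eq (c : Bool) (a b : ℝ) (x y : S2) (v : E3) : kerField c a b x y v =
    (a * ⟪(x : E3), tanVec c y v⟫) • tanOp c x y + b • tanOp c x (tanVec c y v) := by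
  rw [kerField, tanOp_add, tanOp_smul, tanOp_smul]

theorem kerField_sub (c : Bool) (a b a' b' : ℝ) (x y : S2) (v : E3) :
    kerField c (a - a') (b - b') x y v = kerField c a b x y v - kerField c a' b' x y v := by
  simp only [kerField_eq]
  module

theorem inner_tanVec (c : Bool) (y : S2) (v : E3) : ⟪tanVec c y v, (y : E3)⟫ = 0 := by
  have hy := sphere_sum_sq y
  cases c
  · simp only [tanVec, cond_false]
    rw [inner_sub_left, real_inner_smul_left, inner_self_sphere, mul_one, real_inner_comm, sub_self]
  · simp only [tanVec, cond_true, inner_eq_sum, crossE_zero, crossE_one, crossE_two]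
    ring

theorem inner_self_tanOp (c : Bool) (x : S2) (z : E3) : ⟪(x : E3), tanOp c x z⟫ = 0 := by
  cases c
  · simp only [tanOp, cond_false]
    rw [inner_sub_right, real_inner_smul_right, inner_self_sphere, mul_one, sub_self]
  · simp only [tanOp, cond_true, inner_eq_sum, crossE_zero, crossE_one, crossE_two]
    ring

theorem inner_tanVec_eq (c : Bool) (y : S2) (v g : E3) :
    ⟪tanVec c y v, g⟫ = ⟪v, tanOp c y g⟫ := by
  cases c
  · simp only [tanVec, tanOp, cond_false, inner_sub_left, inner_sub_right, real_inner_smul_left,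
      real_inner_smul_right]
    rw [real_inner_comm v (y : E3)]; ring
  · simp only [tanVec, tanOp, cond_true, inner_eq_sum, crossE_zero, crossE_one, crossE_two]
    ring

theorem norm_tanOp_sq (c : Bool) (x : S2) (z : E3) :
    ‖tanOp c x z‖ ^ 2 = ‖z‖ ^ 2 - ⟪(x : E3), z⟫ ^ 2 := by
  have hx := sphere_sum_sq x
  rw [← real_inner_self_eq_norm_sq, ← real_inner_self_eq_norm_sq]
  cases c
  · simp only [tanOp, cond_false, inner_eq_sum, PiLp.sub_apply, PiLp.smul_apply, smul_eq_mul]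
    linear_combination (x.1 0 * z 0 + x.1 1 * z 1 + x.1 2 * z 2) ^ 2 * hx
  · simp only [tanOp, cond_true, inner_eq_sum, crossE_zero, crossE_one, crossE_two]
    linear_combination (z 0 * z 0 + z 1 * z 1 + z 2 * z 2) * hx

theorem norm_tanVec_le (c : Bool) (y : S2) (v : E3) : ‖tanVec c y v‖ ≤ ‖v‖ := by
  have h : ‖tanVec c y v‖ ^ 2 = ‖tanOp c y v‖ ^ 2 := by
    cases c
    · rfl
    · rw [← real_inner_self_eq_norm_sq, ← real_inner_self_eq_norm_sq]
      simp only [tanVec, tanOp, cond_true, inner_eq_sum, crossE_zero, crossE_one, crossE_two]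
      ring
  rw [norm_tanOp_sq] at h
  exact le_of_sq_le_sq (by nlinarith [sq_nonneg ⟪(y : E3), v⟫]) (norm_nonneg v)

theorem norm_tanOp_le (c : Bool) (x : S2) (z : E3) : ‖tanOp c x z‖ ≤ ‖z‖ :=
  le_of_sq_le_sq (by rw [norm_tanOp_sq]; nlinarith [sq_nonneg ⟪(x : E3), z⟫]) (norm_nonneg z)

theorem one_sub_inner_sq_nonneg (x y : S2) : 0 ≤ 1 - ⟪(x : E3), y⟫ ^ 2 := by
  nlinarith [inner_le_one x y, neg_one_le_inner x y]

/-- Both `tanOp c x y` and the component of `x` orthogonal to `y` have length `√(1 - t²)`. Their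
product compensates the growth of `κ'` at the poles. -/
theorem norm_kerField_le (c : Bool) (a b : ℝ) (x y : S2) (v : E3) :
    ‖kerField c a b x y v‖ ≤ (|a| * (1 - ⟪(x : E3), y⟫ ^ 2) + |b|) * ‖v‖ := by
  set w := tanVec c y v
  set s := 1 - ⟪(x : E3), y⟫ ^ 2 with hs
  have hs0 : 0 ≤ s := one_sub_inner_sq_nonneg x y
  have h1 : ‖tanOp c x y‖ = √s := by
    rw [← Real.sqrt_sq (norm_nonneg (tanOp c x y)), norm_tanOp_sq, norm_eq_of_mem_sphere y, one_pow]
  have h2 : |⟪(x : E3), w⟫| ≤ √s * ‖v‖ := by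
    have e1 : ⟪(x : E3), w⟫ = ⟪tanOp false y x, w⟫ := by
      have := inner_tanVec c y v
      rw [real_inner_comm] at this
      simp only [tanOp, cond_false, inner_sub_left, real_inner_smul_left]
      rw [this, mul_zero, sub_zero]
    have e2 : ‖tanOp false y x‖ = √s := by
      rw [← Real.sqrt_sq (norm_nonneg (tanOp false y x)), norm_tanOp_sq, norm_eq_of_mem_sphere x,
        one_pow, real_inner_comm, hs]
    rw [e1, ← e2]
    exact (abs_real_inner_le_norm _ _).trans
      (mul_le_mul_of_nonneg_left (norm_tanVec_le c y v) (norm_nonneg _))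
  have h3 : ‖tanOp c x w‖ ≤ ‖v‖ := (norm_tanOp_le c x w).trans (norm_tanVec_le c y v)
  rw [kerField_eq]
  refine (norm_add_le _ _).trans ?_
  rw [norm_smul, norm_smul, Real.norm_eq_abs, Real.norm_eq_abs, abs_mul, h1]
  have h4 : |⟪(x : E3), w⟫| * √s ≤ s * ‖v‖ := by
    calc _ ≤ √s * ‖v‖ * √s := mul_le_mul_of_nonneg_right h2 (Real.sqrt_nonneg _)
      _ = (√s * √s) * ‖v‖ := by ring
      _ = _ := by rw [Real.mul_self_sqrt hs0]
  calc |a| * |⟪(x : E3), w⟫| * √s + |b| * ‖tanOp c x w‖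
      ≤ |a| * (s * ‖v‖) + |b| * ‖v‖ := by
        rw [mul_assoc]
        gcongr
    _ = _ := by ring

theorem gradient_zonal_mul_linPoly (K : Polynomial ℝ) (y w x : E3) :
    gradient (polyFun (zonal K y * linPoly w)) x =
      ((Polynomial.derivative K).eval ⟪x, y⟫ * ⟪x, w⟫) • y + (K.eval ⟪x, y⟫) • w := by
  rw [gradient_polyFun]
  ext i
  have h : MvPolynomial.pderiv i (zonal K y) =
      zonal (Polynomial.derivative K) y * MvPolynomial.C (y i) := by
    rw [zonal, Derivation.map_aeval, smul_eq_mul, pderiv_linPoly, zonal]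
  simp only [MvPolynomial.pderiv_mul, h, pderiv_linPoly, polyFun_add, polyFun_mul, polyFun_C,
    polyFun_zonal, polyFun_linPoly, PiLp.add_apply, PiLp.smul_apply, smul_eq_mul]
  ring

/-- The kernel field has the scalar potential `K(x·y) (x·w)`. This reduces its vector Fourier
coefficients to a scalar Funk–Hecke formula. -/
theorem vecC_zonal_mul_linPoly (c : Bool) (K : Polynomial ℝ) (x y : S2) (v : E3) :
    vecC c (zonal K y * linPoly (tanVec c y v)) x =
      kerField c ((Polynomial.derivative K).eval ⟪(x : E3), y⟫) (K.eval ⟪(x : E3), y⟫) x y v := by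
  rw [vecC_eq_tanOp, gradient_zonal_mul_linPoly, kerField]

theorem integral_vecC_vecC (c c' : Bool) {n : ℕ} {q : Poly} (hq : q ∈ harmonicPoly n) (p : Poly) :
    ∫ x, ⟪vecC c p x, vecC c' q x⟫ ∂surf = if c = c' then eigen n * sphInt (p * q) else 0 := by
  have h := inner_toLp_toLp (vecC c p) (vecC c' q)
  rw [← h]
  split_ifs with hc
  · subst hc; exact inner_vecL2_vecL2 c hq p
  · exact inner_vecL2_of_ne hc p q

/-! ### The scalar kernels -/

/-- The primitive of `δ` vanishing at `-1`. -/
def primit (δ : ℝ → ℝ) (t : ℝ) : ℝ := ∫ s in (-1 : ℝ)..t, δ s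

/-- `κ(t) = (1 - t²)⁻¹ ∫_{-1}^t δ`. -/
def kap (δ : ℝ → ℝ) (t : ℝ) : ℝ := primit δ t / (1 - t ^ 2)

/-- The derivative of `κ`. -/
def kapDeriv (δ : ℝ → ℝ) (t : ℝ) : ℝ := δ t / (1 - t ^ 2) + 2 * t * primit δ t / (1 - t ^ 2) ^ 2

theorem hasDerivAt_primit {δ : ℝ → ℝ} (hδ : Continuous δ) (t : ℝ) :
    HasDerivAt (primit δ) (δ t) t :=
  intervalIntegral.integral_hasDerivAt_right (hδ.intervalIntegrable _ _)
    (hδ.stronglyMeasurableAtFilter _ _) hδ.continuousAt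

theorem hasDerivAt_kap {δ : ℝ → ℝ} (hδ : Continuous δ) {t : ℝ} (ht : t ∈ Ioo (-1 : ℝ) 1) :
    HasDerivAt (kap δ) (kapDeriv δ t) t := by
  have h0 : 1 - t ^ 2 ≠ 0 := by nlinarith [ht.1, ht.2]
  have h1 : HasDerivAt (fun t : ℝ => 1 - t ^ 2) (-(2 * t)) t := by
    simpa using (hasDerivAt_pow 2 t).const_sub 1
  refine ((hasDerivAt_primit hδ t).div h1 h0).congr_deriv ?_
  rw [kapDeriv]
  field_simp
  ring

theorem continuous_primit {δ : ℝ → ℝ} (hδ : Continuous δ) : Continuous (primit δ) :=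
  continuous_iff_continuousAt.mpr fun t => (hasDerivAt_primit hδ t).continuousAt

theorem measurable_kap {δ : ℝ → ℝ} (hδ : Continuous δ) : Measurable (kap δ) :=
  (continuous_primit hδ).measurable.div (by fun_prop)

theorem measurable_kapDeriv {δ : ℝ → ℝ} (hδ : Continuous δ) : Measurable (kapDeriv δ) := by
  have := (continuous_primit hδ).measurable
  have := hδ.measurable
  unfold kapDeriv
  fun_prop

theorem primit_sub {δ η : ℝ → ℝ} (hδ : Continuous δ) (hη : Continuous η) (t : ℝ) :
    primit (fun s => δ s - η s) t = primit δ t - primit η t :=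
  intervalIntegral.integral_sub (hδ.intervalIntegrable _ _) (hη.intervalIntegrable _ _)

theorem kap_sub {δ η : ℝ → ℝ} (hδ : Continuous δ) (hη : Continuous η) (t : ℝ) :
    kap (fun s => δ s - η s) t = kap δ t - kap η t := by
  rw [kap, primit_sub hδ hη, sub_div]; rfl

theorem kapDeriv_sub {δ η : ℝ → ℝ} (hδ : Continuous δ) (hη : Continuous η) (t : ℝ) :
    kapDeriv (fun s => δ s - η s) t = kapDeriv δ t - kapDeriv η t := by
  simp only [kapDeriv, primit_sub hδ hη]; ring

/-- As `δ` has mean zero, its primitive can be computed from the nearer endpoint, and `min(1 - t, 1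
+ t) ≤ 1 - t²`. -/
theorem abs_primit_le {δ : ℝ → ℝ} (hδ : Continuous δ) (h0 : primit δ 1 = 0) {ε : ℝ}
    (hε : ∀ t ∈ Icc (-1 : ℝ) 1, |δ t| ≤ ε) {t : ℝ} (ht : t ∈ Icc (-1 : ℝ) 1) :
    |primit δ t| ≤ ε * (1 - t ^ 2) := by
  have hε0 : 0 ≤ ε := (abs_nonneg _).trans (hε t ht)
  have h1 : |primit δ t| ≤ ε * |t - -1| := by
    refine intervalIntegral.norm_integral_le_of_norm_le_const (E := ℝ) (f := δ) fun s hs => ?_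
    rw [uIoc_of_le ht.1] at hs
    exact hε s ⟨hs.1.le, hs.2.trans ht.2⟩
  have h2 : |primit δ t| ≤ ε * |1 - t| := by
    have h3 : primit δ t = -∫ s in t..1, δ s := by
      have := intervalIntegral.integral_add_adjacent_intervals
        (hδ.intervalIntegrable (-1) t (μ := volume)) (hδ.intervalIntegrable t 1)
      change primit δ t + _ = primit δ 1 at this
      linarith
    rw [h3, abs_neg]
    refine intervalIntegral.norm_integral_le_of_norm_le_const (E := ℝ) (f := δ) fun s hs => ?_
    rw [uIoc_of_le ht.2] at hs
    exact hε s ⟨ht.1.trans hs.1.le, hs.2⟩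
  rw [abs_of_nonneg (by linarith [ht.1] : 0 ≤ t - -1)] at h1
  rw [abs_of_nonneg (by linarith [ht.2] : 0 ≤ 1 - t)] at h2
  rcases le_total 0 t with h | h
  · refine h2.trans (mul_le_mul_of_nonneg_left ?_ hε0)
    nlinarith [ht.2]
  · refine h1.trans (mul_le_mul_of_nonneg_left ?_ hε0)
    nlinarith [ht.1]

theorem abs_kap_le {δ : ℝ → ℝ} (hδ : Continuous δ) (h0 : primit δ 1 = 0) {ε : ℝ}
    (hε : ∀ t ∈ Icc (-1 : ℝ) 1, |δ t| ≤ ε) {t : ℝ} (ht : t ∈ Icc (-1 : ℝ) 1) :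
    |kap δ t| ≤ ε ∧ |kapDeriv δ t| * (1 - t ^ 2) ≤ 3 * ε := by
  have hε0 : 0 ≤ ε := (abs_nonneg _).trans (hε t ht)
  have h1 := abs_primit_le hδ h0 hε ht
  have hs : 0 ≤ 1 - t ^ 2 := by nlinarith [ht.1, ht.2]
  have ht1 : |t| ≤ 1 := abs_le.mpr ht
  rcases hs.eq_or_lt with h | h
  -- At `t = ±1` the quotients have denominator zero and take the value `0`.
  · rw [kap, kapDeriv, ← h]
    simp only [div_zero, abs_zero, mul_zero]
    exact ⟨hε0, by linarith⟩
  · have h2 : |kap δ t| ≤ ε := by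
      rw [kap, abs_div, abs_of_pos h, div_le_iff₀ h]
      exact h1
    refine ⟨h2, ?_⟩
    have h3 : kapDeriv δ t = (δ t + 2 * t * kap δ t) / (1 - t ^ 2) := by
      rw [kapDeriv, kap]
      field_simp
    rw [h3, abs_div, abs_of_pos h, div_mul_cancel₀ _ h.ne']
    refine (abs_add_le _ _).trans ?_
    rw [abs_mul, abs_mul, abs_two]
    have h4 : |t| * |kap δ t| ≤ 1 * ε := mul_le_mul ht1 h2 (abs_nonneg _) zero_le_one
    have := hε t ht
    nlinarith

theorem inner_mem_Icc (x y : S2) : ⟪(x : E3), y⟫ ∈ Icc (-1 : ℝ) 1 :=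
  ⟨neg_one_le_inner x y, inner_le_one x y⟩

/-- The kernel field generated by `δ`. -/
def kerOf (c : Bool) (δ : ℝ → ℝ) (y : S2) (v : E3) (x : S2) : E3 :=
  kerField c (kapDeriv δ ⟪(x : E3), y⟫) (kap δ ⟪(x : E3), y⟫) x y v

theorem norm_kerOf_le (c : Bool) {δ : ℝ → ℝ} (hδ : Continuous δ) (h0 : primit δ 1 = 0) {ε : ℝ}
    (hε : ∀ t ∈ Icc (-1 : ℝ) 1, |δ t| ≤ ε) (y : S2) (v : E3) (x : S2) :
    ‖kerOf c δ y v x‖ ≤ 4 * ε * ‖v‖ := by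
  refine (norm_kerField_le _ _ _ _ _ _).trans (mul_le_mul_of_nonneg_right ?_ (norm_nonneg _))
  have := abs_kap_le hδ h0 hε (inner_mem_Icc x y)
  linarith [this.1, this.2]

theorem continuous_tanOp (c : Bool) {z : S2 → E3} (hz : Continuous z) :
    Continuous fun x => tanOp c x (z x) := by
  cases c
  · simp only [tanOp, cond_false]
    fun_prop
  · simp only [tanOp, cond_true]
    rw [(PiLp.homeomorph 2 (fun _ : Fin 3 => ℝ)).comp_continuous_iff.symm]
    refine continuous_pi fun j => ?_
    fin_cases j
    · change Continuous fun x : S2 => crossE x (z x) 0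
      simp only [crossE_zero]; fun_prop
    · change Continuous fun x : S2 => crossE x (z x) 1
      simp only [crossE_one]; fun_prop
    · change Continuous fun x : S2 => crossE x (z x) 2
      simp only [crossE_two]; fun_prop

theorem measurable_kerOf (c : Bool) {δ : ℝ → ℝ} (hδ : Continuous δ) (y : S2) (v : E3) :
    Measurable (kerOf c δ y v) := by
  have h1 := measurable_kap hδ
  have h2 := measurable_kapDeriv hδ
  have h3 := (continuous_tanOp c (continuous_const (y := (y : E3)))).measurable
  have h4 := (continuous_tanOp c (continuous_const (y := tanVec c y v))).measurable
  have h5 : Measurable fun x : S2 => ⟪(x : E3), (y : E3)⟫ := by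
    exact Continuous.measurable (by fun_prop)
  have h6 : Measurable fun x : S2 => ⟪(x : E3), tanVec c y v⟫ := by
    exact Continuous.measurable (by fun_prop)
  unfold kerOf
  simp only [kerField_eq]
  exact (((h2.comp h5).mul h6).smul h3).add ((h1.comp h5).smul h4)

/-! ### Zonal integrals of continuous functions -/

theorem abs_integral_surf_le {g : S2 → ℝ} {ε : ℝ} (hε : ∀ x, |g x| ≤ ε) :
    |∫ x, g x ∂surf| ≤ ε * (4 * Real.pi) := by
  rw [← surf_real_univ]
  rw [← Real.norm_eq_abs]
  exact norm_integral_le_of_norm_le_const (Eventually.of_forall fun x => hε x)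

/-- Archimedes' theorem. -/
theorem integral_zonal {g : ℝ → ℝ} (hg : Continuous g) (y : S2) :
    ∫ x : S2, g ⟪(x : E3), y⟫ ∂surf = 2 * Real.pi * ∫ t in (-1 : ℝ)..1, g t := by
  have hpi := Real.pi_pos
  rw [← sub_eq_zero, ← abs_nonpos_iff]
  refine le_of_forall_pos_le_add fun η hη => ?_
  -- Reduction to polynomials by Weierstrass; with this accuracy each side of the identity
  -- contributes `η / 2`.
  have hε : 0 < η / (8 * Real.pi) := by positivity
  obtain ⟨p, hp⟩ := exists_polynomial_near_of_continuousOn (-1) 1 g hg.continuousOn _ hε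
  have h1 := sphInt_zonal p y
  simp only [sphInt_apply, polyFun_zonal, polyInt_apply] at h1
  have h2 : |∫ x : S2, (g ⟪(x : E3), y⟫ - p.eval ⟪(x : E3), y⟫) ∂surf| ≤
      η / (8 * Real.pi) * (4 * Real.pi) := by
    refine abs_integral_surf_le fun x => ?_
    rw [abs_sub_comm]
    exact (hp _ (inner_mem_Icc x y)).le
  have h3 : |∫ t in (-1 : ℝ)..1, (g t - p.eval t)| ≤ η / (8 * Real.pi) * |1 - (-1 : ℝ)| := by
    refine intervalIntegral.norm_integral_le_of_norm_le_const (E := ℝ)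
      (f := fun t => g t - p.eval t) fun s hs => ?_
    rw [uIoc_of_le (by norm_num : (-1 : ℝ) ≤ 1)] at hs
    exact (abs_sub_comm _ _).trans_le (hp s ⟨hs.1.le, hs.2⟩).le
  have h2' : Continuous fun x : S2 => p.eval ⟪(x : E3), (y : E3)⟫ :=
    p.continuous.comp (by fun_prop)
  rw [integral_sub (integrable_of_continuous (by fun_prop)) (integrable_of_continuous h2'),
    h1] at h2
  rw [intervalIntegral.integral_sub (hg.intervalIntegrable _ _)
    (polynomial_intervalIntegrable p _ _)] at h3
  set I := ∫ x : S2, g ⟪(x : E3), y⟫ ∂surf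
  set J := ∫ t in (-1 : ℝ)..1, g t
  set P := ∫ t in (-1 : ℝ)..1, p.eval t
  have h4 : I - 2 * Real.pi * J = (I - 2 * Real.pi * P) - 2 * Real.pi * (J - P) := by ring
  rw [h4, zero_add]
  refine (abs_sub _ _).trans ?_
  rw [abs_mul, abs_of_pos (by positivity : 0 < 2 * Real.pi)]
  have h5 : 2 * Real.pi * |J - P| ≤ 2 * Real.pi * (η / (8 * Real.pi) * |1 - (-1 : ℝ)|) :=
    mul_le_mul_of_nonneg_left h3 (by positivity)
  have h6 : η / (8 * Real.pi) * (4 * Real.pi) +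
      2 * Real.pi * (η / (8 * Real.pi) * |1 - (-1 : ℝ)|) = η := by
    norm_num
    field_simp
    norm_num
  linarith

/-- At the poles `t^(2m) = 1`, while by Archimedes `∫ t^(2m) = 4π / (2m + 1)` tends to `0`. Hence
the values of `κ` and `κ'` at `±1` never matter. -/
theorem surf_poles_null (y : S2) : ∀ᵐ x : S2 ∂surf, ⟪(x : E3), y⟫ ∈ Ioo (-1 : ℝ) 1 := by
  have hS : MeasurableSet {x : S2 | ⟪(x : E3), (y : E3)⟫ ∉ Ioo (-1 : ℝ) 1} :=
    (measurableSet_Ioo.preimage (Continuous.measurable (by fun_prop))).compl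
  set S := {x : S2 | ⟪(x : E3), (y : E3)⟫ ∉ Ioo (-1 : ℝ) 1} with hSdef
  have h1 : ∀ m : ℕ, surf.real S ≤ 4 * Real.pi / (2 * m + 1) := by
    intro m
    have h2 := integral_zonal (continuous_pow (2 * m)) y
    rw [integral_pow] at h2
    have h3 : surf.real S = ∫ x : S2, S.indicator 1 x ∂surf := by
      rw [integral_indicator_one hS]
    rw [h3]
    calc ∫ x : S2, S.indicator 1 x ∂surf ≤ ∫ x : S2, ⟪(x : E3), (y : E3)⟫ ^ (2 * m) ∂surf := by
          refine integral_mono ((integrable_const (1 : ℝ)).indicator hS)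
            (integrable_of_continuous (by fun_prop)) fun x => ?_
          by_cases hx : x ∈ S
          · rw [indicator_of_mem hx]
            have h4 : ⟪(x : E3), (y : E3)⟫ ^ 2 = 1 := by
              have h5 := inner_mem_Icc x y
              rcases h5.1.eq_or_lt with h | h
              · rw [← h]; norm_num
              rcases h5.2.eq_or_lt with h' | h'
              · rw [h']; norm_num
              · exact absurd ⟨h, h'⟩ hx
            simp [pow_mul, h4]
          · rw [indicator_of_notMem hx]
            rw [pow_mul]; positivity
      _ = _ := by
        rw [h2]
        have : (-1 : ℝ) ^ (2 * m + 1) = -1 := by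
          rw [pow_succ, pow_mul]; norm_num
        rw [this, one_pow]
        push_cast
        ring
  have h2 : Tendsto (fun m : ℕ => 4 * Real.pi / (2 * (m : ℝ) + 1)) atTop (𝓝 0) := by
    refine tendsto_const_nhds.div_atTop ?_
    exact tendsto_atTop_add_const_right _ _
      (tendsto_natCast_atTop_atTop.const_mul_atTop (by norm_num))
  have h3 : surf.real S ≤ 0 := ge_of_tendsto' h2 h1
  have h4 : surf.real S = 0 := le_antisymm h3 measureReal_nonneg
  rw [measureReal_eq_zero_iff] at h4
  exact h4

/-! ### Fourier coefficients of the kernel fields -/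

theorem eq_zero_of_forall_abs_le {D C : ℝ} (h : ∀ ε > 0, |D| ≤ C * ε) : D = 0 := by
  have h1 : Tendsto (fun ε : ℝ => C * ε) (𝓝[>] 0) (𝓝 0) := by
    have : Tendsto (fun ε : ℝ => C * ε) (𝓝 0) (𝓝 (C * 0)) := tendsto_id.const_mul C
    rw [mul_zero] at this
    exact this.mono_left nhdsWithin_le_nhds
  exact abs_nonpos_iff.mp (ge_of_tendsto h1 (eventually_mem_nhdsWithin.mono fun ε hε => h ε hε))

theorem exists_eq_one_sub_X_sq_mul {A : Polynomial ℝ} (h1 : A.eval 1 = 0) (h2 : A.eval (-1) = 0) :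
    ∃ K : Polynomial ℝ, A = (1 - Polynomial.X ^ 2) * K := by
  obtain ⟨B, hB⟩ := Polynomial.dvd_iff_isRoot.mpr (show A.IsRoot 1 from h1)
  have h3 : B.eval (-1) = 0 := by
    rw [hB] at h2
    simp only [Polynomial.eval_mul, Polynomial.eval_sub, Polynomial.eval_X,
      Polynomial.eval_C] at h2
    linarith
  obtain ⟨K, hK⟩ := Polynomial.dvd_iff_isRoot.mpr (show B.IsRoot (-1) from h3)
  refine ⟨-K, ?_⟩
  rw [hB, hK]
  simp only [map_one, map_neg]
  ring

/-- The primitive of a mean-free polynomial from `-1` vanishes at `±1`, so it is divisible by `1 -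
X²` and `κ` is itself a polynomial. -/
theorem exists_polynomial_kap {p : Polynomial ℝ} (hp : polyInt p = 0) :
    ∃ K : Polynomial ℝ, Polynomial.derivative ((1 - Polynomial.X ^ 2) * K) = p ∧
      ∀ t ∈ Ioo (-1 : ℝ) 1, kap (fun s => p.eval s) t = K.eval t ∧
        kapDeriv (fun s => p.eval s) t = (Polynomial.derivative K).eval t := by
  obtain ⟨g, hg⟩ := exists_derivative_eq p
  set A := g - Polynomial.C (g.eval (-1)) with hA
  have hA' : Polynomial.derivative A = p := by simp [hA, hg]
  have hA1 : A.eval (-1) = 0 := by simp [hA]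
  have hA2 : A.eval 1 = 0 := by
    have := polyInt_derivative A
    rw [hA', hp, hA1] at this
    linarith
  obtain ⟨K, hK⟩ := exists_eq_one_sub_X_sq_mul hA2 hA1
  rw [hK] at hA'
  refine ⟨K, hA', fun t ht => ?_⟩
  have h0 : 1 - t ^ 2 ≠ 0 := by nlinarith [ht.1, ht.2]
  have h1 : primit (fun s => p.eval s) t = (1 - t ^ 2) * K.eval t := by
    rw [primit, ← hA', integral_eval_derivative]
    simp
  have h2 : p.eval t = -(2 * t) * K.eval t + (1 - t ^ 2) * (Polynomial.derivative K).eval t := by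
    rw [← hA']
    simp only [Polynomial.derivative_mul, Polynomial.derivative_sub, Polynomial.derivative_one,
      Polynomial.derivative_X_sq, Polynomial.eval_add, Polynomial.eval_mul, Polynomial.eval_sub,
      Polynomial.eval_zero, Polynomial.eval_C, Polynomial.eval_X, Polynomial.eval_one,
      Polynomial.eval_pow]
    ring
  constructor
  · rw [kap, h1]
    field_simp
  · rw [kapDeriv, h1, h2]
    field_simp
    ring

/-- The `λ_n` that Green's formula produces is exactly the factor in front of the integral in
`sphInt_zonal_linPoly_mul`. -/
theorem integral_kerOf_polynomial (c c' : Bool) {p : Polynomial ℝ} (hp : polyInt p = 0) {n : ℕ}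
    {q : Poly} (hq : q ∈ harmonicPoly n) (y : S2) (v : E3) :
    ∫ x, ⟪kerOf c (fun s => p.eval s) y v x, vecC c' q x⟫ ∂surf =
      if c = c' then -(2 * Real.pi * polyInt (p * legendre n)) * ⟪v, vecC c q y⟫ else 0 := by
  obtain ⟨K, hK, hKt⟩ := exists_polynomial_kap hp
  have h1 : ∫ x, ⟪kerOf c (fun s => p.eval s) y v x, vecC c' q x⟫ ∂surf =
      ∫ x, ⟪vecC c (zonal K y * linPoly (tanVec c y v)) x, vecC c' q x⟫ ∂surf := by
    refine integral_congr_ae ?_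
    filter_upwards [surf_poles_null y] with x hx
    rw [vecC_zonal_mul_linPoly, kerOf, (hKt _ hx).1, (hKt _ hx).2]
  rw [h1, integral_vecC_vecC c c' hq]
  split_ifs
  · rw [sphInt_zonal_linPoly_mul hq (inner_tanVec c y v), hK, inner_tanVec_eq, vecC_eq_tanOp]
  · rfl

theorem exists_polynomial_near {δ : ℝ → ℝ} (hδ : Continuous δ) (h0 : primit δ 1 = 0) {ε : ℝ}
    (hε : 0 < ε) :
    ∃ p : Polynomial ℝ, polyInt p = 0 ∧ ∀ t ∈ Icc (-1 : ℝ) 1, |δ t - p.eval t| ≤ ε := by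
  obtain ⟨p, hp⟩ := exists_polynomial_near_of_continuousOn (-1) 1 δ hδ.continuousOn _ (half_pos hε)
  have h1 : |polyInt p| ≤ ε / 2 * |1 - (-1 : ℝ)| := by
    have h2 : polyInt p = ∫ t in (-1 : ℝ)..1, (p.eval t - δ t) := by
      rw [intervalIntegral.integral_sub (polynomial_intervalIntegrable p _ _)
        (hδ.intervalIntegrable _ _)]
      change _ = polyInt p - primit δ 1
      rw [h0, sub_zero]
    rw [h2]
    refine intervalIntegral.norm_integral_le_of_norm_le_const (E := ℝ)
      (f := fun t => p.eval t - δ t) fun s hs => ?_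
    rw [uIoc_of_le (by norm_num : (-1 : ℝ) ≤ 1)] at hs
    exact (hp s ⟨hs.1.le, hs.2⟩).le
  have h3 : |1 - (-1 : ℝ)| = 2 := by norm_num
  rw [h3] at h1
  -- Subtracting its average restores mean zero and costs another `ε / 2`.
  refine ⟨p - Polynomial.C (polyInt p / 2), ?_, fun t ht => ?_⟩
  · rw [map_sub, polyInt_apply (Polynomial.C _)]
    simp only [Polynomial.eval_C, intervalIntegral.integral_const, smul_eq_mul]
    ring
  · have h4 := hp t ht
    rw [abs_lt] at h4
    rw [abs_le] at h1 ⊢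
    simp only [Polynomial.eval_sub, Polynomial.eval_C]
    constructor <;> linarith [h4.1, h4.2, h1.1, h1.2]

theorem kerOf_sub (c : Bool) {δ η : ℝ → ℝ} (hδ : Continuous δ) (hη : Continuous η) (y : S2)
    (v : E3) (x : S2) :
    kerOf c (fun s => δ s - η s) y v x = kerOf c δ y v x - kerOf c η y v x := by
  rw [kerOf, kap_sub hδ hη, kapDeriv_sub hδ hη, kerField_sub]
  rfl

theorem exists_abs_le_Icc {δ : ℝ → ℝ} (hδ : Continuous δ) :
    ∃ M, ∀ t ∈ Icc (-1 : ℝ) 1, |δ t| ≤ M :=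
  isCompact_Icc.exists_bound_of_continuousOn hδ.continuousOn

theorem memLp_kerOf (c : Bool) {δ : ℝ → ℝ} (hδ : Continuous δ) (h0 : primit δ 1 = 0) (y : S2)
    (v : E3) : MemLp (kerOf c δ y v) 2 surf := by
  obtain ⟨M, hM⟩ := exists_abs_le_Icc hδ
  exact MemLp.of_bound (measurable_kerOf c hδ y v).aestronglyMeasurable (4 * M * ‖v‖)
    (Eventually.of_forall fun x => norm_kerOf_le c hδ h0 hM y v x)

theorem integrable_inner_memLp {u : S2 → E3} (hu : MemLp u 2 surf) (g : C(S2, E3)) :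
    Integrable (fun x => ⟪u x, g x⟫) surf := by
  refine (integrable_inner_continuous_Lp g (hu.toLp u)).congr ?_
  filter_upwards [hu.coeFn_toLp] with x hx
  rw [hx, real_inner_comm]

/-- Both sides depend linearly on `δ` and continuously in the uniform norm on `[-1, 1]`, so the
polynomial case suffices. -/
theorem integral_kerOf (c c' : Bool) {δ : ℝ → ℝ} (hδ : Continuous δ) (h0 : primit δ 1 = 0) {n : ℕ}
    {q : Poly} (hq : q ∈ harmonicPoly n) (y : S2) (v : E3) :
    ∫ x, ⟪kerOf c δ y v x, vecC c' q x⟫ ∂surf =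
      if c = c' then -(2 * Real.pi * ∫ t in (-1 : ℝ)..1, δ t * (legendre n).eval t) *
        ⟪v, vecC c q y⟫ else 0 := by
  obtain ⟨B, hB⟩ := exists_bound_of_continuous (vecC c' q).continuous
  obtain ⟨M, hM⟩ := exists_abs_le_Icc (legendre n).continuous
  rw [← sub_eq_zero]
  refine eq_zero_of_forall_abs_le (C := 4 * ‖v‖ * B * (4 * Real.pi) +
    2 * Real.pi * (M * 2) * |⟪v, vecC c q y⟫|) fun ε hε => ?_
  obtain ⟨p, hp, hpδ⟩ := exists_polynomial_near hδ h0 hε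
  have hpc : Continuous fun s => p.eval s := p.continuous
  have hp0 : primit (fun s => p.eval s) 1 = 0 := hp
  have hd0 : primit (fun s => δ s - p.eval s) 1 = 0 := by
    rw [primit_sub hδ hpc, h0, hp0, sub_zero]
  have hB0 : 0 ≤ B := (norm_nonneg _).trans (hB y)
  have h1 : |(∫ x, ⟪kerOf c δ y v x, vecC c' q x⟫ ∂surf) -
      ∫ x, ⟪kerOf c (fun s => p.eval s) y v x, vecC c' q x⟫ ∂surf| ≤
        4 * ε * ‖v‖ * B * (4 * Real.pi) := by
    rw [← integral_sub (integrable_inner_memLp (memLp_kerOf c hδ h0 y v) _)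
      (integrable_inner_memLp (memLp_kerOf c hpc hp0 y v) _)]
    refine abs_integral_surf_le fun x => ?_
    rw [← inner_sub_left, ← kerOf_sub c hδ hpc]
    exact (abs_real_inner_le_norm _ _).trans (mul_le_mul
      (norm_kerOf_le c (hδ.sub hpc) hd0 hpδ y v x) (hB x) (norm_nonneg _) (by positivity))
  have h2 : |(∫ t in (-1 : ℝ)..1, δ t * (legendre n).eval t) - polyInt (p * legendre n)| ≤
      ε * M * |1 - (-1 : ℝ)| := by
    have hl : Continuous fun t => δ t * (legendre n).eval t := hδ.mul (legendre n).continuous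
    rw [polyInt_apply, ← intervalIntegral.integral_sub (hl.intervalIntegrable _ _)
      (polynomial_intervalIntegrable _ _ _)]
    refine intervalIntegral.norm_integral_le_of_norm_le_const (E := ℝ)
      (f := fun t => δ t * (legendre n).eval t - (p * legendre n).eval t) fun s hs => ?_
    rw [uIoc_of_le (by norm_num : (-1 : ℝ) ≤ 1)] at hs
    have hs' : s ∈ Icc (-1 : ℝ) 1 := ⟨hs.1.le, hs.2⟩
    rw [Polynomial.eval_mul, ← sub_mul, norm_mul]
    exact mul_le_mul (hpδ s hs') (hM s hs') (norm_nonneg _) hε.le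
  have h3 : |1 - (-1 : ℝ)| = 2 := by norm_num
  rw [h3] at h2
  rw [integral_kerOf_polynomial c c' hp hq] at h1
  set I := ∫ x, ⟪kerOf c δ y v x, vecC c' q x⟫ ∂surf
  set J := ∫ t in (-1 : ℝ)..1, δ t * (legendre n).eval t
  have hM0 : 0 ≤ M := (abs_nonneg _).trans (hM 0 (by norm_num))
  have hpi := Real.pi_pos
  split_ifs with hc
  · rw [if_pos hc] at h1
    have h4 : I - -(2 * Real.pi * J) * ⟪v, vecC c q y⟫ =
        (I - -(2 * Real.pi * polyInt (p * legendre n)) * ⟪v, vecC c q y⟫) +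
          2 * Real.pi * (J - polyInt (p * legendre n)) * ⟪v, vecC c q y⟫ := by ring
    rw [h4]
    refine (abs_add_le _ _).trans ?_
    rw [abs_mul, abs_mul, abs_of_pos (by positivity : 0 < 2 * Real.pi)]
    have h5 : 2 * Real.pi * |J - polyInt (p * legendre n)| * |⟪v, vecC c q y⟫| ≤
        2 * Real.pi * (ε * M * 2) * |⟪v, vecC c q y⟫| := by gcongr
    linarith
  · rw [if_neg hc] at h1
    refine h1.trans ?_
    have h5 : 0 ≤ 2 * Real.pi * (M * 2) * |⟪v, vecC c q y⟫| * ε := by positivity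
    linarith

/-! ### The scaled zonal kernels -/

/-- The pole `(1, 0, 0)`. -/
def northPole : S2 := ⟨!₂[1, 0, 0], by
  rw [mem_sphere_zero_iff_norm, EuclideanSpace.norm_eq]; simp [Fin.sum_univ_three]⟩

/-- The kernel is prescribed only at inner products of unit vectors; every `t` in `[-1, 1]` is one,
at distance `√(2 - 2t)`, so `ψ_ρ` is an explicit function there. -/
theorem exists_inner_northPole {t : ℝ} (ht : t ∈ Icc (-1 : ℝ) 1) :
    ∃ y : S2, ⟪(northPole : E3), (y : E3)⟫ = t ∧ ‖(northPole : E3) - y‖ = √(2 - 2 * t) := by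
  have h : 0 ≤ 1 - t ^ 2 := by nlinarith [ht.1, ht.2]
  have hy : (!₂[t, √(1 - t ^ 2), 0] : E3) ∈ Metric.sphere (0 : E3) 1 := by
    rw [mem_sphere_zero_iff_norm, EuclideanSpace.norm_eq]
    simp [Fin.sum_univ_three, Real.sq_sqrt h]
  have h1 : ⟪(northPole : E3), (!₂[t, √(1 - t ^ 2), 0] : E3)⟫ = t := by
    rw [inner_eq_sum]; simp [northPole]
  refine ⟨⟨_, hy⟩, h1, ?_⟩
  rw [← Real.sqrt_sq (norm_nonneg _), norm_sub_sq_real, h1, norm_eq_of_mem_sphere northPole,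
    mem_sphere_zero_iff_norm.mp hy]
  congr 1
  ring

/-- A scaled zonal kernel is `1/(4π)` minus a continuous mean-free function. -/
theorem exists_continuous_of_isScaledZonalKernel {ψ : ℝ → ℝ → ℝ} (hψ : IsScaledZonalKernel ψ)
    {ρ : ℝ} (hρ : ρ ∈ Ioo (0 : ℝ) 1) :
    ∃ δ : ℝ → ℝ, Continuous δ ∧ primit δ 1 = 0 ∧
      ∀ t ∈ Icc (-1 : ℝ) 1, δ t = 1 / (4 * Real.pi) - ψ ρ t := by
  obtain ⟨φ, c, hφ, h⟩ := hψ
  obtain ⟨h1, h2⟩ := h ρ hρ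
  have hρ0 : 0 < ρ⁻¹ := inv_pos.mpr hρ.1
  have hψt : ∀ t ∈ Icc (-1 : ℝ) 1, ψ ρ t = c ρ * φ (ρ⁻¹ * √(2 - 2 * t)) := by
    intro t ht
    obtain ⟨y, hy, hy'⟩ := exists_inner_northPole ht
    rw [← hy', ← h1, hy]
  set δ : ℝ → ℝ := fun t => 1 / (4 * Real.pi) - c ρ * φ (ρ⁻¹ * √(2 - 2 * t))
  have hc : Continuous fun t : ℝ => φ (ρ⁻¹ * √(2 - 2 * t)) :=
    hφ.comp_continuous (by fun_prop) fun t => mul_nonneg hρ0.le (Real.sqrt_nonneg _)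
  have hδ : Continuous δ := continuous_const.sub (continuous_const.mul hc)
  refine ⟨δ, hδ, ?_, fun t ht => by rw [hψt t ht]⟩
  have h3 := integral_zonal hδ northPole
  have h4 : ∫ x : S2, δ ⟪(x : E3), northPole⟫ ∂surf = 0 := by
    have h5 : ∀ x : S2, δ ⟪(x : E3), northPole⟫ =
        1 / (4 * Real.pi) - ψ ρ ⟪(northPole : E3), (x : E3)⟫ := by
      intro x
      rw [hψt _ (inner_mem_Icc northPole x), real_inner_comm]
    simp only [h5]
    rw [integral_sub (integrable_const _), h2, integral_const, surf_real_univ, smul_eq_mul]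
    · field_simp
      simp
    -- A non-integrable kernel would have integral `0` by convention, contradicting the
    -- normalization.
    · by_contra h6
      have := h2 northPole
      rw [integral_undef h6] at this
      exact zero_ne_one this
  rw [h4] at h3
  have := Real.pi_pos
  rcases mul_eq_zero.mp h3.symm with h | h
  · linarith
  · exact h

/-- The constant `1/(4π)` is orthogonal to `P_n` for `n > 0`. The minus sign matches the one in
`integral_kerOf`. -/
theorem legendreCoeff_eq {ψ : ℝ → ℝ} {δ : ℝ → ℝ} (hδ : Continuous δ)
    (h : ∀ t ∈ Icc (-1 : ℝ) 1, δ t = 1 / (4 * Real.pi) - ψ t) {n : ℕ} (hn : 0 < n) :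
    legendreCoeff ψ n = -(2 * Real.pi * ∫ t in (-1 : ℝ)..1, δ t * (legendre n).eval t) := by
  have h1 : ∫ t in (-1 : ℝ)..1, ψ t * (legendre n).eval t =
      ∫ t in (-1 : ℝ)..1, (1 / (4 * Real.pi) * (legendre n).eval t -
        δ t * (legendre n).eval t) := by
    refine intervalIntegral.integral_congr fun t ht => ?_
    rw [uIcc_of_le (by norm_num)] at ht
    simp only [h t ht]
    ring
  have h2 : ∫ t in (-1 : ℝ)..1, (legendre n).eval t = 0 := by
    have := functional_eq_zero_of_degree_lt (legendreInt_legendreOp n) (p := 1)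
      (by rw [Polynomial.degree_one]; exact_mod_cast hn)
    rwa [legendreInt_apply, one_mul, polyInt_apply] at this
  have hl : Continuous fun t => (legendre n).eval t := (legendre n).continuous
  have hl1 : Continuous fun t => 1 / (4 * Real.pi) * (legendre n).eval t :=
    continuous_const.mul hl
  have hl2 : Continuous fun t => δ t * (legendre n).eval t := hδ.mul hl
  rw [legendreCoeff, h1, intervalIntegral.integral_sub
    (hl1.intervalIntegrable _ _) (hl2.intervalIntegrable _ _),
    intervalIntegral.integral_const_mul, h2]
  ring

theorem kappa_eq_kap {ψ : ℝ → ℝ} {δ : ℝ → ℝ} (hδ : Continuous δ)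
    (h : ∀ t ∈ Icc (-1 : ℝ) 1, δ t = 1 / (4 * Real.pi) - ψ t) {t : ℝ}
    (ht : t ∈ Ioo (-1 : ℝ) 1) : kappa ψ t = kap δ t := by
  have h1 : ∀ t ∈ Ioo (-1 : ℝ) 1,
      (∫ s in (-1 : ℝ)..t, (1 - 4 * Real.pi * ψ s)) / (4 * Real.pi * (1 - t ^ 2)) = kap δ t := by
    intro t ht
    have h2 : ∫ s in (-1 : ℝ)..t, (1 - 4 * Real.pi * ψ s) = 4 * Real.pi * primit δ t := by
      rw [primit, ← intervalIntegral.integral_const_mul]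
      refine intervalIntegral.integral_congr fun s hs => ?_
      rw [uIcc_of_le ht.1.le] at hs
      have := Real.pi_pos
      simp only [h s ⟨hs.1, hs.2.trans ht.2.le⟩]
      field_simp
    rw [h2, kap, mul_div_mul_left _ _ (by positivity)]
  refine extendFrom_eq (closure_mono (singleton_subset_iff.mpr ht) (subset_closure rfl)) ?_
  refine ((hasDerivAt_kap hδ ht).continuousAt.tendsto.mono_left nhdsWithin_le_nhds).congr' ?_
  exact eventually_mem_nhdsWithin.mono fun s hs => (h1 s hs).symm

theorem deriv_kappa_eq_kapDeriv {ψ : ℝ → ℝ} {δ : ℝ → ℝ} (hδ : Continuous δ)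
    (h : ∀ t ∈ Icc (-1 : ℝ) 1, δ t = 1 / (4 * Real.pi) - ψ t) {t : ℝ}
    (ht : t ∈ Ioo (-1 : ℝ) 1) : deriv (kappa ψ) t = kapDeriv δ t :=
  ((hasDerivAt_kap hδ ht).congr_of_eventuallyEq
    ((isOpen_Ioo.eventually_mem ht).mono fun _ hs => kappa_eq_kap hδ h hs)).deriv

/-- The two matrix kernels. -/
def matKernel (c : Bool) (ψ : ℝ → ℝ) (x y : S2) : Matrix (Fin 3) (Fin 3) ℝ :=
  bif c then kernelDiv ψ x y else kernelCurl ψ x y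

/-- The vector identities are `Q v = (x · (v × y)) (x × y)` and `R v = x × (v × y)` for the first
kernel, and `(x - t y) · v = x · (v - (y·v) y)` for the second. -/
theorem matKernel_mulVec (c : Bool) (ψ : ℝ → ℝ) (x y : S2) (v : E3) :
    WithLp.toLp 2 (matKernel c ψ x y *ᵥ v.ofLp) =
      kerField c (deriv (kappa ψ) ⟪(x : E3), y⟫) (kappa ψ ⟪(x : E3), y⟫) x y v := by
  change WithLp.toLp 2 (matKernel c ψ x y *ᵥ v.ofLp) =
      kerField c (deriv (kappa ψ) (dotS x y)) (kappa ψ (dotS x y)) x y v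
  rw [kerField_eq]
  set a := deriv (kappa ψ) (dotS x y) with ha
  set b := kappa ψ (dotS x y) with hb
  have ht : dotS x y = x.1 0 * y.1 0 + x.1 1 * y.1 1 + x.1 2 * y.1 2 := inner_eq_sum _ _
  cases c
  · simp only [matKernel, cond_false, kernelCurl, ← ha, ← hb, matV, matW]
    ext j
    fin_cases j <;>
    simp [tanOp, tanVec, ht, Matrix.mulVec, dotProduct, Fin.sum_univ_three, Matrix.mul_apply,
      Matrix.vecMulVec_apply, inner_eq_sum, Matrix.one_apply] <;> ring
  · simp only [matKernel, cond_true, kernelDiv, ← ha, ← hb, matQ, matR]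
    ext j
    fin_cases j <;>
    simp [tanOp, tanVec, ht, Matrix.mulVec, dotProduct, Fin.sum_univ_three, cross_apply,
      Matrix.vecMulVec_apply, inner_eq_sum, Matrix.one_apply, crossE_zero, crossE_one,
      crossE_two] <;> ring

/-! ### The components of the quasi-interpolant -/

/-- The two components of the quasi-interpolant. -/
def quasi (c : Bool) (ψ : ℝ → ℝ) {N : ℕ} (X : Fin N → S2) (f : S2 → E3) (x : S2) : E3 :=
  bif c then quasiDiv ψ X f x else quasiCurl ψ X f x

theorem quasi_eq (c : Bool) (ψ : ℝ → ℝ) {N : ℕ} (X : Fin N → S2) (f : S2 → E3) (x : S2) :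
    quasi c ψ X f x = (4 * Real.pi / N) • ∑ j, kerField c (deriv (kappa ψ) ⟪(x : E3), X j⟫)
      (kappa ψ ⟪(x : E3), X j⟫) x (X j) (f (X j)) := by
  simp only [← matKernel_mulVec]
  cases c <;> rfl

theorem inner_self_quasi (c : Bool) (ψ : ℝ → ℝ) {N : ℕ} (X : Fin N → S2) (f : S2 → E3) (x : S2) :
    ⟪(x : E3), quasi c ψ X f x⟫ = 0 := by
  rw [quasi_eq, real_inner_smul_right, inner_sum, Finset.sum_eq_zero, mul_zero]
  exact fun j _ => inner_self_tanOp c x _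

theorem quasi_ae_eq (c : Bool) {ψ δ : ℝ → ℝ} (hδ : Continuous δ)
    (h : ∀ t ∈ Icc (-1 : ℝ) 1, δ t = 1 / (4 * Real.pi) - ψ t) {N : ℕ} (X : Fin N → S2)
    (f : S2 → E3) : quasi c ψ X f =ᵐ[surf]
      (4 * Real.pi / N : ℝ) • ∑ j, kerOf c δ (X j) (f (X j)) := by
  filter_upwards [ae_all_iff.mpr fun j => surf_poles_null (X j)] with x hx
  rw [quasi_eq, Pi.smul_apply, Finset.sum_apply]
  congr 1
  refine Finset.sum_congr rfl fun j _ => ?_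
  rw [kerOf, kappa_eq_kap hδ h (hx j), deriv_kappa_eq_kapDeriv hδ h (hx j)]

theorem memLp_quasi (c : Bool) {ψ : ℝ → ℝ → ℝ} (hψ : IsScaledZonalKernel ψ) {ρ : ℝ}
    (hρ : ρ ∈ Ioo (0 : ℝ) 1) {N : ℕ} (X : Fin N → S2) (f : S2 → E3) :
    MemLp (quasi c (ψ ρ) X f) 2 surf := by
  obtain ⟨δ, hδ, h0, h⟩ := exists_continuous_of_isScaledZonalKernel hψ hρ
  exact (memLp_congr_ae (quasi_ae_eq c hδ h X f)).mpr
    ((memLp_finsetSum' _ fun j _ => memLp_kerOf c hδ h0 _ _).const_smul _)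

/-- The quasi-interpolant is a discretized convolution: its coefficient is `ψ̂(n)` times the
quadrature of the product of `f` with the harmonic, for harmonics of its own type only. -/
theorem integral_quasi (c c' : Bool) {ψ : ℝ → ℝ → ℝ} (hψ : IsScaledZonalKernel ψ) {ρ : ℝ}
    (hρ : ρ ∈ Ioo (0 : ℝ) 1) {N : ℕ} (X : Fin N → S2) (f : S2 → E3) {n : ℕ} (hn : 0 < n)
    {q : Poly} (hq : q ∈ harmonicPoly n) :
    ∫ x, ⟪quasi c (ψ ρ) X f x, vecC c' q x⟫ ∂surf =
      if c = c' then legendreCoeff (ψ ρ) n * quadrature X (fun y => ⟪f y, vecC c q y⟫) else 0 := by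
  obtain ⟨δ, hδ, h0, h⟩ := exists_continuous_of_isScaledZonalKernel hψ hρ
  have h1 : ∫ x, ⟪quasi c (ψ ρ) X f x, vecC c' q x⟫ ∂surf =
      ∫ x, 4 * Real.pi / N * ∑ j, ⟪kerOf c δ (X j) (f (X j)) x, vecC c' q x⟫ ∂surf := by
    refine integral_congr_ae ?_
    filter_upwards [quasi_ae_eq c hδ h X f] with x hx
    rw [hx, Pi.smul_apply, Finset.sum_apply, real_inner_smul_left, sum_inner]
  rw [h1, integral_const_mul, integral_finsetSum _ fun j _ =>
    integrable_inner_memLp (memLp_kerOf c hδ h0 _ _) _]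
  simp only [integral_kerOf c c' hδ h0 hq, ← legendreCoeff_eq hδ h hn]
  split_ifs
  · rw [← Finset.mul_sum, quadrature]
    ring
  · simp

/-! ### The components of the Helmholtz–Hodge decomposition -/

/-- The two components of the Helmholtz–Hodge decomposition. -/
def hodgePart (c : Bool) (f : C(S2, E3)) : Lp E3 2 surf := bif c then divPart f else curlPart f

theorem hodgePart_mem_tangentL2 (c : Bool) (f : C(S2, E3)) : hodgePart c f ∈ tangentL2 := by
  cases c
  · exact (Submodule.starProjection_apply_mem curlFreeL2 _).1
  · exact (Submodule.starProjection_apply_mem divFreeL2 _).1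

theorem vecL2_true_mem_divFreeL2 (q : Poly) : vecL2 true q ∈ divFreeL2 := by
  refine ⟨vecL2_mem_tangentL2 true q, fun φ hφ => ?_⟩
  have h := inner_toLp_toLp ⟨_, continuous_surfGrad hφ⟩ (vecC true q)
  rw [inner_toLp_eq] at h
  exact h.trans (integral_surfGrad_surfCurl hφ q)

theorem vecL2_false_mem_curlFreeL2 (q : Poly) : vecL2 false q ∈ curlFreeL2 := by
  refine ⟨vecL2_mem_tangentL2 false q, fun φ hφ => ?_⟩
  have h := inner_toLp_toLp ⟨_, continuous_surfCurl hφ⟩ (vecC false q)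
  rw [inner_toLp_eq] at h
  exact h.trans (integral_surfCurl_surfGrad hφ q)

/-- A harmonic of the same type lies in the range of the self-adjoint projection; for the other
type, its potential is a test function in the defining relations of that range. -/
theorem integral_hodgePart (c c' : Bool) (f : C(S2, E3)) (q : Poly) :
    ∫ x, ⟪hodgePart c f x, vecC c' q x⟫ ∂surf =
      if c = c' then ∫ x, ⟪f x, vecC c q x⟫ ∂surf else 0 := by
  have h1 : ∫ x, ⟪hodgePart c f x, vecC c' q x⟫ ∂surf = ⟪vecL2 c' q, hodgePart c f⟫ := by
    rw [inner_vecL2]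
    exact integral_congr_ae (Eventually.of_forall fun x => real_inner_comm _ _)
  have h2 : ∫ x, ⟪f x, vecC c q x⟫ ∂surf =
      ⟪vecL2 c q, ContinuousMap.toLp (E := E3) 2 surf ℝ f⟫ := by
    rw [real_inner_comm]
    exact (inner_toLp_toLp f (vecC c q)).symm
  rw [h1, h2]
  cases c <;> cases c'
  · rw [if_pos rfl]
    change ⟪_, curlFreeL2.starProjection _⟫ = _
    rw [← Submodule.inner_starProjection_left_eq_right,
      Submodule.starProjection_eq_self_iff.mpr (vecL2_false_mem_curlFreeL2 q)]
  · rw [if_neg (by decide), inner_vecL2]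
    exact (Submodule.starProjection_apply_mem curlFreeL2 _).2 _ (contDiff_polyFun q)
  · rw [if_neg (by decide), inner_vecL2]
    exact (Submodule.starProjection_apply_mem divFreeL2 _).2 _ (contDiff_polyFun q)
  · rw [if_pos rfl]
    change ⟪_, divFreeL2.starProjection _⟫ = _
    rw [← Submodule.inner_starProjection_left_eq_right,
      Submodule.starProjection_eq_self_iff.mpr (vecL2_true_mem_divFreeL2 q)]

/-! ### Sobolev terms -/

/-- The potential of a normalized vector harmonic. -/
def unitY (ℓ : ℕ) (k : Order ℓ) : Poly := (√(eigen ℓ))⁻¹ • Ypoly ℓ k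

theorem unitY_mem (ℓ : ℕ) (k : Order ℓ) : unitY ℓ k ∈ harmonicPoly ℓ :=
  Submodule.smul_mem _ _ (Ypoly_mem ℓ k)

theorem ydiv_eq (ℓ : ℕ) (k : Order ℓ) (x : S2) : ydiv ℓ k x = vecC true (unitY ℓ k) x := by
  rw [unitY, map_smul]; rfl

theorem zcurl_eq (ℓ : ℕ) (k : Order ℓ) (x : S2) : zcurl ℓ k x = vecC false (unitY ℓ k) x := by
  rw [unitY, map_smul]; rfl

theorem vecSobolevTerm_eq (σ : ℝ) (u : S2 → E3) (ℓ : ℕ) : vecSobolevTerm σ u ℓ =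
    ∑ k, (1 + eigen ℓ) ^ σ * ∑ b, (∫ x, ⟪u x, vecC b (unitY ℓ k) x⟫ ∂surf) ^ 2 := by
  simp only [vecSobolevTerm, ydiv_eq, zcurl_eq, Fintype.sum_bool]

theorem inner_vecHarm_tang {f : C(S2, E3)} (hf : ∀ x : S2, ⟪(x : E3), f x⟫ = 0) (ℓ : ℕ) (b : Bool)
    (k : Order (ℓ + 1)) :
    ⟪vecHarm ⟨ℓ, b, k⟩, tang f hf⟫ = ∫ x, ⟪f x, vecC b (unitY (ℓ + 1) k) x⟫ ∂surf := by
  rw [← inner_toLp_toLp, real_inner_comm, unitY, map_smul, map_smul]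
  rfl

theorem vecSobolevTerm_eq_sobTerm (σ : ℝ) {f : C(S2, E3)} (hf : ∀ x : S2, ⟪(x : E3), f x⟫ = 0)
    (ℓ : ℕ) : vecSobolevTerm σ f (ℓ + 1) = sobTerm σ (tang f hf) ℓ := by
  rw [vecSobolevTerm_eq, sobTerm, levelSq, Fintype.sum_prod_type_right, ← Finset.mul_sum]
  simp only [inner_vecHarm_tang]

/-- The Sobolev terms of the error of one component of the quasi-interpolant. -/
theorem vecSobolevTerm_error (τ : ℝ) (c : Bool) {ψ : ℝ → ℝ → ℝ} (hψ : IsScaledZonalKernel ψ)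
    {ρ : ℝ} (hρ : ρ ∈ Ioo (0 : ℝ) 1) {N : ℕ} (X : Fin N → S2) (f : C(S2, E3)) {ℓ : ℕ}
    (hℓ : 0 < ℓ) :
    vecSobolevTerm τ (fun x => hodgePart c f x - quasi c (ψ ρ) X f x) ℓ =
      ∑ k, (1 + eigen ℓ) ^ τ * ((∫ x, ⟪f x, vecC c (unitY ℓ k) x⟫ ∂surf) -
        legendreCoeff (ψ ρ) ℓ * quadrature X fun y => ⟪f y, vecC c (unitY ℓ k) y⟫) ^ 2 := by
  have h : ∀ k b, ∫ x, ⟪hodgePart c f x - quasi c (ψ ρ) X f x, vecC b (unitY ℓ k) x⟫ ∂surf =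
      if c = b then (∫ x, ⟪f x, vecC c (unitY ℓ k) x⟫ ∂surf) -
        legendreCoeff (ψ ρ) ℓ * quadrature X fun y => ⟪f y, vecC c (unitY ℓ k) y⟫ else 0 := by
    intro k b
    simp only [inner_sub_left]
    rw [integral_sub (integrable_inner_memLp (Lp.memLp _) _)
      (integrable_inner_memLp (memLp_quasi c hψ hρ X f) _), integral_hodgePart,
      integral_quasi c b hψ hρ X f hℓ (unitY_mem ℓ k)]
    split_ifs <;> simp
  rw [vecSobolevTerm_eq]
  simp only [h]
  cases c <;> simp

/-! ### The quadrature error -/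

/-- The error of the quadrature rule applied to `x ↦ f(x) · g(x)`, as a functional of `g`. -/
def quadErr {N : ℕ} (X : Fin N → S2) (f : C(S2, E3)) : C(S2, E3) →ₗ[ℝ] ℝ where
  toFun g := (∫ x, innerC f g x ∂surf) - quadrature X (innerC f g)
  map_add' g h := by
    have h1 : ∀ x, innerC f (g + h) x = innerC f g x + innerC f h x := fun x =>
      inner_add_right (f x) (g x) (h x)
    simp only [quadrature, h1, Finset.sum_add_distrib]
    rw [integral_add (integrable_of_continuous (innerC f g).continuous)
      (integrable_of_continuous (innerC f h).continuous)]
    ring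
  map_smul' r g := by
    have h1 : ∀ x, innerC f (r • g) x = r * innerC f g x := fun x =>
      real_inner_smul_right (f x) (g x) r
    simp only [quadrature, h1, integral_const_mul, ← Finset.mul_sum, RingHom.id_apply, smul_eq_mul]
    ring

theorem quadErr_apply {N : ℕ} (X : Fin N → S2) (f g : C(S2, E3)) :
    quadErr X f g = (∫ x, ⟪f x, g x⟫ ∂surf) - quadrature X fun y => ⟪f y, g y⟫ := rfl

theorem harmPart_eq (u : tangentL2) (ℓ : ℕ) (b : Bool) :
    harmPart u ℓ b = ∑ k, ⟪vecHarm ⟨ℓ, b, k⟩, u⟫ • unitY (ℓ + 1) k := by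
  simp only [harmPart, unitY, smul_smul, mul_comm]

theorem map_partialSum (Λ : C(S2, E3) →ₗ[ℝ] ℝ) (u : tangentL2) (M : ℕ) :
    Λ (partialSum u M) = ∑ ℓ ∈ Finset.range M, ∑ j : Bool × Order (ℓ + 1),
      ⟪vecHarm ⟨ℓ, j⟩, u⟫ * Λ (vecC j.1 (unitY (ℓ + 1) j.2)) := by
  simp only [partialSum, harmPart_eq, map_sum, map_smul, smul_eq_mul, Fintype.sum_prod_type]

theorem exists_inner_vecHarm_eq (M : ℕ) (α : VecIndex → ℝ) :
    ∃ u : tangentL2, ∀ ℓ < M, ∀ j, ⟪vecHarm ⟨ℓ, j⟩, u⟫ = α ⟨ℓ, j⟩ := by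
  refine ⟨∑ i ∈ (Finset.range M).sigma fun _ => Finset.univ, α i • vecHarm i, fun ℓ hℓ j => ?_⟩
  exact orthonormal_vecHarm.inner_right_sum α (by simpa using hℓ)

theorem partialSum_congr {u v : tangentL2} {M : ℕ}
    (h : ∀ ℓ < M, ∀ j, ⟪vecHarm ⟨ℓ, j⟩, u⟫ = ⟪vecHarm ⟨ℓ, j⟩, v⟫) :
    partialSum u M = partialSum v M := by
  refine Finset.sum_congr rfl fun ℓ hℓ => Finset.sum_congr rfl fun b _ => ?_
  rw [harmPart, harmPart]
  simp only [h ℓ (Finset.mem_range.mp hℓ)]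

theorem sobTerm_partialSumL2 (σ : ℝ) (u : tangentL2) (M ℓ : ℕ) :
    sobTerm σ (partialSumL2 u M) ℓ = if ℓ < M then sobTerm σ u ℓ else 0 := by
  simp only [sobTerm, levelSq, inner_vecHarm_partialSumL2]
  split_ifs <;> simp

theorem hasSum_sobTerm_partialSumL2 (σ : ℝ) (u : tangentL2) (M : ℕ) :
    HasSum (sobTerm σ (partialSumL2 u M)) (∑ ℓ ∈ Finset.range M, sobTerm σ u ℓ) := by
  have h : HasSum (sobTerm σ (partialSumL2 u M))
      (∑ ℓ ∈ Finset.range M, sobTerm σ (partialSumL2 u M) ℓ) :=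
    hasSum_sum_of_ne_finset_zero fun ℓ hℓ => by
      rw [sobTerm_partialSumL2, if_neg (by simpa using hℓ)]
  rwa [Finset.sum_congr rfl fun ℓ hℓ => by
    rw [sobTerm_partialSumL2, if_pos (Finset.mem_range.mp hℓ)]] at h

/-- Duality: a worst case error bound for products controls a weighted sum of the quadrature
errors of the products with vector harmonics. -/
theorem sum_quadErr_sq_le {σ τ : ℝ} (hσ : 1 < σ) {N : ℕ} {X : Fin N → S2} {D : ℝ}
    (hX : ∀ g : C(S2, ℝ), MemScalarSobolev σ g →
      |(∫ x, g x ∂surf) - quadrature X g| ≤ D * scalarSobolevNorm σ g)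
    {f : C(S2, E3)} (hf : ∀ x : S2, ⟪(x : E3), f x⟫ = 0) (hfs : Summable (sobTerm σ (tang f hf)))
    {b : ℕ → ℝ} {B : ℝ} (hB : ∀ ℓ, (1 + eigen (ℓ + 1)) ^ (τ + σ) * b ℓ ^ 2 ≤ B) (M : ℕ) :
    ∑ ℓ ∈ Finset.range M, (1 + eigen (ℓ + 1)) ^ τ * b ℓ ^ 2 * ∑ j : Bool × Order (ℓ + 1),
      quadErr X f (vecC j.1 (unitY (ℓ + 1) j.2)) ^ 2 ≤
        D ^ 2 * prodConst σ * B * sobSq σ (tang f hf) := by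
  set w : ℕ → ℝ := fun ℓ => (1 + eigen (ℓ + 1)) ^ τ * b ℓ ^ 2 with hw
  set r : VecIndex → ℝ := fun i => quadErr X f (vecC i.2.1 (unitY (i.1 + 1) i.2.2)) with hr
  set T := ∑ ℓ ∈ Finset.range M, w ℓ * ∑ j : Bool × Order (ℓ + 1), r ⟨ℓ, j⟩ ^ 2 with hT
  set S := sobSq σ (tang f hf) with hS
  change T ≤ _
  have hw0 : ∀ ℓ, 0 ≤ w ℓ := fun ℓ =>
    mul_nonneg (Real.rpow_nonneg (one_add_eigen_pos _).le _) (sq_nonneg _)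
  have hT0 : 0 ≤ T := Finset.sum_nonneg fun ℓ _ =>
    mul_nonneg (hw0 ℓ) (Finset.sum_nonneg fun _ _ => sq_nonneg _)
  -- The dual test field: with coefficients `w r` its quadrature error against `f` equals `T`, while
  -- its squared Sobolev norm is at most `B T`.
  obtain ⟨u, hu⟩ := exists_inner_vecHarm_eq M fun i => w i.1 * r i
  set G := partialSum u M with hG
  have h1 : quadErr X f G = T := by
    rw [hG, map_partialSum, hT]
    refine Finset.sum_congr rfl fun ℓ hℓ => ?_
    rw [Finset.mul_sum]
    refine Finset.sum_congr rfl fun j _ => ?_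
    rw [hu ℓ (Finset.mem_range.mp hℓ)]
    simp only [hr]
    ring
  have hGt := inner_self_partialSum u M
  have h2 := hasSum_sobTerm_partialSumL2 σ u M
  have h3 : sobSq σ (tang G hGt) ≤ B * T := by
    change ∑' ℓ, sobTerm σ (partialSumL2 u M) ℓ ≤ _
    rw [h2.tsum_eq, hT, Finset.mul_sum]
    refine Finset.sum_le_sum fun ℓ hℓ => ?_
    have h4 : levelSq u ℓ = w ℓ ^ 2 * ∑ j : Bool × Order (ℓ + 1), r ⟨ℓ, j⟩ ^ 2 := by
      rw [levelSq, Finset.mul_sum]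
      refine Finset.sum_congr rfl fun j _ => ?_
      rw [hu ℓ (Finset.mem_range.mp hℓ), mul_pow]
    have h5 : (1 + eigen (ℓ + 1)) ^ σ * w ℓ ^ 2 =
        ((1 + eigen (ℓ + 1)) ^ (τ + σ) * b ℓ ^ 2) * w ℓ := by
      rw [Real.rpow_add (one_add_eigen_pos _)]
      simp only [hw]
      ring
    rw [sobTerm, h4, ← mul_assoc, h5, ← mul_assoc B]
    exact mul_le_mul_of_nonneg_right (mul_le_mul_of_nonneg_right (hB ℓ) (hw0 ℓ))
      (Finset.sum_nonneg fun _ _ => sq_nonneg _)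
  have h4 : ∀ x, ‖G x‖ ^ 2 ≤ 4 * sobConst σ * sobSq σ (tang G hGt) := by
    intro x
    -- `G` is its own partial sum, so the uniform bound for partial sums applies to it.
    have h5 : G = partialSum (partialSumL2 u M) M := partialSum_congr fun ℓ hℓ j => by
      rw [inner_vecHarm_partialSumL2, if_pos hℓ]
    have h6 := norm_partialSum_sq_le hσ h2.summable M x
    rw [← h5] at h6
    exact h6
  obtain ⟨h5, h6⟩ := memScalarSobolev_innerC hσ hf hGt hfs h2.summable h4
  have h7 := hX _ h5
  change |quadErr X f G| ≤ _ at h7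
  rw [h1, abs_of_nonneg hT0] at h7
  have h8 : T ^ 2 ≤ D ^ 2 * (prodConst σ * (S * (B * T))) := by
    calc T ^ 2 ≤ (D * scalarSobolevNorm σ (innerC f G)) ^ 2 := by gcongr
      _ = D ^ 2 * scalarSobolevNorm σ (innerC f G) ^ 2 := by ring
      _ ≤ D ^ 2 * (prodConst σ * (S * sobSq σ (tang G hGt))) := by gcongr
      _ ≤ _ := by
        have := prodConst_nonneg σ
        have : 0 ≤ S := sobSq_nonneg _ _
        gcongr
  rcases hT0.eq_or_lt with h | h
  · rw [← h]
    have hB0 : 0 ≤ B := (mul_nonneg (Real.rpow_nonneg (one_add_eigen_pos _).le _)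
      (sq_nonneg _)).trans (hB 0)
    exact mul_nonneg (mul_nonneg (mul_nonneg (sq_nonneg _) (prodConst_nonneg σ)) hB0)
      (sobSq_nonneg _ _)
  · refine le_of_mul_le_mul_right ?_ h
    calc T * T = T ^ 2 := (sq T).symm
      _ ≤ _ := h8
      _ = _ := by ring

/-- The error coefficient is `(1 - b) a + b r`, with `a` the coefficient of `f` and `r` the
quadrature error. The `a`-part is controlled degree by degree through `A`, the `r`-part through
duality. -/
theorem sum_vecSobolevTerm_error_le {σ τ : ℝ} (hσ : 1 < σ) (c : Bool) {ψ : ℝ → ℝ → ℝ}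
    (hψ : IsScaledZonalKernel ψ) {ρ : ℝ} (hρ : ρ ∈ Ioo (0 : ℝ) 1) {N : ℕ} {X : Fin N → S2} {D : ℝ}
    (hX : ∀ g : C(S2, ℝ), MemScalarSobolev σ g →
      |(∫ x, g x ∂surf) - quadrature X g| ≤ D * scalarSobolevNorm σ g)
    {f : C(S2, E3)} (hf : ∀ x : S2, ⟪(x : E3), f x⟫ = 0) (hfs : Summable (sobTerm σ (tang f hf)))
    {A B : ℝ}
    (hA : ∀ ℓ, (1 + eigen (ℓ + 1)) ^ τ * (1 - legendreCoeff (ψ ρ) (ℓ + 1)) ^ 2 ≤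
      A * (1 + eigen (ℓ + 1)) ^ σ)
    (hB : ∀ ℓ, (1 + eigen (ℓ + 1)) ^ (τ + σ) * legendreCoeff (ψ ρ) (ℓ + 1) ^ 2 ≤ B) (M : ℕ) :
    ∑ ℓ ∈ Finset.range M,
      vecSobolevTerm τ (fun x => hodgePart c f x - quasi c (ψ ρ) X f x) (ℓ + 1) ≤
        2 * (A + D ^ 2 * prodConst σ * B) * sobSq σ (tang f hf) := by
  have h1 : ∀ ℓ, vecSobolevTerm τ (fun x => hodgePart c f x - quasi c (ψ ρ) X f x) (ℓ + 1) ≤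
      2 * (A * sobTerm σ (tang f hf) ℓ) +
        2 * ((1 + eigen (ℓ + 1)) ^ τ * legendreCoeff (ψ ρ) (ℓ + 1) ^ 2 *
          ∑ j : Bool × Order (ℓ + 1), quadErr X f (vecC j.1 (unitY (ℓ + 1) j.2)) ^ 2) := by
    intro ℓ
    rw [vecSobolevTerm_error τ c hψ hρ X f ℓ.succ_pos]
    set b := legendreCoeff (ψ ρ) (ℓ + 1) with hb
    set μ := (1 + eigen (ℓ + 1)) ^ τ with hμ
    have hμ0 : 0 ≤ μ := Real.rpow_nonneg (one_add_eigen_pos _).le _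
    set a : Bool → Order (ℓ + 1) → ℝ := fun i k => ∫ x, ⟪f x, vecC i (unitY (ℓ + 1) k) x⟫ ∂surf
      with ha
    set r : Bool → Order (ℓ + 1) → ℝ := fun i k => quadErr X f (vecC i (unitY (ℓ + 1) k)) with hr
    have h2 : ∀ k, μ * (a c k - b * quadrature X fun y => ⟪f y, vecC c (unitY (ℓ + 1) k) y⟫) ^ 2 ≤
        2 * (μ * (1 - b) ^ 2) * a c k ^ 2 + 2 * (μ * b ^ 2) * r c k ^ 2 := by
      intro k
      have h3 : r c k = a c k - quadrature X fun y => ⟪f y, vecC c (unitY (ℓ + 1) k) y⟫ :=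
        quadErr_apply _ _ _
      have h4 : (a c k - b * quadrature X fun y => ⟪f y, vecC c (unitY (ℓ + 1) k) y⟫) =
          (1 - b) * a c k + b * r c k := by rw [h3]; ring
      rw [h4]
      calc μ * ((1 - b) * a c k + b * r c k) ^ 2
          ≤ μ * (2 * (((1 - b) * a c k) ^ 2 + (b * r c k) ^ 2)) :=
            mul_le_mul_of_nonneg_left (add_sq_le) hμ0
        _ = _ := by ring
    have h5 : ∀ s : Bool → Order (ℓ + 1) → ℝ, ∑ k, s c k ^ 2 ≤
        ∑ j : Bool × Order (ℓ + 1), s j.1 j.2 ^ 2 := by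
      intro s
      rw [Fintype.sum_prod_type]
      exact Finset.single_le_sum (f := fun i => ∑ k, s i k ^ 2)
        (fun i _ => Finset.sum_nonneg fun _ _ => sq_nonneg _) (Finset.mem_univ c)
    have h6 : sobTerm σ (tang f hf) ℓ =
        (1 + eigen (ℓ + 1)) ^ σ * ∑ j : Bool × Order (ℓ + 1), a j.1 j.2 ^ 2 := by
      rw [sobTerm, levelSq]
      congr 1
      exact Finset.sum_congr rfl fun j _ =>
        congrArg (· ^ 2) (inner_vecHarm_tang hf ℓ j.1 j.2)
    refine (Finset.sum_le_sum fun k _ => h2 k).trans ?_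
    rw [Finset.sum_add_distrib, ← Finset.mul_sum, ← Finset.mul_sum, h6]
    have h7 : μ * (1 - b) ^ 2 * ∑ k, a c k ^ 2 ≤
        A * (1 + eigen (ℓ + 1)) ^ σ * ∑ j : Bool × Order (ℓ + 1), a j.1 j.2 ^ 2 :=
      (mul_le_mul_of_nonneg_left (h5 a) (mul_nonneg hμ0 (sq_nonneg _))).trans
        (mul_le_mul_of_nonneg_right (hA ℓ) (Finset.sum_nonneg fun _ _ => sq_nonneg _))
    have h8 : μ * b ^ 2 * ∑ k, r c k ^ 2 ≤
        μ * b ^ 2 * ∑ j : Bool × Order (ℓ + 1), r j.1 j.2 ^ 2 :=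
      mul_le_mul_of_nonneg_left (h5 r) (mul_nonneg hμ0 (sq_nonneg _))
    linarith
  have hA0 : 0 ≤ A := by
    have h2 := (mul_nonneg (Real.rpow_nonneg (one_add_eigen_pos _).le _) (sq_nonneg _)).trans (hA 0)
    exact nonneg_of_mul_nonneg_left h2 (Real.rpow_pos_of_pos (one_add_eigen_pos _) _)
  refine (Finset.sum_le_sum fun ℓ _ => h1 ℓ).trans ?_
  rw [Finset.sum_add_distrib, ← Finset.mul_sum, ← Finset.mul_sum, ← Finset.mul_sum]
  have h2 := sum_quadErr_sq_le hσ hX hf hfs hB M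
  have h3 : A * ∑ ℓ ∈ Finset.range M, sobTerm σ (tang f hf) ℓ ≤ A * sobSq σ (tang f hf) :=
    mul_le_mul_of_nonneg_left (hfs.sum_le_tsum _ fun ℓ _ => sobTerm_nonneg _ _ _) hA0
  linarith

/-! ### Bounds for the Fourier–Legendre coefficients -/

theorem sq_le_one_add_eigen (n : ℕ) : (n : ℝ) ^ 2 ≤ 1 + eigen n := by
  rw [eigen]; nlinarith [n.cast_nonneg (α := ℝ)]

theorem one_add_eigen_le (n : ℕ) : 1 + eigen n ≤ ((n : ℝ) + 1) ^ 2 := by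
  rw [eigen]; nlinarith [n.cast_nonneg (α := ℝ)]

theorem abs_legendreCoeff_le {ψ : ℝ → ℝ → ℝ} {s c : ℝ} (hs : 0 ≤ s) (hc : 0 < c)
    (h : ∀ ρ ∈ Ioo (0 : ℝ) 1, ∀ ℓ : ℕ, 0 < ℓ →
      |legendreCoeff (ψ ρ) ℓ| ≤ c * (1 + ρ * ℓ) ^ (-s)) {ρ : ℝ} (hρ : ρ ∈ Ioo (0 : ℝ) 1) {ℓ : ℕ}
    (hℓ : 0 < ℓ) : |legendreCoeff (ψ ρ) ℓ| ≤ c := by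
  refine (h ρ hρ ℓ hℓ).trans (mul_le_of_le_one_right hc.le ?_)
  refine Real.rpow_le_one_of_one_le_of_nonpos ?_ (by linarith)
  have : 0 ≤ ρ * (ℓ : ℝ) := mul_nonneg hρ.1.le ℓ.cast_nonneg
  linarith

/-- The approximation order condition, with any smaller exponent and for all scales. -/
theorem exists_abs_one_sub_legendreCoeff_le {ψ : ℝ → ℝ → ℝ} {σ s m : ℝ} (hs : 0 ≤ s)
    (hm : 0 ≤ m) (hmσ : m ≤ σ) (h1 : KernelOrder ψ σ) (h2 : KernelDecay ψ s) :
    ∃ A > (0 : ℝ), ∀ ρ ∈ Ioo (0 : ℝ) 1, ∀ ℓ : ℕ, 0 < ℓ →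
      |1 - legendreCoeff (ψ ρ) ℓ| ≤ A * ((ℓ : ℝ) * ρ) ^ m := by
  obtain ⟨ρ₀, hρ₀, c₁, hc₁, c₂, -, h1⟩ := h1
  obtain ⟨c, hc, h2⟩ := h2
  -- Outside the range of the order condition one has `ℓ ρ ≥ d`, where the trivial bound `1 + c` is
  -- absorbed by `((ℓ ρ) / d) ^ m`.
  set d := min (1 / 2) ρ₀ with hd
  have hd0 : 0 < d := lt_min (by norm_num) hρ₀.1
  have hA : 0 < (1 + c) * (d ^ m)⁻¹ := by positivity
  refine ⟨c₁ + (1 + c) * (d ^ m)⁻¹, by linarith, fun ρ hρ ℓ hℓ => ?_⟩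
  have hℓ1 : (1 : ℝ) ≤ ℓ := by exact_mod_cast hℓ
  have hx : 0 < (ℓ : ℝ) * ρ := mul_pos (by linarith) hρ.1
  have hxm : 0 < ((ℓ : ℝ) * ρ) ^ m := Real.rpow_pos_of_pos hx m
  have hlarge : d ≤ (ℓ : ℝ) * ρ → |1 - legendreCoeff (ψ ρ) ℓ| ≤
      (c₁ + (1 + c) * (d ^ m)⁻¹) * ((ℓ : ℝ) * ρ) ^ m := by
    intro h
    have h3 : |1 - legendreCoeff (ψ ρ) ℓ| ≤ 1 + c := by
      refine (abs_sub _ _).trans ?_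
      rw [abs_one]
      linarith [abs_legendreCoeff_le hs hc h2 hρ hℓ]
    have h4 : 1 ≤ (d ^ m)⁻¹ * ((ℓ : ℝ) * ρ) ^ m := by
      rw [← div_eq_inv_mul, one_le_div (by positivity)]
      exact Real.rpow_le_rpow hd0.le h hm
    have h5 : 1 + c ≤ (1 + c) * ((d ^ m)⁻¹ * ((ℓ : ℝ) * ρ) ^ m) :=
      le_mul_of_one_le_right (by linarith) h4
    nlinarith [mul_pos hc₁ hxm]
  rcases lt_or_ge ρ ρ₀ with hρρ | hρρ
  · obtain ⟨h3, -⟩ := h1 ρ ⟨hρ.1, hρρ⟩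
    have hinv : 0 ≤ ρ⁻¹ - 1 := by
      have := (one_lt_inv₀ hρ.1).mpr hρ.2
      linarith
    rcases le_or_gt ℓ ⌊ρ⁻¹ - 1⌋₊ with h | h
    · have h4 : (ℓ : ℝ) ≤ ρ⁻¹ - 1 := (Nat.le_floor_iff hinv).mp h
      have h5 : (ℓ : ℝ) * ρ ≤ 1 := by
        have := mul_le_mul_of_nonneg_right h4 hρ.1.le
        rw [sub_mul, inv_mul_cancel₀ hρ.1.ne'] at this
        linarith [hρ.1]
      have h6 : ((ℓ : ℝ) * ρ) ^ σ ≤ ((ℓ : ℝ) * ρ) ^ m :=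
        Real.rpow_le_rpow_of_exponent_ge hx h5 hmσ
      refine (h3 ℓ h).trans ?_
      have := mul_le_mul_of_nonneg_left h6 hc₁.le
      nlinarith [mul_pos hA hxm]
    · have h4 : ρ⁻¹ - 1 < ℓ := (Nat.floor_lt hinv).mp h
      -- Beyond the cut-off `ℓ ρ > 1 - ρ`, and `ℓ ρ ≥ ρ` because `ℓ ≥ 1`; one of the two is at least
      -- `1/2`.
      refine hlarge ((min_le_left _ _).trans ?_)
      have := mul_lt_mul_of_pos_right h4 hρ.1
      rw [sub_mul, inv_mul_cancel₀ hρ.1.ne'] at this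
      nlinarith [hρ.1]
  · refine hlarge ((min_le_right _ _).trans (hρρ.trans ?_))
    exact le_mul_of_one_le_left hρ.1.le hℓ1

/-- The growth `n^(2(σ-τ))` of the squared bound is absorbed by the difference of the two Sobolev
weights, since `n² ≤ 1 + λ_n`. -/
theorem one_add_eigen_rpow_mul_sq_le {σ τ : ℝ} (hτσ : τ ≤ σ) {A ρ x : ℝ} (hρ : 0 < ρ) {n : ℕ}
    (h : |x| ≤ A * ((n : ℝ) * ρ) ^ (σ - τ)) :
    (1 + eigen n) ^ τ * x ^ 2 ≤ (A * ρ ^ (σ - τ)) ^ 2 * (1 + eigen n) ^ σ := by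
  have h0 := one_add_eigen_pos n
  have h1 : ((n : ℝ) ^ (σ - τ)) ^ 2 ≤ (1 + eigen n) ^ (σ - τ) := by
    rw [← Real.rpow_natCast, ← Real.rpow_mul n.cast_nonneg, mul_comm,
      Real.rpow_mul n.cast_nonneg, Real.rpow_natCast]
    exact Real.rpow_le_rpow (sq_nonneg _) (sq_le_one_add_eigen n) (by linarith)
  have h2 : x ^ 2 ≤ (A * ρ ^ (σ - τ)) ^ 2 * (1 + eigen n) ^ (σ - τ) := by
    calc x ^ 2 = |x| ^ 2 := (sq_abs x).symm
      _ ≤ (A * ((n : ℝ) * ρ) ^ (σ - τ)) ^ 2 := by gcongr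
      _ = (A * ρ ^ (σ - τ)) ^ 2 * ((n : ℝ) ^ (σ - τ)) ^ 2 := by
        rw [Real.mul_rpow n.cast_nonneg hρ.le]; ring
      _ ≤ _ := mul_le_mul_of_nonneg_left h1 (sq_nonneg _)
  calc (1 + eigen n) ^ τ * x ^ 2
      ≤ (1 + eigen n) ^ τ * ((A * ρ ^ (σ - τ)) ^ 2 * (1 + eigen n) ^ (σ - τ)) :=
        mul_le_mul_of_nonneg_left h2 (Real.rpow_nonneg h0.le _)
    _ = (A * ρ ^ (σ - τ)) ^ 2 * ((1 + eigen n) ^ τ * (1 + eigen n) ^ (σ - τ)) := by ring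
    _ = _ := by rw [← Real.rpow_add h0]; congr 2; ring

/-- The decay in `1 + ρ n` matches the weight because `√(1 + λ_n) ≤ n + 1 ≤ ρ⁻¹ (1 + ρ n)`; the
price is `ρ^(-s)`. -/
theorem one_add_eigen_rpow_mul_sq_le_of_decay {s c ρ x : ℝ} (hs : 0 ≤ s)
    (hρ : ρ ∈ Ioo (0 : ℝ) 1) {n : ℕ} (h : |x| ≤ c * (1 + ρ * n) ^ (-s)) :
    (1 + eigen n) ^ s * x ^ 2 ≤ (c * ρ ^ (-s)) ^ 2 := by
  have hn : (0 : ℝ) ≤ n := n.cast_nonneg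
  have h0 : 0 < 1 + ρ * (n : ℝ) := by have := mul_nonneg hρ.1.le hn; linarith
  have h1 : (1 + eigen n) ^ s ≤ (ρ ^ (-s) * (1 + ρ * n) ^ s) ^ 2 := by
    have h2 : (n : ℝ) + 1 ≤ ρ⁻¹ * (1 + ρ * n) := by
      rw [mul_add, mul_one, ← mul_assoc, inv_mul_cancel₀ hρ.1.ne', one_mul]
      linarith [(one_lt_inv₀ hρ.1).mpr hρ.2]
    have h3 : ((n : ℝ) + 1) ^ s ≤ ρ ^ (-s) * (1 + ρ * n) ^ s := by
      rw [Real.rpow_neg hρ.1.le, ← Real.inv_rpow hρ.1.le,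
        ← Real.mul_rpow (inv_nonneg.mpr hρ.1.le) h0.le]
      exact Real.rpow_le_rpow (by linarith) h2 hs
    calc (1 + eigen n) ^ s ≤ (((n : ℝ) + 1) ^ 2) ^ s :=
          Real.rpow_le_rpow (one_add_eigen_pos n).le (one_add_eigen_le n) hs
      _ = (((n : ℝ) + 1) ^ s) ^ 2 := by
          rw [← Real.rpow_natCast, ← Real.rpow_mul (by linarith), mul_comm,
            Real.rpow_mul (by linarith), Real.rpow_natCast]
      _ ≤ _ := by gcongr
  calc (1 + eigen n) ^ s * x ^ 2
      ≤ (ρ ^ (-s) * (1 + ρ * n) ^ s) ^ 2 * (c * (1 + ρ * n) ^ (-s)) ^ 2 := by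
        rw [← sq_abs x]
        gcongr
    _ = (c * ρ ^ (-s)) ^ 2 * ((1 + ρ * n) ^ s * (1 + ρ * n) ^ (-s)) ^ 2 := by ring
    _ = _ := by rw [← Real.rpow_add h0, add_neg_cancel, Real.rpow_zero]; ring

/-! ### The error estimate -/

theorem vecSobolevTerm_nonneg (σ : ℝ) (u : S2 → E3) (ℓ : ℕ) : 0 ≤ vecSobolevTerm σ u ℓ :=
  Finset.sum_nonneg fun _ _ =>
    mul_nonneg (Real.rpow_nonneg (one_add_eigen_pos ℓ).le _) (by positivity)

theorem exists_error_bound {σ τ : ℝ} (hσ : 1 < σ) (hτ : 0 ≤ τ) (hτσ : τ ≤ σ)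
    {N : ℕ → ℕ} {X : ∀ n, Fin (N n) → S2} (hX : IsQMCDesign σ N X) {ψ : ℝ → ℝ → ℝ}
    (hψ : IsScaledZonalKernel ψ) (hψ_order : KernelOrder ψ σ) (hψ_decay : KernelDecay ψ (τ + σ)) :
    ∃ C > (0 : ℝ), ∀ ρ ∈ Ioo (0 : ℝ) 1, ∀ n : ℕ, ∀ f : C(S2, E3),
      (∀ x : S2, ⟪(x : E3), f x⟫ = 0) → MemVecSobolev σ f → ∀ c : Bool,
        MemVecSobolev τ (fun x => hodgePart c f x - quasi c (ψ ρ) (X n) f x) ∧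
        vecSobolevNorm τ (fun x => hodgePart c f x - quasi c (ψ ρ) (X n) f x) ≤
          C * (ρ ^ (σ - τ) + ρ ^ (-(τ + σ)) * (N n : ℝ) ^ (-(σ / 2))) * vecSobolevNorm σ f := by
  have hs : 0 ≤ τ + σ := by linarith
  obtain ⟨A, hA0, hA⟩ := exists_abs_one_sub_legendreCoeff_le hs (sub_nonneg.mpr hτσ)
    (by linarith : σ - τ ≤ σ) hψ_order hψ_decay
  obtain ⟨b, hb0, hb⟩ := hψ_decay
  obtain ⟨-, -, d, hd0, hd⟩ := hX
  have hP := prodConst_nonneg σ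
  set K := A ^ 2 + d ^ 2 * prodConst σ * b ^ 2 with hK
  have hK0 : 0 < K := by positivity
  -- The squared error is at most `2 (A² R² + d² P b² Q²) ‖f‖²`, where `P` is `prodConst σ` and `R`,
  -- `Q` are the two rates. Since `R, Q ≥ 0` this is at most `2 K (R + Q)² ‖f‖²`.
  refine ⟨√(2 * K), Real.sqrt_pos.mpr (by linarith), fun ρ hρ n f hf hfσ c => ?_⟩
  set u := tang f hf
  have hterm : (fun ℓ => vecSobolevTerm σ f (ℓ + 1)) = sobTerm σ u :=
    funext (vecSobolevTerm_eq_sobTerm σ hf)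
  have hfs : Summable (sobTerm σ u) := hterm ▸ hfσ.2.2
  set e := fun x => hodgePart c f x - quasi c (ψ ρ) (X n) f x with he
  set R := ρ ^ (σ - τ) with hR
  set Q := ρ ^ (-(τ + σ)) * (N n : ℝ) ^ (-(σ / 2)) with hQ
  have hR0 : 0 ≤ R := Real.rpow_nonneg hρ.1.le _
  have hQ0 : 0 ≤ Q := mul_nonneg (Real.rpow_nonneg hρ.1.le _) (Real.rpow_nonneg (N n).cast_nonneg _)
  have hS0 : 0 ≤ sobSq σ u := sobSq_nonneg _ _
  have hsum : ∀ M, ∑ ℓ ∈ Finset.range M, vecSobolevTerm τ e (ℓ + 1) ≤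
      2 * K * (R + Q) ^ 2 * sobSq σ u := by
    intro M
    refine (sum_vecSobolevTerm_error_le hσ c hψ hρ (hd n) hf hfs
      (fun ℓ => one_add_eigen_rpow_mul_sq_le hτσ hρ.1 (hA ρ hρ (ℓ + 1) ℓ.succ_pos))
      (fun ℓ => one_add_eigen_rpow_mul_sq_le_of_decay hs hρ (hb ρ hρ (ℓ + 1) ℓ.succ_pos))
      M).trans (mul_le_mul_of_nonneg_right ?_ hS0)
    have h1 : (A * R) ^ 2 + (d * (N n : ℝ) ^ (-(σ / 2))) ^ 2 * prodConst σ *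
        (b * ρ ^ (-(τ + σ))) ^ 2 = A ^ 2 * R ^ 2 + d ^ 2 * prodConst σ * b ^ 2 * Q ^ 2 := by
      rw [hQ]; ring
    have h2 : A ^ 2 * R ^ 2 + d ^ 2 * prodConst σ * b ^ 2 * Q ^ 2 ≤ K * (R + Q) ^ 2 := by
      rw [hK, add_mul]
      gcongr <;> linarith
    rw [h1]
    linarith
  have hsummable : Summable fun ℓ => vecSobolevTerm τ e (ℓ + 1) :=
    summable_of_sum_range_le (fun ℓ => vecSobolevTerm_nonneg _ _ _) hsum
  refine ⟨⟨(Lp.memLp _).sub (memLp_quasi c hψ hρ _ _), ?_, hsummable⟩, ?_⟩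
  · filter_upwards [hodgePart_mem_tangentL2 c f] with x hx
    rw [inner_sub_right, hx, inner_self_quasi, sub_zero]
  · have h1 : ∑' ℓ, vecSobolevTerm τ e (ℓ + 1) ≤ 2 * K * (R + Q) ^ 2 * sobSq σ u :=
      Real.tsum_le_of_sum_range_le (fun ℓ => vecSobolevTerm_nonneg _ _ _) hsum
    have h2 : vecSobolevNorm σ f = √(sobSq σ u) := by
      rw [vecSobolevNorm, hterm]; rfl
    rw [h2, vecSobolevNorm]
    refine (Real.sqrt_le_sqrt h1).trans_eq ?_
    rw [Real.sqrt_mul (by positivity), Real.sqrt_mul (by positivity),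
      Real.sqrt_sq (add_nonneg hR0 hQ0)]

end SphereQI

end

theorem mainTheorem8 (σ τ : ℝ) (hσ : 1 < σ) (hτ : 0 ≤ τ) (hτσ : τ ≤ σ)
    (N : ℕ → ℕ) (X : ∀ n, Fin (N n) → SphereQI.S2) (hX : SphereQI.IsQMCDesign σ N X)
    (ψ : ℝ → ℝ → ℝ) (hψ : SphereQI.IsScaledZonalKernel ψ)
    (hψ_order : SphereQI.KernelOrder ψ σ) (hψ_decay : SphereQI.KernelDecay ψ (τ + σ)) :
    ∃ C > (0 : ℝ), ∀ ρ ∈ Set.Ioo (0 : ℝ) 1, ∀ n : ℕ, ∀ f : C(SphereQI.S2, SphereQI.E3),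
      (∀ x : SphereQI.S2, inner ℝ (x : SphereQI.E3) (f x) = 0) →
      SphereQI.MemVecSobolev σ f →
        (SphereQI.MemVecSobolev τ
            (fun x => SphereQI.divPart f x - SphereQI.quasiDiv (ψ ρ) (X n) f x) ∧
          SphereQI.vecSobolevNorm τ
            (fun x => SphereQI.divPart f x - SphereQI.quasiDiv (ψ ρ) (X n) f x) ≤
              C * (ρ ^ (σ - τ) + ρ ^ (-(τ + σ)) * (N n : ℝ) ^ (-(σ / 2))) *
                SphereQI.vecSobolevNorm σ f) ∧
        (SphereQI.MemVecSobolev τ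
            (fun x => SphereQI.curlPart f x - SphereQI.quasiCurl (ψ ρ) (X n) f x) ∧
          SphereQI.vecSobolevNorm τ
            (fun x => SphereQI.curlPart f x - SphereQI.quasiCurl (ψ ρ) (X n) f x) ≤
              C * (ρ ^ (σ - τ) + ρ ^ (-(τ + σ)) * (N n : ℝ) ^ (-(σ / 2))) *
                SphereQI.vecSobolevNorm σ f) := by
  obtain ⟨C, hC, h⟩ := SphereQI.exists_error_bound hσ hτ hτσ hX hψ hψ_order hψ_decay
  exact ⟨C, hC, fun ρ hρ n f hf hfσ => ⟨h ρ hρ n f hf hfσ true, h ρ hρ n f hf hfσ false⟩⟩
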